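/- Conventions. All graphs are finite and simple. A set of vertices $S$ of a graph $G$ is called connected if $S\neq\varnothing$ and the induced subgraph $G[S]$ is connected. A plane embedding of a connected graph $H$ is given combinatorially: by a rotation system (for every vertex, a cyclic order of the edges at that vertex) for which the faces obtained by face tracing satisfy $|V|-|E|+|F|=2$ (a graph consisting of a single vertex has one face), together with the choice of one face as the outer face. The outer vertices are the vertices on the boundary walk of the outer face. Let $\mathcal R$ be a set of regions, that is, of connected sets of vertices of $G$. The support of $\mathcal R$ is the union of its regions. The region contact graph $G_{\mathcal R}$ has vertex set $\mathcal R$, and two distinct regions $R_1,R_2$ are adjacent iff there are $v_1\in R_1$, $v_2\in R_2$ with $v_1=v_2$ or $v_1v_2\in E(G)$. A cluster is a connected set of vertices; a cluster $C$ has $\mathcal R$-diameter at most $\alpha$ if any two regions of $\mathcal R$ that intersect $C$ are at distance at most $\alpha$ in $G_{\mathcal R}$. If $H$ is an induced subgraph of $G$ with a plane embedding, a region is an outer region if it contains an outer vertex of $H$. Lemma. There are absolute constants $\alpha\le 170$ and $\beta\le 3744$ and a procedure $\textsc{ClusterOuter}$ (a function of its input) such that the following holds. Let $G$ be a graph, let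 $H=G[W]$ be a connected induced subgraph of $G$ with a plane embedding (for instance, the one inherited from a plane embedding of $G$), and let $\mathcal R$ be a set of regions whose support is $V(H)=W$. Then $\textsc{ClusterOuter}(H,\mathcal R)$ is a partial partition of $V(H)$ into clusters, i.e. a set $\mathcal C$ of pairwise disjoint clusters contained in $V(H)$, and, with $V(\mathcal C)=\bigcup_{C\in\mathcal C}C$: 1. [Outer-clustered.] Every vertex of every outer region $R\in\mathcal R$ belongs to $V(\mathcal C)$. Moreover, $H[V(\mathcal C)]$ is connected. 2. [Diameter.] Every cluster $C\in\mathcal C$ has $\mathcal R$-diameter at most $\alpha$. 3. [Scattering.] For every region $R\in\mathcal R$ and any two vertices $v_a,v_b\in R$, there is a path $\Gamma$ in $G$ from $v_a$ to $v_b$ that can be written as a concatenation $\Gamma=\Gamma_1\circ\cdots\circ\Gamma_k$ of $k\le\beta$ subpaths (the vertex sequence of $\Gamma$ is the concatenation of the vertex sequences of the $\Gamma_i$, so consecutive subpaths are joined by an edge of $\Gamma$), where each $\Gamma_i$ either is contained entirely in some cluster $C\in\mathcal C$ or consists of vertices of $R$ that belong to no cluster. -/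

import Mathlib

universe u

noncomputable section

/-! ### Plane graphs

A finite connected plane graph is given by its combinatorial embedding: the cyclic order in which
the edges leave each vertex (a rotation system), subject to being of genus zero, together with the
choice of the face that is drawn as the unbounded one.  Darts are the oriented edges of a graph. -/

/-- A rotation system of `H`: a permutation of the darts which cyclically permutes, for every
vertex, the darts leaving that vertex. -/
structure RotationSystem {U : Type u} (H : SimpleGraph U) where
  /-- The next dart, in (say) clockwise order, that leaves the same vertex. -/
  next : Equiv.Perm H.Dart
  next_fst : ∀ d : H.Dart, (next d).fst = d.fst
  next_sameCycle : ∀ d d' : H.Dart, d.fst = d'.fst → next.SameCycle d d'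

/-- The corners of an embedded graph (the angular sectors at its vertices): one for every dart, at
the vertex that the dart leaves, and one for every isolated vertex. -/
abbrev Corner {U : Type u} (H : SimpleGraph U) : Type u :=
  H.Dart ⊕ {v : U // ∀ w, ¬ H.Adj v w}

/-- The vertex at which a corner sits. -/
def Corner.vertex {U : Type u} {H : SimpleGraph U} : Corner H → U
  | Sum.inl d => d.fst
  | Sum.inr v => v.1

namespace RotationSystem

variable {U : Type u} {H : SimpleGraph U}

/-- Face tracing: traverse the dart `d`, then turn to the next dart at its endpoint.  The single
corner at an isolated vertex is fixed. -/
def facePerm (ρ : RotationSystem H) : Equiv.Perm (Corner H) :=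
  Equiv.sumCongr
    ((Function.Involutive.toPerm _ SimpleGraph.Dart.symm_involutive).trans ρ.next)
    (Equiv.refl _)

/-- The faces: the cycles of the face tracing permutation. -/
def Face (ρ : RotationSystem H) : Type u :=
  Quotient (Equiv.Perm.SameCycle.setoid ρ.facePerm)

/-- The face to which a corner belongs. -/
def faceOf (ρ : RotationSystem H) (c : Corner H) : ρ.Face :=
  Quotient.mk (Equiv.Perm.SameCycle.setoid ρ.facePerm) c

end RotationSystem

/-- An embedding of the finite connected graph `H` in the plane: a rotation system of genus zero,
that is, with `|V| - |E| + |F| = 2`, and a distinguished outer face.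
(Only meant for connected `H`.) -/
structure PlaneEmbedding {U : Type u} (H : SimpleGraph U) extends RotationSystem H where
  genus_zero : Nat.card U + Nat.card toRotationSystem.Face = Nat.card H.edgeSet + 2
  outerFace : toRotationSystem.Face

/-- `v` is an outer vertex: it lies on the (boundary walk of the) outer face. -/
def PlaneEmbedding.IsOuterVertex {U : Type u} {H : SimpleGraph U} (E : PlaneEmbedding H)
    (v : U) : Prop :=
  ∃ c : Corner H, c.vertex = v ∧ E.faceOf c = E.outerFace

/-! ### Regions, contact graphs and clusters -/

/-- A set of vertices that induces a connected (in particular nonempty) subgraph.  Regions and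
clusters are sets of this kind. -/
def IsConnectedSet {V : Type u} (G : SimpleGraph V) (S : Set V) : Prop :=
  (G.induce S).Connected

/-- The region contact graph of a set `𝓡` of regions: two distinct regions are adjacent if they
share a vertex or contain adjacent vertices. -/
def contactGraph {V : Type u} (G : SimpleGraph V) (𝓡 : Set (Set V)) : SimpleGraph 𝓡 where
  Adj R₁ R₂ := R₁ ≠ R₂ ∧ ∃ v₁ ∈ R₁.1, ∃ v₂ ∈ R₂.1, v₁ = v₂ ∨ G.Adj v₁ v₂
  symm := ⟨by
    rintro R₁ R₂ ⟨hne, v₁, h₁, v₂, h₂, h⟩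
    exact ⟨hne.symm, v₂, h₂, v₁, h₁, h.imp Eq.symm fun h => h.symm⟩⟩
  loopless := ⟨fun _ h => h.1 rfl⟩

/-- `C` has `𝓡`-diameter at most `α`: any two regions that intersect `C` are at distance at most
`α` in the region contact graph (in particular, they lie in the same component of it). -/
def HasRegionDiamLE {V : Type u} (G : SimpleGraph V) (𝓡 : Set (Set V)) (C : Set V) (α : ℕ) :
    Prop :=
  ∀ R₁ R₂ : 𝓡, (R₁.1 ∩ C).Nonempty → (R₂.1 ∩ C).Nonempty →
    (contactGraph G 𝓡).edist R₁ R₂ ≤ (α : ℕ∞)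

/-- `R` is an outer region of the plane graph `H = G[W]`: it contains an outer vertex of `H`. -/
def IsOuterRegion {V : Type u} {G : SimpleGraph V} {W : Set V}
    (E : PlaneEmbedding (G.induce W)) (R : Set V) : Prop :=
  ∃ v : W, v.1 ∈ R ∧ E.IsOuterVertex v

/-- `𝒞` is a partial partition of `W` into clusters of `G`: pairwise disjoint subsets of `W`, each
inducing a connected (nonempty) subgraph. -/
def IsPartialClustering {V : Type u} (G : SimpleGraph V) (W : Set V) (𝒞 : Set (Set V)) : Prop :=
  (∀ C ∈ 𝒞, C ⊆ W ∧ IsConnectedSet G C) ∧ 𝒞.PairwiseDisjoint id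

/-- The vertex sequence `l` is safe for the region `R`: it lies in a single cluster, or it consists
of vertices of `R` that are in no cluster. -/
def IsSafe {V : Type u} (𝒞 : Set (Set V)) (R : Set V) (l : List V) : Prop :=
  (∃ C ∈ 𝒞, ∀ v ∈ l, v ∈ C) ∨ (∀ v ∈ l, v ∈ R ∧ v ∉ ⋃₀ 𝒞)

/-- `a` and `b` are joined by a path of `G` that is the concatenation of at most `β` safe subpaths.
Subpaths are given by their vertex sequences; consecutive subpaths are joined by an edge of the
path (they cannot share a vertex when they lie in different clusters). -/
def SafelyJoined {V : Type u} (G : SimpleGraph V) (𝒞 : Set (Set V)) (R : Set V) (β : ℕ)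
    (a b : V) : Prop :=
  ∃ Γ : G.Walk a b, Γ.IsPath ∧ ∃ L : List (List V), L.length ≤ β ∧ Γ.support = L.flatten ∧
    ∀ l ∈ L, l ≠ [] ∧ IsSafe 𝒞 R l

end

/-! ### Connected sets and their components -/

section ConnectedSets

variable {V : Type u} {G : SimpleGraph V} {S T P : Set V} {x y z : V}

/-! The boundary walk of the outer face is a sequence `w 0`, ..., `w (n - 1)` in convex position:
connected subsets of `W` through alternating terms must meet (`exists_outer_walk`). This is the only
use of planarity. It rests on genus zero: every cycle mod 2 is a sum of face boundaries.

Levels are measured from `w 0`, a step being a move inside a region or along an edge, so that a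
region occupies at most two consecutive levels. From each boundary vertex a chain of pods, one per
level, descends to `w 0`. A pod is connected, its vertices lie in regions touching a common center,
pods are equal or disjoint, and chains that share a pod agree below it. A chain separates `W` well
enough that a connected set meets consecutive chains (`mem_hits_of_between`). From then on the
geometry is that of intervals of integers.

Regions of least level `2 * g` or `2 * g + 1` form a band. A greedy interval cover selects some of
them, trimmed to disjoint pieces. Every chain met by a region of the band is met by a piece at most
two levels away, and two pieces suffice for each region. Pieces of odd rank overlap only pieces of
even rank in the next band. Merging them in a suitable order leaves at most 12 clusters on each
piece and keeps the clusters within distance 17 of a region (`exists_core`).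

A component of the complement of the pods is adjacent only to pods on two consecutive chains. Hence
four rounds of growth, one for each chain and each parity of the rank, extend the clusters over all
regions that meet pods, in particular the outer ones. Each round costs 7, so the distance becomes 45
and the diameter 92 (`exists_cover`).

For scattering, a connected part of a region outside the pods meets at most 44 clusters, since each
of them reaches a pod on one of two chains within a bounded window of levels (`safeWalk_pocket`). A
vertex of the region on a pod is three clusters away from one of at most 24 hub clusters. Passing
from hub to hub without repetition (`SafeWalk.of_colors`) needs at most `24 * 7 + 25 * 89 = 2393`
subpaths. -/

theorem IsConnectedSet.nonempty (h : IsConnectedSet G S) : S.Nonempty :=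
  Set.nonempty_coe_sort.1 (SimpleGraph.Connected.nonempty h)

/-- A connected set has an edge across every nontrivial cut. -/
theorem IsConnectedSet.exists_adj (h : IsConnectedSet G S) (P : Set V) (h₁ : (S ∩ P).Nonempty)
    (h₂ : (S \ P).Nonempty) : ∃ a ∈ S, ∃ b ∈ S, a ∈ P ∧ b ∉ P ∧ G.Adj a b := by
  obtain ⟨a, haS, haP⟩ := h₁
  obtain ⟨b, hbS, hbP⟩ := h₂
  obtain ⟨p⟩ := SimpleGraph.Connected.preconnected h ⟨a, haS⟩ ⟨b, hbS⟩
  obtain ⟨d, -, hd₁, hd₂⟩ := p.exists_boundary_dart {v | v.1 ∈ P} haP hbP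
  exact ⟨d.fst.1, d.fst.2, d.snd.1, d.snd.2, hd₁, hd₂, d.adj⟩

/-- Edges across cuts are the working form of connectedness: unions are then handled by following
membership in a cut instead of splicing walks. The cut used here is the set reachable from one
point. -/
theorem isConnectedSet_of_exists_adj (hne : S.Nonempty)
    (h : ∀ P : Set V, (S ∩ P).Nonempty → (S \ P).Nonempty →
      ∃ a ∈ S, ∃ b ∈ S, a ∈ P ∧ b ∉ P ∧ G.Adj a b) : IsConnectedSet G S := by
  have : Nonempty S := hne.to_subtype
  refine SimpleGraph.Connected.mk (fun a b => ?_)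
  by_contra hab
  obtain ⟨u, hu, v, hv, ⟨hu', hur⟩, hvP, huv⟩ := h
    {v | ∃ hv : v ∈ S, (G.induce S).Reachable a ⟨v, hv⟩}
    ⟨a.1, a.2, a.2, SimpleGraph.Reachable.refl _⟩ ⟨b.1, b.2, fun ⟨_, hb⟩ => hab hb⟩
  exact hvP ⟨hv, hur.trans (SimpleGraph.Adj.reachable (by simpa using huv))⟩

theorem isConnectedSet_singleton (G : SimpleGraph V) (x : V) : IsConnectedSet G {x} :=
  isConnectedSet_of_exists_adj ⟨x, rfl⟩ (by
    rintro P ⟨a, rfl, ha⟩ ⟨b, rfl, hb⟩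
    exact absurd ha hb)

/-- A union of connected sets, each of which contains or is joined to a point of a connected
member, is connected. -/
theorem IsConnectedSet.union_sUnion (hS : IsConnectedSet G S) (F : Set (Set V))
    (hF : ∀ T ∈ F, IsConnectedSet G T ∧ ∃ a ∈ S, ∃ b ∈ T, a = b ∨ G.Adj a b) :
    IsConnectedSet G (S ∪ ⋃₀ F) := by
  refine isConnectedSet_of_exists_adj hS.nonempty.inl ?_
  rintro P ⟨a, ha, haP⟩ ⟨b, hb, hbP⟩
  by_contra hcon
  push Not at hcon
  have key : ∀ T, IsConnectedSet G T → T ⊆ S ∪ ⋃₀ F → ∀ x ∈ T, ∀ y ∈ T, x ∈ P → y ∈ P := by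
    intro T hT hTs x hx y hy hxP
    by_contra hyP
    obtain ⟨u, hu, v, hv, huP, hvP, huv⟩ := hT.exists_adj P ⟨x, hx, hxP⟩ ⟨y, hy, hyP⟩
    exact hcon u (hTs hu) v (hTs hv) huP hvP huv
  have toS : ∀ x ∈ S ∪ ⋃₀ F, ∀ s ∈ S, (x ∈ P ↔ s ∈ P) := by
    rintro x (hx | ⟨T, hT, hx⟩) s hs
    · exact ⟨key S hS Set.subset_union_left x hx s hs, key S hS Set.subset_union_left s hs x hx⟩
    · obtain ⟨hTc, a', ha', b', hb', hab⟩ := hF T hT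
      have hTs : T ⊆ S ∪ ⋃₀ F := fun y hy => Or.inr ⟨T, hT, hy⟩
      have e1 : a' ∈ P ↔ b' ∈ P := by
        rcases hab with rfl | hab
        · rfl
        · constructor
          · intro h; by_contra h'
            exact hcon a' (Or.inl ha') b' (hTs hb') h h' hab
          · intro h; by_contra h'
            exact hcon b' (hTs hb') a' (Or.inl ha') h h' hab.symm
      have e2 : x ∈ P ↔ b' ∈ P := ⟨key T hTc hTs x hx b' hb', key T hTc hTs b' hb' x hx⟩
      have e3 : a' ∈ P ↔ s ∈ P := ⟨key S hS Set.subset_union_left a' ha' s hs,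
        key S hS Set.subset_union_left s hs a' ha'⟩
      rw [e2, ← e1, e3]
  obtain ⟨s, hs⟩ := hS.nonempty
  exact hbP ((toS b hb s hs).2 ((toS a ha s hs).1 haP))

theorem IsConnectedSet.union (hS : IsConnectedSet G S) (hT : IsConnectedSet G T)
    (h : ∃ a ∈ S, ∃ b ∈ T, a = b ∨ G.Adj a b) : IsConnectedSet G (S ∪ T) := by
  simpa using hS.union_sUnion {T} (by rintro _ rfl; exact ⟨hT, h⟩)

theorem IsConnectedSet.union_of_inter (hS : IsConnectedSet G S) (hT : IsConnectedSet G T)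
    (h : (S ∩ T).Nonempty) : IsConnectedSet G (S ∪ T) :=
  hS.union hT (h.elim fun a ha => ⟨a, ha.1, a, ha.2, Or.inl rfl⟩)

theorem isConnectedSet_sUnion {F : Set (Set V)} (hF : ∀ T ∈ F, IsConnectedSet G T ∧ x ∈ T)
    (hne : F.Nonempty) : IsConnectedSet G (⋃₀ F) := by
  have := (isConnectedSet_singleton G x).union_sUnion F
    (fun T hT => ⟨(hF T hT).1, x, rfl, x, (hF T hT).2, Or.inl rfl⟩)
  obtain ⟨T, hT⟩ := hne
  rwa [Set.union_eq_self_of_subset_left] at this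
  rintro _ rfl
  exact ⟨T, hT, (hF T hT).2⟩

/-- A property that is preserved along the edges of a connected set holds on all of it. -/
theorem IsConnectedSet.induction (hS : IsConnectedSet G S) {p : V → Prop}
    (hp : ∀ a ∈ S, ∀ b ∈ S, G.Adj a b → p a → p b) (hx : x ∈ S) (hy : y ∈ S) (h : p x) : p y := by
  by_contra hy'
  obtain ⟨a, ha, b, hb, hap, hbp, hab⟩ := hS.exists_adj {v | p v} ⟨x, hx, h⟩ ⟨y, hy, hy'⟩
  exact hbp (hp a ha b hb hab hap)

theorem IsConnectedSet.exists_walk (hS : IsConnectedSet G S) (hx : x ∈ S) (hy : y ∈ S) :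
    ∃ p : G.Walk x y, ∀ v ∈ p.support, v ∈ S := by
  refine hS.induction (p := fun y => ∃ p : G.Walk x y, ∀ v ∈ p.support, v ∈ S) ?_ hx hy
    ⟨SimpleGraph.Walk.nil, by simpa using hx⟩
  rintro a - b hb hab ⟨p, hp⟩
  refine ⟨p.concat hab, fun v hv => ?_⟩
  rw [SimpleGraph.Walk.support_concat, List.mem_append] at hv
  rcases hv with hv | hv
  · exact hp v hv
  · simp at hv; exact hv ▸ hb

/-- The component of `x` in the subgraph induced by `S`. -/
def compOf (G : SimpleGraph V) (S : Set V) (x : V) : Set V :=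
  ⋃₀ {T | T ⊆ S ∧ IsConnectedSet G T ∧ x ∈ T}

theorem compOf_subset : compOf G S x ⊆ S := Set.sUnion_subset fun _ hT => hT.1

theorem mem_compOf_self (hx : x ∈ S) : x ∈ compOf G S x :=
  ⟨{x}, ⟨Set.singleton_subset_iff.2 hx, isConnectedSet_singleton G x, rfl⟩, rfl⟩

theorem isConnectedSet_compOf (hx : x ∈ S) : IsConnectedSet G (compOf G S x) :=
  isConnectedSet_sUnion (fun _ hT => ⟨hT.2.1, hT.2.2⟩)
    ⟨{x}, Set.singleton_subset_iff.2 hx, isConnectedSet_singleton G x, rfl⟩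

theorem mem_of_mem_compOf (h : y ∈ compOf G S x) : x ∈ S :=
  h.elim fun _ hT => hT.1.1 hT.1.2.2

theorem IsConnectedSet.subset_compOf (hT : IsConnectedSet G T) (hTS : T ⊆ S) (hx : x ∈ T) :
    T ⊆ compOf G S x := fun _ hy => ⟨T, ⟨hTS, hT, hx⟩, hy⟩

theorem IsConnectedSet.subset_compOf' (hT : IsConnectedSet G T) (hTS : T ⊆ S)
    (h : (T ∩ compOf G S x).Nonempty) : T ⊆ compOf G S x := by
  obtain ⟨y, hy, hyc⟩ := h
  have hx := mem_of_mem_compOf hyc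
  have := (isConnectedSet_compOf (G := G) hx).union_of_inter hT ⟨y, hyc, hy⟩
  exact fun z hz => this.subset_compOf (Set.union_subset compOf_subset hTS)
    (Or.inl (mem_compOf_self hx)) (Or.inr hz)

theorem compOf_eq (h : y ∈ compOf G S x) : compOf G S y = compOf G S x := by
  have hx := mem_of_mem_compOf h
  have hy := compOf_subset h
  apply Set.Subset.antisymm
  · exact (isConnectedSet_compOf hy).subset_compOf' compOf_subset ⟨y, mem_compOf_self hy, h⟩
  · exact (isConnectedSet_compOf hx).subset_compOf compOf_subset h

theorem compOf_adj (h : y ∈ compOf G S x) (hz : z ∈ S) (hyz : G.Adj y z) : z ∈ compOf G S x := by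
  have hy := compOf_subset h
  have := (isConnectedSet_singleton G y).union (isConnectedSet_singleton G z)
    ⟨y, rfl, z, rfl, Or.inr hyz⟩
  refine this.subset_compOf' ?_ ⟨y, Or.inl rfl, h⟩ (Or.inr rfl)
  rintro _ (rfl | rfl) <;> assumption

theorem compOf_mono (h : S ⊆ T) : compOf G S x ⊆ compOf G T x :=
  Set.sUnion_subset_sUnion fun _ hU => ⟨hU.1.trans h, hU.2⟩

/-- A component of `S \ P` is joined to `P` by an edge of the connected set `S`. -/
theorem IsConnectedSet.exists_adj_compOf (hS : IsConnectedSet G S) (h : (S ∩ P).Nonempty)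
    (hx : x ∈ S) (hxP : x ∉ P) : ∃ y ∈ compOf G (S \ P) x, ∃ z ∈ S, z ∈ P ∧ G.Adj y z := by
  obtain ⟨z, hzS, hzP⟩ := h
  obtain ⟨a, ha, b, hb, ha', hb', hab⟩ := hS.exists_adj (compOf G (S \ P) x)
    ⟨x, hx, mem_compOf_self ⟨hx, hxP⟩⟩ ⟨z, hzS, fun h => (compOf_subset h).2 hzP⟩
  refine ⟨a, ha', b, hb, ?_, hab⟩
  by_contra hbP
  exact hb' (compOf_adj ha' ⟨hb, hbP⟩ hab)

end ConnectedSets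

/-! ### Genus zero: every cycle is a sum of face boundaries -/

section Planarity

open SimpleGraph Module

variable {U : Type u} {H : SimpleGraph U}

theorem SimpleGraph.finite_dart [Finite U] : Finite H.Dart :=
  Finite.of_injective _ (SimpleGraph.Dart.toProd_injective (G := H))

namespace RotationSystem

/-- The face tracing permutation on the darts. -/
def dartPerm (ρ : RotationSystem H) : Equiv.Perm H.Dart :=
  (Function.Involutive.toPerm _ SimpleGraph.Dart.symm_involutive).trans ρ.next

theorem dartPerm_apply (ρ : RotationSystem H) (d : H.Dart) : ρ.dartPerm d = ρ.next d.symm := rfl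

theorem dartPerm_fst (ρ : RotationSystem H) (d : H.Dart) : (ρ.dartPerm d).fst = d.snd :=
  ρ.next_fst d.symm

theorem facePerm_inl (ρ : RotationSystem H) (d : H.Dart) :
    ρ.facePerm (Sum.inl d) = Sum.inl (ρ.dartPerm d) := rfl

theorem faceOf_facePerm (ρ : RotationSystem H) (c : Corner H) :
    ρ.faceOf (ρ.facePerm c) = ρ.faceOf c :=
  Quotient.sound (s := Equiv.Perm.SameCycle.setoid ρ.facePerm)
    (Equiv.Perm.sameCycle_apply_left.2 (Equiv.Perm.SameCycle.refl _ _))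

/-- The face to the side of a dart. -/
def dartFace (ρ : RotationSystem H) (d : H.Dart) : ρ.Face := ρ.faceOf (Sum.inl d)

theorem dartFace_next (ρ : RotationSystem H) (d : H.Dart) :
    ρ.dartFace (ρ.next d) = ρ.dartFace d.symm := by
  have := ρ.faceOf_facePerm (Sum.inl d.symm)
  rwa [facePerm_inl, dartPerm_apply, Dart.symm_symm] at this

/-- A function on darts that is invariant under rotation at the vertices of `T` and under reversal
of the darts inside `T` is constant on the darts that leave `T`, if `T` is connected. -/
theorem eq_of_next_of_symm (ρ : RotationSystem H) {X : Type*} (ψ : H.Dart → X) {T : Set U}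
    (hT : IsConnectedSet H T) (h₁ : ∀ d : H.Dart, d.fst ∈ T → ψ (ρ.next d) = ψ d)
    (h₂ : ∀ d : H.Dart, d.fst ∈ T → d.snd ∈ T → ψ d.symm = ψ d) [Finite U]
    {d d' : H.Dart} (hd : d.fst ∈ T) (hd' : d'.fst ∈ T) : ψ d = ψ d' := by
  have hv : ∀ d d' : H.Dart, d.fst ∈ T → d'.fst = d.fst → ψ d' = ψ d := by
    intro d d' hd hdd
    have := finite_dart (H := H)
    obtain ⟨n, rfl⟩ := (ρ.next_sameCycle d d' hdd.symm).exists_nat_pow_eq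
    clear hdd
    induction n with
    | zero => rfl
    | succ n ih =>
      rw [pow_succ', Equiv.Perm.mul_apply, h₁, ih]
      have : ∀ n, ((ρ.next ^ n) d).fst = d.fst := by
        intro n
        induction n with
        | zero => rfl
        | succ n ih => rw [pow_succ', Equiv.Perm.mul_apply, next_fst, ih]
      rwa [this]
  have := hT.induction (p := fun v => ∀ d' : H.Dart, d'.fst = v → ψ d' = ψ d) ?_ hd hd'
    (fun d' h => hv d d' hd h)
  · exact (this d' rfl).symm
  · intro a ha b hb hab hpa d' hd'
    let e : H.Dart := ⟨(a, b), hab⟩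
    rw [hv e.symm d' hb hd', h₂ e ha hb]
    exact hpa e rfl

end RotationSystem

/-- A dart along a given edge. -/
noncomputable def SimpleGraph.edgeDart (e : H.edgeSet) : H.Dart :=
  ⟨(Quot.out e.1), by
    have h := e.2
    have : s((Quot.out e.1).1, (Quot.out e.1).2) = e.1 := Quot.out_eq e.1
    rw [← this] at h
    exact h⟩

theorem SimpleGraph.edge_edgeDart (e : H.edgeSet) : (edgeDart e).edge = e.1 := Quot.out_eq e.1

theorem SimpleGraph.edgeDart_eq (d : H.Dart) :
    edgeDart ⟨d.edge, d.edge_mem⟩ = d ∨ edgeDart ⟨d.edge, d.edge_mem⟩ = d.symm :=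
  dart_edge_eq_iff _ _ |>.1 (edge_edgeDart ⟨d.edge, d.edge_mem⟩)

/-- Sums over darts are sums over edges, with both orientations. -/
theorem SimpleGraph.sum_darts_eq [Fintype H.Dart] [Fintype H.edgeSet] {A : Type*} [AddCommMonoid A]
    (g : H.Dart → A) : ∑ d, g d = ∑ e : H.edgeSet, (g (edgeDart e) + g (edgeDart e).symm) := by
  classical
  rw [← Finset.sum_fiberwise (s := Finset.univ)
    (g := fun d : H.Dart => (⟨d.edge, d.edge_mem⟩ : H.edgeSet))]
  refine Finset.sum_congr rfl fun e _ => ?_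
  rw [← Finset.sum_pair (Dart.symm_ne _).symm]
  refine Finset.sum_congr ?_ fun _ _ => rfl
  ext d
  simp only [Finset.mem_filter, Finset.mem_univ, true_and, Finset.mem_insert,
    Finset.mem_singleton]
  rw [← dart_edge_eq_iff, edge_edgeDart, Subtype.ext_iff]

/-- In a connected plane graph, a function on the edges (with values in `𝔽₂`) that is orthogonal to
all coboundaries is a sum of face boundaries. -/
theorem PlaneEmbedding.exists_face_potential [Finite U] (hH : H.Connected) (E : PlaneEmbedding H)
    (hdart : Nonempty H.Dart) [Fintype H.edgeSet] (z : H.edgeSet → ZMod 2)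
    (hz : ∀ f : U → ZMod 2, ∑ e, z e * (f (edgeDart e).fst + f (edgeDart e).snd) = 0) :
    ∃ φ : E.Face → ZMod 2, ∀ d : H.Dart,
      φ (E.dartFace d) + φ (E.dartFace d.symm) = z ⟨d.edge, d.edge_mem⟩ := by
  classical
  have := Fintype.ofFinite U
  have := finite_dart (H := H)
  have := Fintype.ofFinite H.Dart
  have : Finite (Corner H) := inferInstance
  have : Finite E.Face := Quotient.finite _
  have := Fintype.ofFinite E.Face
  have : Nonempty U := hH.nonempty
  have huniv : IsConnectedSet H Set.univ :=
    isConnectedSet_of_exists_adj Set.univ_nonempty (by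
      rintro P ⟨a, -, ha⟩ ⟨b, -, hb⟩
      obtain ⟨p⟩ := hH.preconnected a b
      obtain ⟨d, -, hd₁, hd₂⟩ := p.exists_boundary_dart P ha hb
      exact ⟨d.fst, trivial, d.snd, trivial, hd₁, hd₂, d.adj⟩)
  let M : Matrix H.edgeSet U (ZMod 2) := Matrix.of fun e v =>
    (if (edgeDart e).fst = v then 1 else 0) + (if (edgeDart e).snd = v then 1 else 0)
  have hM : ∀ f e, M.mulVecLin f e = f (edgeDart e).fst + f (edgeDart e).snd := by
    intro f e
    rw [Matrix.mulVecLin_apply]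
    simp [M, Matrix.mulVec, dotProduct, add_mul, Finset.sum_add_distrib]
  let N : (E.Face → ZMod 2) →ₗ[ZMod 2] (H.edgeSet → ZMod 2) :=
    { toFun := fun φ e => φ (E.dartFace (edgeDart e)) + φ (E.dartFace (edgeDart e).symm)
      map_add' := by intro a b; ext e; simp; ring
      map_smul' := by intro a b; ext e; simp; ring }
  have hNd : ∀ φ (d : H.Dart), N φ ⟨d.edge, d.edge_mem⟩ =
      φ (E.dartFace d) + φ (E.dartFace d.symm) := by
    intro φ d
    rcases edgeDart_eq d with h | h
    · simp [N, h]
    · simp [N, h, add_comm]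
  have two : ∀ a : ZMod 2, a + a = 0 := CharTwo.add_self_eq_zero
  have eq_of_add : ∀ a b : ZMod 2, a + b = 0 → a = b := fun a b h => CharTwo.add_eq_zero.1 h
  -- the kernels consist of constants
  have hker1 : finrank (ZMod 2) (LinearMap.ker M.mulVecLin) ≤ 1 := by
    have hle : LinearMap.ker M.mulVecLin ≤ Submodule.span (ZMod 2) {fun _ => 1} := by
      intro f hf
      rw [LinearMap.mem_ker] at hf
      have hadj : ∀ a b, H.Adj a b → f a = f b := by
        intro a b hab
        let d : H.Dart := ⟨(a, b), hab⟩
        have := congrFun hf ⟨d.edge, d.edge_mem⟩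
        rw [hM] at this
        rcases edgeDart_eq d with h | h
        · rw [h] at this; exact eq_of_add _ _ this
        · rw [h] at this; exact (eq_of_add _ _ this).symm
      obtain ⟨v₀⟩ := ‹Nonempty U›
      rw [Submodule.mem_span_singleton]
      refine ⟨f v₀, ?_⟩
      ext v
      have := huniv.induction (p := fun v => f v = f v₀) (x := v₀) (y := v)
        (fun a _ b _ hab h => (hadj a b hab).symm.trans h) trivial trivial rfl
      simp [this]
    exact (Submodule.finrank_mono hle).trans ((finrank_span_le_card _).trans (by simp))
  have hker2 : finrank (ZMod 2) (LinearMap.ker N) ≤ 1 := by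
    have hle : LinearMap.ker N ≤ Submodule.span (ZMod 2) {fun _ => 1} := by
      intro φ hφ
      rw [LinearMap.mem_ker] at hφ
      -- An element of the kernel agrees on the two sides of every edge, hence on all darts at a
      -- vertex by rotation, hence everywhere by connectedness.
      have hs : ∀ d : H.Dart, φ (E.dartFace d.symm) = φ (E.dartFace d) := fun d => by
        have := congrFun hφ ⟨d.edge, d.edge_mem⟩
        rw [hNd] at this
        exact (eq_of_add _ _ this).symm
      obtain ⟨d₀⟩ := hdart
      rw [Submodule.mem_span_singleton]
      refine ⟨φ (E.dartFace d₀), ?_⟩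
      ext F
      obtain ⟨c, rfl⟩ := Quotient.exists_rep F
      have : φ (E.faceOf c) = φ (E.dartFace d₀) := by
        rcases c with d | ⟨v, hv⟩
        · exact E.eq_of_next_of_symm (fun d => φ (E.dartFace d)) huniv
            (fun d _ => by rw [E.dartFace_next, hs]) (fun d _ _ => hs d) trivial trivial
        · exfalso
          have hne : ∃ u, u ≠ v := by
            by_cases h : d₀.fst = v
            · exact ⟨d₀.snd, fun h' => d₀.adj.ne (h.trans h'.symm)⟩
            · exact ⟨_, h⟩
          obtain ⟨u, hu⟩ := hne
          obtain ⟨a, -, b, -, ha, -, hab⟩ := huniv.exists_adj {v} ⟨v, trivial, rfl⟩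
            ⟨u, trivial, hu⟩
          rw [Set.mem_singleton_iff] at ha
          exact hv b (ha ▸ hab)
      exact (show φ _ * 1 = _ from (mul_one _).trans this.symm)
    exact (Submodule.finrank_mono hle).trans ((finrank_span_le_card _).trans (by simp))
  have hrM := LinearMap.finrank_range_add_finrank_ker M.mulVecLin
  have hrT := LinearMap.finrank_range_add_finrank_ker M.transpose.mulVecLin
  have hrN := LinearMap.finrank_range_add_finrank_ker N
  have htr : finrank (ZMod 2) (LinearMap.range M.transpose.mulVecLin) =
      finrank (ZMod 2) (LinearMap.range M.mulVecLin) := Matrix.rank_transpose M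
  simp only [finrank_fintype_fun_eq_card] at hrM hrT hrN
  have hg := E.genus_zero
  rw [Nat.card_eq_fintype_card, Nat.card_eq_fintype_card, Nat.card_eq_fintype_card] at hg
  have hpair : ∀ (x : H.edgeSet → ZMod 2), x ∈ LinearMap.ker M.transpose.mulVecLin ↔
      ∀ f : U → ZMod 2, ∑ e, x e * (f (edgeDart e).fst + f (edgeDart e).snd) = 0 := by
    intro x
    have h1 : ∀ f : U → ZMod 2, ∑ e, x e * (f (edgeDart e).fst + f (edgeDart e).snd) =
        M.transpose.mulVecLin x ⬝ᵥ f := by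
      intro f
      rw [Matrix.mulVecLin_apply, Matrix.mulVec_transpose, ← Matrix.dotProduct_mulVec]
      refine Finset.sum_congr rfl fun e _ => ?_
      rw [← Matrix.mulVecLin_apply, hM]
    simp only [h1, LinearMap.mem_ker]
    constructor
    · intro h f; rw [h, zero_dotProduct]
    · intro h; exact dotProduct_eq_zero _ h
  -- Face boundaries are cycles: in the sum over darts every corner is counted twice, because the
  -- face after rotating a dart is the face behind it.
  have hle : LinearMap.range N ≤ LinearMap.ker M.transpose.mulVecLin := by
    rintro _ ⟨φ, rfl⟩
    rw [hpair]
    intro f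
    have h1 := sum_darts_eq (fun d : H.Dart =>
      f d.fst * (φ (E.dartFace d) + φ (E.dartFace d.symm)))
    have h2 : ∑ d : H.Dart, f d.fst * (φ (E.dartFace d) + φ (E.dartFace d.symm)) = 0 := by
      simp only [mul_add, Finset.sum_add_distrib]
      have h3 : ∑ d : H.Dart, f d.fst * φ (E.dartFace d.symm) =
          ∑ d : H.Dart, f d.fst * φ (E.dartFace d) := by
        rw [← Equiv.sum_comp E.next (fun d => f d.fst * φ (E.dartFace d))]
        refine Finset.sum_congr rfl fun d _ => ?_
        rw [E.next_fst, E.dartFace_next]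
      rw [h3, two]
    rw [h2] at h1
    rw [h1]
    refine Finset.sum_congr rfl fun e _ => ?_
    simp only [N, LinearMap.coe_mk, AddHom.coe_mk, Dart.symm_symm]
    change _ = _ + f (edgeDart e).snd * _
    ring
  -- Boundaries have dimension at least `|F| - 1` and cycles at most `|E| - |V| + 1`. Euler's
  -- formula makes these bounds equal.
  have heq := Submodule.eq_of_le_of_finrank_le hle (by omega)
  have hzm := (hpair z).2 hz
  rw [← heq] at hzm
  obtain ⟨φ, hφ⟩ := hzm
  exact ⟨φ, fun d => by rw [← hNd, hφ]⟩

theorem SimpleGraph.sum_edge_single [Fintype H.edgeSet] [DecidableEq (Sym2 U)] (f : U → ZMod 2)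
    (d : H.Dart) : ∑ e : H.edgeSet, (if d.edge = e.1 then (1 : ZMod 2) else 0) *
      (f (edgeDart e).fst + f (edgeDart e).snd) = f d.fst + f d.snd := by
  rw [Finset.sum_eq_single ⟨d.edge, d.edge_mem⟩]
  · rcases edgeDart_eq d with h | h
    · simp [h]
    · simp [h, add_comm]
  · intro e _ he
    rw [if_neg (fun h => he (Subtype.ext h.symm)), zero_mul]
  · simp

/-- The chain of a walk: its coboundary pairing is the sum of the values at the ends. -/
theorem SimpleGraph.Walk.exists_chain [Fintype H.edgeSet] {a b : U} (p : H.Walk a b) :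
    ∃ z : H.edgeSet → ZMod 2,
      (∀ f : U → ZMod 2, ∑ e, z e * (f (edgeDart e).fst + f (edgeDart e).snd) = f a + f b) ∧
      ∀ d : H.Dart, d.fst ∉ p.support → z ⟨d.edge, d.edge_mem⟩ = 0 := by
  classical
  induction p with
  | nil => exact ⟨0, fun f => by simp [CharTwo.add_self_eq_zero], fun _ _ => rfl⟩
  | @cons u v w h p ih =>
    obtain ⟨z, hz, hz'⟩ := ih
    let d : H.Dart := ⟨(u, v), h⟩
    refine ⟨fun e => (if d.edge = e.1 then 1 else 0) + z e, fun f => ?_, fun d' hd' => ?_⟩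
    · simp only [add_mul, Finset.sum_add_distrib]
      rw [sum_edge_single, hz]
      change f u + f v + (f v + f w) = _
      rw [add_assoc, ← add_assoc (f v), CharTwo.add_self_eq_zero, zero_add]
    · rw [Walk.support_cons, List.mem_cons, not_or] at hd'
      dsimp only
      rw [hz' d' hd'.2, add_zero, if_neg]
      intro he
      rcases (dart_edge_eq_iff d d').1 he with h' | h'
      · exact hd'.1 (by rw [← h'])
      · apply hd'.2
        have : d'.fst = v := by
          have := congrArg (fun e : H.Dart => e.snd) h'
          exact this.symm
        rw [this]
        exact p.start_mem_support

/-- Darts on one face of a connected plane graph do not cross: connected vertex sets through the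
tails of alternating darts of a facial walk intersect. -/
theorem PlaneEmbedding.inter_nonempty_of_alternate [Finite U] (hH : H.Connected)
    (E : PlaneEmbedding H) (d₀ : H.Dart) {j k l : ℕ} (hjk : j < k) (hkl : k < l)
    (hl : l < Function.minimalPeriod E.dartPerm d₀) {S T : Set U} (hS : IsConnectedSet H S)
    (hT : IsConnectedSet H T) (h0 : d₀.fst ∈ S) (hkS : (E.dartPerm^[k] d₀).fst ∈ S)
    (hjT : (E.dartPerm^[j] d₀).fst ∈ T) (hlT : (E.dartPerm^[l] d₀).fst ∈ T) :
    (S ∩ T).Nonempty := by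
  classical
  have := Fintype.ofFinite U
  have hfin := finite_dart (H := H)
  have := Fintype.ofFinite H.Dart
  by_contra hST
  have hdisj : ∀ v ∈ T, v ∉ S := fun v hvT hvS => hST ⟨v, hvS, hvT⟩
  have two : ∀ a : ZMod 2, a + a = 0 := CharTwo.add_self_eq_zero
  set d : ℕ → H.Dart := fun t => E.dartPerm^[t] d₀ with hd
  have hdsucc : ∀ t, d (t + 1) = E.dartPerm (d t) := fun t => Function.iterate_succ_apply' _ _ _
  obtain ⟨p, hp⟩ := hS.exists_walk hkS h0
  obtain ⟨z, hz, hzs⟩ := p.exists_chain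
  -- `a` is the indicator of the first `k` darts of the facial walk and `y` its image on unoriented
  -- edges. Closed up by the walk `p` inside `S`, this stretch becomes a cycle.
  let a : H.Dart → ZMod 2 := fun e => ∑ t ∈ Finset.range k, if d t = e then 1 else 0
  let y : H.edgeSet → ZMod 2 := fun e => ∑ t ∈ Finset.range k, if (d t).edge = e.1 then 1 else 0
  have hy : ∀ e : H.Dart, y ⟨e.edge, e.edge_mem⟩ = a e + a e.symm := by
    intro e
    simp only [y, a, ← Finset.sum_add_distrib]
    refine Finset.sum_congr rfl fun t _ => ?_
    by_cases h1 : d t = e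
    · have : d t ≠ e.symm := fun h => Dart.symm_ne e (h.symm.trans h1)
      simp [h1, (Dart.symm_ne e).symm]
    · by_cases h2 : d t = e.symm
      · simp [h2, Dart.symm_ne e]
      · rw [if_neg h1, if_neg h2, if_neg, add_zero]
        rw [dart_edge_eq_iff]
        exact not_or.2 ⟨h1, h2⟩
  have hyb : ∀ f : U → ZMod 2, ∑ e, y e * (f (edgeDart e).fst + f (edgeDart e).snd) =
      f (d 0).fst + f (d k).fst := by
    intro f
    simp only [y, Finset.sum_mul]
    rw [Finset.sum_comm]
    simp only [sum_edge_single]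
    have : ∀ k, ∑ t ∈ Finset.range k, (f (d t).fst + f (d t).snd) =
        f (d 0).fst + f (d k).fst := by
      intro k
      induction k with
      | zero => simp [two]
      | succ k ih =>
        rw [Finset.sum_range_succ, ih, hdsucc, E.dartPerm_fst, add_assoc, ← add_assoc (f (d k).fst),
          two, zero_add]
    exact this k
  obtain ⟨φ, hφ⟩ := E.exists_face_potential hH ⟨d₀⟩ (fun e => z e + y e) (by
    intro f
    simp only [add_mul, Finset.sum_add_distrib]
    rw [hz, hyb, add_comm (f (d 0).fst)]
    exact two _)
  have hzT : ∀ e : H.Dart, e.fst ∈ T → z ⟨e.edge, e.edge_mem⟩ = 0 :=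
    fun e he => hzs e fun h => hdisj _ he (hp _ h)
  -- Shifting the stretch by one dart changes the count only at its two ends, whose tails lie in `S`
  -- and so not in `T`.
  have ha : ∀ e : H.Dart, (E.dartPerm e).fst ∈ T → a (E.dartPerm e) = a e := by
    intro e he
    have h1 : a (E.dartPerm e) + (if d k = E.dartPerm e then 1 else 0) =
        (∑ t ∈ Finset.range k, if d (t + 1) = E.dartPerm e then 1 else 0) +
          if d 0 = E.dartPerm e then 1 else 0 := by
      have h2 := Finset.sum_range_succ' (fun t => if d t = E.dartPerm e then (1 : ZMod 2) else 0) k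
      rw [Finset.sum_range_succ] at h2
      exact h2
    rw [if_neg, if_neg, add_zero, add_zero] at h1
    · rw [h1]
      refine Finset.sum_congr rfl fun t _ => ?_
      rw [hdsucc]
      simp only [EmbeddingLike.apply_eq_iff_eq]
    · intro h; rw [← h] at he; exact hdisj _ he h0
    · intro h; rw [← h] at he; exact hdisj _ he hkS
  -- On the darts leaving `T` the cycle is given by `a` alone, so the face potential corrected by
  -- `a` changes neither under rotation nor under reversal. But `d j` and `d l` are on the same
  -- face, and only the first is in the stretch.
  have hconst := E.eq_of_next_of_symm (fun e => φ (E.dartFace e) + a e) hT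
    (by
      intro e he
      have h1 := ha e.symm (by rw [E.dartPerm_apply, Dart.symm_symm, E.next_fst]; exact he)
      rw [E.dartPerm_apply, Dart.symm_symm] at h1
      have h2 := hφ e
      rw [hzT e he, hy, zero_add] at h2
      rw [E.dartFace_next, h1]
      apply CharTwo.add_eq_zero.1
      rw [show φ (E.dartFace e.symm) + a e.symm + (φ (E.dartFace e) + a e) =
        φ (E.dartFace e) + φ (E.dartFace e.symm) + (a e + a e.symm) by ring, h2, two])
    (by
      intro e he _
      have h2 := hφ e
      rw [hzT e he, hy, zero_add] at h2
      apply CharTwo.add_eq_zero.1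
      rw [show φ (E.dartFace e.symm) + a e.symm + (φ (E.dartFace e) + a e) =
        φ (E.dartFace e) + φ (E.dartFace e.symm) + (a e + a e.symm) by ring, h2, two])
    (d := d j) (d' := d l) hjT hlT
  have hface : ∀ t, E.dartFace (d t) = E.dartFace d₀ := by
    intro t
    induction t with
    | zero => rfl
    | succ t ih => rw [hdsucc, ← ih]; exact E.faceOf_facePerm (Sum.inl (d t))
  rw [hface, hface, add_right_inj] at hconst
  have hinj : ∀ s < Function.minimalPeriod E.dartPerm d₀, ∀ t < Function.minimalPeriod E.dartPerm d₀,
      d s = d t → s = t := fun s hs t ht h =>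
    Function.iterate_injOn_Iio_minimalPeriod hs ht h
  have h1 : a (d j) = 1 := by
    simp only [a]
    rw [Finset.sum_eq_single j]
    · simp
    · intro t ht htj
      rw [Finset.mem_range] at ht
      exact if_neg fun h => htj (hinj _ (by omega) _ (by omega) h)
    · intro h; exact absurd (Finset.mem_range.2 hjk) h
  have h2 : a (d l) = 0 := by
    refine Finset.sum_eq_zero fun t ht => if_neg fun h => ?_
    rw [Finset.mem_range] at ht
    have := hinj _ (by omega) _ hl h
    omega
  rw [h1, h2] at hconst
  exact one_ne_zero hconst

/-- The outer vertices of a connected plane graph, in the order of the outer boundary walk, are in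
convex position. -/
theorem PlaneEmbedding.exists_outer_walk {V : Type u} [Finite V] {G : SimpleGraph V} {W : Set V}
    (hW : IsConnectedSet G W) (E : PlaneEmbedding (G.induce W)) :
    ∃ (n : ℕ) (w : ℕ → V), 0 < n ∧ (∀ t, w t ∈ W) ∧
      (∀ v : W, E.IsOuterVertex v → ∃ t < n, w t = v.1) ∧
      ∀ j k l, 0 < j → j < k → k < l → l < n → ∀ S ⊆ W, ∀ T ⊆ W, IsConnectedSet G S →
        IsConnectedSet G T → w 0 ∈ S → w k ∈ S → w j ∈ T → w l ∈ T → (S ∩ T).Nonempty := by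
  classical
  have := finite_dart (H := G.induce W)
  obtain ⟨c₀, hc₀⟩ := Quotient.exists_rep E.outerFace
  have hout : ∀ v, E.IsOuterVertex v → ∃ c, Corner.vertex c = v ∧ E.facePerm.SameCycle c₀ c := by
    rintro v ⟨c, hc, hcf⟩
    rw [← hc₀] at hcf
    exact ⟨c, hc, (Quotient.exact (s := Equiv.Perm.SameCycle.setoid E.facePerm) hcf).symm⟩
  rcases c₀ with d₀ | ⟨v₀, hv₀⟩
  · refine ⟨Function.minimalPeriod E.dartPerm d₀, fun t => (E.dartPerm^[t] d₀).fst.1, ?_,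
      fun t => Subtype.coe_prop _, ?_, ?_⟩
    · obtain ⟨m, hm, hm'⟩ := isOfFinOrder_iff_pow_eq_one.1 (isOfFinOrder_of_finite E.dartPerm)
      refine Function.minimalPeriod_pos_of_mem_periodicPts ⟨m, hm, ?_⟩
      change E.dartPerm^[m] d₀ = d₀
      rw [← Equiv.Perm.coe_pow, hm', Equiv.Perm.one_apply]
    · intro v hv
      obtain ⟨c, hc, hcf⟩ := hout v hv
      obtain ⟨m, hm⟩ := hcf.exists_nat_pow_eq
      have hm' : ∀ m, (E.facePerm ^ m) (Sum.inl d₀) = Sum.inl (E.dartPerm^[m] d₀) := by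
        intro m
        induction m with
        | zero => rfl
        | succ m ih => rw [pow_succ', Equiv.Perm.mul_apply, ih, Function.iterate_succ_apply']; rfl
      obtain ⟨q, hq, hq'⟩ := isOfFinOrder_iff_pow_eq_one.1 (isOfFinOrder_of_finite E.dartPerm)
      have hpos : 0 < Function.minimalPeriod E.dartPerm d₀ := by
        refine Function.minimalPeriod_pos_of_mem_periodicPts ⟨q, hq, ?_⟩
        change E.dartPerm^[q] d₀ = d₀
        rw [← Equiv.Perm.coe_pow, hq', Equiv.Perm.one_apply]
      refine ⟨m % Function.minimalPeriod E.dartPerm d₀, Nat.mod_lt _ hpos, ?_⟩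
      dsimp only
      rw [Function.iterate_mod_minimalPeriod_eq, ← hc, ← hm, hm' m]
      rfl
    · intro j k l _ hjk hkl hl S hSW T hTW hS hT h0 hk hj' hl'
      have hpre : ∀ S ⊆ W, IsConnectedSet G S →
          IsConnectedSet (G.induce W) {v : W | v.1 ∈ S} := by
        intro S hSW hS
        obtain ⟨s, hs⟩ := hS.nonempty
        refine isConnectedSet_of_exists_adj ⟨⟨s, hSW hs⟩, hs⟩ ?_
        rintro P ⟨a, ha, haP⟩ ⟨b, hb, hbP⟩
        obtain ⟨x, hx, y, hy, ⟨hxW, hxP⟩, hyP, hxy⟩ := hS.exists_adj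
          {v | ∃ h : v ∈ W, (⟨v, h⟩ : W) ∈ P} ⟨a.1, ha, a.2, haP⟩
          ⟨b.1, hb, fun ⟨_, h⟩ => hbP h⟩
        exact ⟨⟨x, hxW⟩, hx, ⟨y, hSW hy⟩, hy, hxP, fun h => hyP ⟨_, h⟩, hxy⟩
      obtain ⟨v, hv, hv'⟩ := E.inter_nonempty_of_alternate hW d₀ hjk hkl hl (hpre S hSW hS)
        (hpre T hTW hT) h0 hk hj' hl'
      exact ⟨v.1, hv, hv'⟩
  · refine ⟨1, fun _ => v₀.1, one_pos, fun _ => v₀.2, ?_, by omega⟩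
    intro v hv
    obtain ⟨c, hc, hcf⟩ := hout v hv
    obtain ⟨m, hm⟩ := hcf
    have hm' : (E.facePerm ^ m) (Sum.inr ⟨v₀, hv₀⟩) = Sum.inr ⟨v₀, hv₀⟩ :=
      (Equiv.Perm.zpow_apply_eq_self_of_apply_eq_self rfl m)
    rw [hm'] at hm
    refine ⟨0, one_pos, ?_⟩
    rw [← hc, ← hm]
    rfl

end Planarity

/-! ### Distances in the region contact graph -/

section ContactDist

variable {V : Type u} {G : SimpleGraph V} {𝓡 : Set (Set V)} {R R' R'' X : Set V} {k l : ℕ}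
  {v : V}

/-- Two regions are at distance at most `k` in the region contact graph. -/
def ContactDistLE (G : SimpleGraph V) (𝓡 : Set (Set V)) (k : ℕ) (R R' : Set V) : Prop :=
  ∃ (h : R ∈ 𝓡) (h' : R' ∈ 𝓡), (contactGraph G 𝓡).edist ⟨R, h⟩ ⟨R', h'⟩ ≤ (k : ℕ∞)

theorem ContactDistLE.refl (h : R ∈ 𝓡) : ContactDistLE G 𝓡 0 R R := ⟨h, h, by simp⟩

theorem ContactDistLE.symm (h : ContactDistLE G 𝓡 k R R') : ContactDistLE G 𝓡 k R' R := by
  obtain ⟨h₁, h₂, h⟩ := h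
  exact ⟨h₂, h₁, by rwa [SimpleGraph.edist_comm]⟩

theorem ContactDistLE.trans (h : ContactDistLE G 𝓡 k R R') (h' : ContactDistLE G 𝓡 l R' R'') :
    ContactDistLE G 𝓡 (k + l) R R'' := by
  obtain ⟨h₁, h₂, h⟩ := h
  obtain ⟨_, h₃, h'⟩ := h'
  refine ⟨h₁, h₃, (SimpleGraph.edist_triangle (v := ⟨R', h₂⟩)).trans ?_⟩
  push_cast
  exact add_le_add h h'

theorem ContactDistLE.mono (h : ContactDistLE G 𝓡 k R R') (hkl : k ≤ l) :
    ContactDistLE G 𝓡 l R R' := by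
  obtain ⟨h₁, h₂, h⟩ := h
  exact ⟨h₁, h₂, h.trans (by exact_mod_cast hkl)⟩

theorem ContactDistLE.of_touch (h : R ∈ 𝓡) (h' : R' ∈ 𝓡) {x y : V} (hx : x ∈ R) (hy : y ∈ R')
    (hxy : x = y ∨ G.Adj x y) : ContactDistLE G 𝓡 1 R R' := by
  by_cases hR : R = R'
  · subst hR
    exact (ContactDistLE.refl h).mono zero_le_one
  · refine ⟨h, h', ?_⟩
    have : (contactGraph G 𝓡).Adj ⟨R, h⟩ ⟨R', h'⟩ :=
      ⟨fun he => hR (congrArg Subtype.val he), x, hx, y, hy, hxy⟩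
    rw [SimpleGraph.edist_eq_one_iff_adj.2 this, Nat.cast_one]

theorem ContactDistLE.left_mem (h : ContactDistLE G 𝓡 k R R') : R ∈ 𝓡 := h.1

theorem ContactDistLE.right_mem (h : ContactDistLE G 𝓡 k R R') : R' ∈ 𝓡 := h.2.1

/-- The vertex `v` lies in a region at distance at most `k` from the region `X`. -/
def NearRegion (G : SimpleGraph V) (𝓡 : Set (Set V)) (k : ℕ) (v : V) (X : Set V) : Prop :=
  ∃ R, v ∈ R ∧ ContactDistLE G 𝓡 k R X

theorem NearRegion.mono (h : NearRegion G 𝓡 k v X) (hkl : k ≤ l) : NearRegion G 𝓡 l v X :=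
  h.imp fun _ h => ⟨h.1, h.2.mono hkl⟩

theorem NearRegion.trans (h : NearRegion G 𝓡 k v X) (h' : ContactDistLE G 𝓡 l X R) :
    NearRegion G 𝓡 (k + l) v R :=
  h.imp fun _ h => ⟨h.1, h.2.trans h'⟩

/-- Any region through a vertex that lies near `X`, or through a neighbour of it, is near `X`. -/
theorem NearRegion.contactDistLE (h : NearRegion G 𝓡 k v X) (hR : R ∈ 𝓡) {x : V} (hx : x ∈ R)
    (hxv : x = v ∨ G.Adj x v) : ContactDistLE G 𝓡 (k + 1) R X := by
  obtain ⟨R', hv, h⟩ := h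
  exact ((ContactDistLE.of_touch hR h.left_mem hx hv hxv).trans h).mono (by omega)

/-- Two regions that meet the cluster are each at distance at most `k + 1` from `X`. -/
theorem hasRegionDiamLE_of_nearRegion {C : Set V} (h : ∀ v ∈ C, NearRegion G 𝓡 k v X) :
    HasRegionDiamLE G 𝓡 C (2 * k + 2) := by
  rintro R₁ R₂ ⟨x, hx, hxC⟩ ⟨y, hy, hyC⟩
  obtain ⟨_, _, h'⟩ := (((h x hxC).contactDistLE R₁.2 hx (Or.inl rfl)).trans
    ((h y hyC).contactDistLE R₂.2 hy (Or.inl rfl)).symm).mono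
      (show k + 1 + (k + 1) ≤ 2 * k + 2 by omega)
  exact h'

end ContactDist

/-! ### Levels -/

section Levels

variable {V : Type u} {G : SimpleGraph V} {W : Set V} {𝓡 : Set (Set V)}

/-- A connected set `W` covered by connected regions, with a cyclic sequence `w 0, …, w (n - 1)` of
vertices in convex position, and the levels of the vertices: their distances from `w 0` when
passing from a vertex to another one of the same region, or to a neighbour, counts as a step. -/
structure Layout (G : SimpleGraph V) (W : Set V) (𝓡 : Set (Set V)) where
  /-- The number of boundary positions. -/
  n : ℕ
  /-- The boundary vertices. -/
  w : ℕ → V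
  /-- The level of a vertex. -/
  level : V → ℕ
  n_pos : 0 < n
  w_mem : ∀ t, w t ∈ W
  noncrossing : ∀ j k l, 0 < j → j < k → k < l → l < n → ∀ S ⊆ W, ∀ T ⊆ W, IsConnectedSet G S →
    IsConnectedSet G T → w 0 ∈ S → w k ∈ S → w j ∈ T → w l ∈ T → (S ∩ T).Nonempty
  region_conn : ∀ R ∈ 𝓡, IsConnectedSet G R
  cover : ⋃₀ 𝓡 = W
  level_w_zero : level (w 0) = 0
  eq_of_level_zero : ∀ v ∈ W, level v = 0 → v = w 0
  level_adj : ∀ u ∈ W, ∀ v ∈ W, G.Adj u v → level u ≤ level v + 1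
  level_region : ∀ R ∈ 𝓡, ∀ u ∈ R, ∀ v ∈ R, level u ≤ level v + 1
  exists_leg : ∀ v ∈ W, 0 < level v → ∃ S, IsConnectedSet G S ∧ v ∈ S ∧
    (∀ x ∈ S, level x = level v) ∧ (∃ R ∈ 𝓡, S ⊆ R) ∧
      ∃ x ∈ S, ∃ y ∈ W, G.Adj x y ∧ level y + 1 = level v

/-- The level is the distance from `w 0` in the auxiliary graph `Γ`, where a shared region or an
edge of `G` inside `W` counts as adjacency. A predecessor in `Γ` may be far away in `G`, but then it
shares a region with `v`, and the part of that region on the level of `v` serves as a leg. -/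
theorem exists_layout [Finite V] (E : PlaneEmbedding (G.induce W)) (hW : IsConnectedSet G W)
    (h𝓡 : ∀ R ∈ 𝓡, IsConnectedSet G R) (hcover : ⋃₀ 𝓡 = W) :
    ∃ L : Layout G W 𝓡, ∀ v : W, E.IsOuterVertex v → ∃ t < L.n, L.w t = v.1 := by
  obtain ⟨n, w, hn, hw, hout, hnc⟩ := E.exists_outer_walk hW
  let Γ : SimpleGraph V :=
    { Adj := fun u v => u ≠ v ∧ ((∃ R ∈ 𝓡, u ∈ R ∧ v ∈ R) ∨ (u ∈ W ∧ v ∈ W ∧ G.Adj u v))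
      symm := ⟨by
        rintro u v ⟨h, ⟨R, hR, h1, h2⟩ | ⟨h1, h2, h3⟩⟩
        · exact ⟨h.symm, Or.inl ⟨R, hR, h2, h1⟩⟩
        · exact ⟨h.symm, Or.inr ⟨h2, h1, h3.symm⟩⟩⟩
      loopless := ⟨fun _ h => h.1 rfl⟩ }
  have hreach : ∀ v ∈ W, Γ.Reachable (w 0) v := fun v hv =>
    hW.induction (p := fun v => Γ.Reachable (w 0) v)
      (fun a ha b hb hab h => h.trans (SimpleGraph.Adj.reachable ⟨hab.ne, Or.inr ⟨ha, hb, hab⟩⟩))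
      (hw 0) hv (SimpleGraph.Reachable.refl _)
  have hstep : ∀ u ∈ W, ∀ v ∈ W, Γ.Adj u v → Γ.dist (w 0) u ≤ Γ.dist (w 0) v + 1 := by
    intro u _ v hv huv
    obtain ⟨p, hp⟩ := (hreach v hv).exists_walk_length_eq_dist
    rw [← hp]
    simpa using SimpleGraph.dist_le (p.concat huv.symm)
  have hRW : ∀ R ∈ 𝓡, R ⊆ W := fun R hR => hcover ▸ Set.subset_sUnion_of_mem hR
  have hreg : ∀ R ∈ 𝓡, ∀ u ∈ R, ∀ v ∈ R, Γ.dist (w 0) u ≤ Γ.dist (w 0) v + 1 := by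
    intro R hR u hu v hv
    by_cases huv : u = v
    · rw [huv]; omega
    · exact hstep u (hRW R hR hu) v (hRW R hR hv) ⟨huv, Or.inl ⟨R, hR, hu, hv⟩⟩
  refine ⟨⟨n, w, Γ.dist (w 0), hn, hw, hnc, h𝓡, hcover, by simp, ?_, ?_, hreg, ?_⟩, hout⟩
  · intro v hv h
    exact ((hreach v hv).dist_eq_zero_iff.1 h).symm
  · intro u hu v hv huv
    exact hstep u hu v hv ⟨huv.ne, Or.inr ⟨hu, hv, huv⟩⟩
  · intro v hv hpos
    have : ∃ u, u ∈ W ∧ Γ.Adj u v ∧ Γ.dist (w 0) u + 1 = Γ.dist (w 0) v := by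
      obtain ⟨p, hp⟩ := (hreach v hv).exists_walk_length_eq_dist
      have hnil : ¬ p.Nil := by
        intro h
        rw [← SimpleGraph.Walk.length_eq_zero_iff] at h
        omega
      have hadj := p.adj_penultimate hnil
      have huW : p.penultimate ∈ W := by
        rcases hadj.2 with ⟨R, hR, h1, -⟩ | ⟨h1, -, -⟩
        · exact hRW R hR h1
        · exact h1
      refine ⟨p.penultimate, huW, hadj, le_antisymm ?_ ?_⟩
      · have h1 := SimpleGraph.dist_le p.dropLast
        have h2 : p.dropLast.length + 1 = p.length := by
          have := congrArg SimpleGraph.Walk.length (p.concat_dropLast hadj)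
          rwa [SimpleGraph.Walk.length_concat] at this
        omega
      · exact hstep v hv _ huW hadj.symm
    obtain ⟨u, huW, ⟨-, huv⟩, hu⟩ := this
    have hvR : ∃ R ∈ 𝓡, v ∈ R := by rwa [← hcover] at hv
    rcases huv with ⟨R, hR, huR, hvR⟩ | ⟨-, -, huv⟩
    -- The region meets the previous level at `u`, so it lies on the level of `v` or below. Leaving
    -- the component of `v` on its own level therefore leads exactly one level down.
    · let P : Set V := {x | Γ.dist (w 0) x ≠ Γ.dist (w 0) v}
      have hvP : v ∉ P := fun h => h rfl
      obtain ⟨y, hy, z, hzR, hzP, hyz⟩ := (h𝓡 R hR).exists_adj_compOf (P := P)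
        ⟨u, huR, by change _ ≠ _; omega⟩ hvR hvP
      refine ⟨compOf G (R \ P) v, isConnectedSet_compOf ⟨hvR, hvP⟩, mem_compOf_self ⟨hvR, hvP⟩,
        fun x hx => not_not.1 (compOf_subset hx).2, ⟨R, hR, fun x hx => (compOf_subset hx).1⟩,
        y, hy, z, hRW R hR hzR, hyz, ?_⟩
      have h1 := hreg R hR v hvR z hzR
      have h2 := hreg R hR z hzR u huR
      change _ ≠ _ at hzP
      omega
    · obtain ⟨R, hR, hvR⟩ := hvR
      exact ⟨{v}, isConnectedSet_singleton G v, rfl, by rintro x rfl; rfl,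
        ⟨R, hR, Set.singleton_subset_iff.2 hvR⟩, v, rfl, u, huW, huv.symm, hu⟩

namespace Layout

theorem region_subset (L : Layout G W 𝓡) {R : Set V} (hR : R ∈ 𝓡) : R ⊆ W := L.cover ▸ Set.subset_sUnion_of_mem hR

theorem exists_region (L : Layout G W 𝓡) {v : V} (hv : v ∈ W) : ∃ R ∈ 𝓡, v ∈ R := by
  rw [← L.cover] at hv; exact hv

/-- Every vertex is joined to `w 0` by a connected set that does not exceed its level. -/
theorem exists_descent (L : Layout G W 𝓡) {v : V} (hv : v ∈ W) : ∃ T ⊆ W, IsConnectedSet G T ∧ v ∈ T ∧ L.w 0 ∈ T ∧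
    ∀ x ∈ T, L.level x ≤ L.level v := by
  induction hm : L.level v generalizing v with
  | zero =>
    obtain rfl := L.eq_of_level_zero v hv hm
    exact ⟨{L.w 0}, Set.singleton_subset_iff.2 hv, isConnectedSet_singleton G _, rfl, rfl,
      by rintro x rfl; exact hm.le⟩
  | succ m ih =>
    obtain ⟨S, hS, hvS, hSl, ⟨R, hR, hSR⟩, x, hx, y, hyW, hxy, hy⟩ := L.exists_leg v hv (by omega)
    obtain ⟨T, hTW, hT, hyT, h0, hTl⟩ := ih hyW (by omega)
    refine ⟨S ∪ T, Set.union_subset (hSR.trans (L.region_subset hR)) hTW,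
      hS.union hT ⟨x, hx, y, hyT, Or.inr hxy⟩, Or.inl hvS, Or.inr h0, ?_⟩
    rintro z (hz | hz)
    · rw [hSl z hz, hm]
    · have := hTl z hz; omega

end Layout

end Levels

/-! ### Pods: connected sets inside a level through which the boundary vertices descend -/

section Pods

variable {V : Type u} {G : SimpleGraph V} {W : Set V} {𝓡 : Set (Set V)}

/-- Greedy selection in increasing order: `c` is selected if it is compatible with all the
selected smaller numbers. -/
def greedySet (C : ℕ → Prop) (r : ℕ → ℕ → Prop) (c : ℕ) : Prop :=
  C c ∧ ∀ f, f < c → greedySet C r f → r f c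
termination_by c

theorem greedySet_iff {C : ℕ → Prop} {r : ℕ → ℕ → Prop} {c : ℕ} :
    greedySet C r c ↔ C c ∧ ∀ f, f < c → greedySet C r f → r f c := by
  rw [greedySet]

namespace Layout

/-- `P` is a connected set inside level `k`, all of whose vertices lie in regions touching the
center `F`, and, unless `k = 0`, `b` is a vertex of the previous level adjacent to a vertex
of `P` in `F`. -/
def IsPod (L : Layout G W 𝓡) (k : ℕ) (P F : Set V) (b : V) : Prop :=
  IsConnectedSet G P ∧ P ⊆ W ∧ (∀ x ∈ P, L.level x = k) ∧ F ∈ 𝓡 ∧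
    (∀ x ∈ P, NearRegion G 𝓡 1 x F) ∧
    (0 < k → b ∈ W ∧ L.level b + 1 = k ∧ ∃ y ∈ P, y ∈ F ∧ G.Adj y b)

/-- A leg is a connected part of one region on level `m` with an edge to level `m - 1`. Founders are
chosen greedily with disjoint legs. The remaining covered part of the level is cut along the founder
legs, and each piece is attached to one founder leg, with preference for the last founder before it.
Convexity makes every leg through an attached piece meet the leg of its founder, so the region of
that founder is a center for the whole pod. -/
theorem exists_pods_of_level (L : Layout G W 𝓡) {m : ℕ} (hm : 0 < m) (C : ℕ → Prop)
    (hC : ∀ c, C c ↔ c < L.n ∧ m ≤ L.level (L.w c)) (v : ℕ → V) (A : ℕ → Set V)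
    (hvl : ∀ c, C c → L.level (v c) = m)
    (hAW : ∀ c, C c → A c ⊆ W) (hA : ∀ c, C c → IsConnectedSet G (A c))
    (hvA : ∀ c, C c → v c ∈ A c) (hwA : ∀ c, C c → L.w c ∈ A c)
    (hAl : ∀ c, C c → ∀ x ∈ A c, m ≤ L.level x ∧ (L.level x = m → x = v c))
    (hAA : ∀ c c', C c → C c' → (A c ∩ A c').Nonempty → v c = v c') :
    ∃ pod : ℕ → Set V, (∀ c, C c → (∃ F b, L.IsPod m (pod c) F b) ∧ v c ∈ pod c) ∧
      (∀ c c', C c → C c' → v c = v c' → pod c = pod c') ∧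
      (∀ c c', C c → C c' → (pod c ∩ pod c').Nonempty → pod c = pod c') := by
  classical
  have hvW : ∀ c, C c → v c ∈ W := fun c hc => hAW c hc (hvA c hc)
  -- the legs, depending on the vertex only
  have hleg : ∀ x, ∃ S : Set V, ∃ R : Set V, ∃ y b : V, x ∈ W → L.level x = m →
      IsConnectedSet G S ∧ x ∈ S ∧ (∀ x ∈ S, L.level x = m) ∧ R ∈ 𝓡 ∧ S ⊆ R ∧ y ∈ S ∧ b ∈ W ∧
        G.Adj y b ∧ L.level b + 1 = m := by
    intro x
    by_cases h : x ∈ W ∧ L.level x = m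
    · obtain ⟨S, h1, h2, h3, ⟨R, h4, h5⟩, y, hy, b, hb, h6, h7⟩ := L.exists_leg x h.1 (by omega)
      exact ⟨S, R, y, b, fun _ hx => ⟨h1, h2, fun z hz => (h3 z hz).trans hx, h4, h5, hy, hb, h6,
        h7.trans hx⟩⟩
    · exact ⟨∅, ∅, x, x, fun h1 h2 => absurd ⟨h1, h2⟩ h⟩
  choose leg reg ey eb hleg using hleg
  let S : ℕ → Set V := fun c => leg (v c)
  have hS : ∀ c, C c → IsConnectedSet G (S c) ∧ v c ∈ S c ∧ (∀ x ∈ S c, L.level x = m) ∧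
      reg (v c) ∈ 𝓡 ∧ S c ⊆ reg (v c) ∧ ey (v c) ∈ S c ∧ eb (v c) ∈ W ∧
        G.Adj (ey (v c)) (eb (v c)) ∧ L.level (eb (v c)) + 1 = m :=
    fun c hc => hleg (v c) (hvW c hc) (hvl c hc)
  have hSW : ∀ c, C c → S c ⊆ W := fun c hc =>
    (hS c hc).2.2.2.2.1.trans (L.region_subset (hS c hc).2.2.2.1)
  -- a connected set inside the level cannot pass by a leg
  have wall : ∀ a g b, C a → C g → C b → a < g → g < b → ∀ D, IsConnectedSet G D → D ⊆ W →
      (∀ x ∈ D, L.level x = m) → v a ∈ D → v b ∈ D → (D ∩ S g).Nonempty := by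
    intro a g b ha hg hb hag hgb D hD hDW hDl hva hvb
    by_contra hne
    have hnot : ∀ x ∈ D, x ∉ S g := fun x hx hxS => hne ⟨x, hx, hxS⟩
    obtain ⟨hSc, hvS, hSl, -, -, hyS, hbW, hyb, hbl⟩ := hS g hg
    obtain ⟨T, hTW, hT, hbT, h0T, hTl⟩ := L.exists_descent hbW
    have ha0 : 0 < a := by
      rcases Nat.eq_zero_or_pos a with rfl | h
      · have := ((hC 0).1 ha).2
        rw [L.level_w_zero] at this
        omega
      · exact h
    -- This set joins `w g` to `w 0`, whereas the next one joins `w a` to `w b` with `a < g < b`, so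
    -- convex position applies. Levels confine their intersection to level `m`, or to a common part
    -- of two tails `A`, which then arrive at the same vertex.
    have hc1 : IsConnectedSet G (A g ∪ S g ∪ T) :=
      ((hA g hg).union_of_inter hSc ⟨v g, hvA g hg, hvS⟩).union hT
        ⟨_, Or.inr hyS, _, hbT, Or.inr hyb⟩
    have hc2 : IsConnectedSet G (D ∪ A a ∪ A b) :=
      (hD.union_of_inter (hA a ha) ⟨v a, hva, hvA a ha⟩).union_of_inter (hA b hb)
        ⟨v b, Or.inl hvb, hvA b hb⟩
    obtain ⟨x, hx1, hx2⟩ := L.noncrossing a g b ha0 hag hgb ((hC b).1 hb).1 _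
      (Set.union_subset (Set.union_subset (hAW g hg) (hSW g hg)) hTW) _
      (Set.union_subset (Set.union_subset hDW (hAW a ha)) (hAW b hb)) hc1 hc2
      (Or.inr h0T) (Or.inl (Or.inl (hwA g hg))) (Or.inl (Or.inr (hwA a ha)))
      (Or.inr (hwA b hb))
    have hlow : m ≤ L.level x := by
      rcases hx2 with (h | h) | h
      · exact (hDl x h).ge
      · exact (hAl a ha x h).1
      · exact (hAl b hb x h).1
    have key : ∀ c, C c → x ∈ A c → v c ∈ D → False := by
      intro c hc hxc hvD
      rcases hx1 with (h | h) | h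
      · have := hAA c g hc hg ⟨x, hxc, h⟩
        exact hnot _ hvD (this ▸ hvS)
      · have := (hAl c hc x hxc).2 (hSl x h)
        exact hnot _ hvD (this ▸ h)
      · have := hTl x h; omega
    rcases hx2 with (h | h) | h
    · rcases hx1 with (h' | h') | h'
      · have := (hAl g hg x h').2 (hDl x h)
        exact hnot _ h (this ▸ hvS)
      · exact hnot _ h h'
      · have := hTl x h'; omega
    · exact key a ha h hva
    · exact key b hb h hvb
  -- founders
  let Φ : ℕ → Prop := greedySet C fun f c => Disjoint (S f) (S c)
  have hΦC : ∀ c, Φ c → C c := fun c hc => (greedySet_iff.1 hc).1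
  have hΦd : ∀ f g, Φ f → Φ g → f ≠ g → Disjoint (S f) (S g) := by
    intro f g hf hg hne
    rcases lt_or_gt_of_ne hne with h | h
    · exact (greedySet_iff.1 hg).2 f h hf
    · exact ((greedySet_iff.1 hf).2 g h hg).symm
  have hΦe : ∀ c, C c → ¬ Φ c → ∃ f < c, Φ f ∧ ¬ Disjoint (S f) (S c) := by
    intro c hc hnc
    by_contra hcon
    push Not at hcon
    exact hnc (greedySet_iff.2 ⟨hc, hcon⟩)
  have hφ : ∀ c, ∃ f, C c → Φ f ∧ f ≤ c ∧ ∀ g, Φ g → g ≤ c → g ≤ f := by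
    intro c
    by_cases hc : C c
    · have hex : ∃ f ≤ c, Φ f := by
        by_cases h : Φ c
        · exact ⟨c, le_rfl, h⟩
        · obtain ⟨f, hf, hf', -⟩ := hΦe c hc h
          exact ⟨f, hf.le, hf'⟩
      obtain ⟨f, hf, hf'⟩ := hex
      exact ⟨Nat.findGreatest Φ c, fun _ => ⟨Nat.findGreatest_spec hf hf',
        Nat.findGreatest_le c, fun g hg hgc => Nat.le_findGreatest hgc hg⟩⟩
    · exact ⟨0, fun h => absurd h hc⟩
  choose φ hφ using hφ
  -- A leg that is not a founder's meets some earlier founder leg. If that is not the last founder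
  -- before `c`, the wall at the last one must be met too, and founder legs are disjoint.
  have hmeet : ∀ c, C c → (S c ∩ S (φ c)).Nonempty := by
    intro c hc
    obtain ⟨h1, h2, h3⟩ := hφ c hc
    by_cases hΦc : Φ c
    · rw [le_antisymm h2 (h3 c hΦc le_rfl)]
      exact ⟨v c, (hS c hc).2.1, (hS c hc).2.1⟩
    · obtain ⟨f, hfc, hf, hfd⟩ := hΦe c hc hΦc
      have hmf : (S f ∩ S c).Nonempty := Set.not_disjoint_iff_nonempty_inter.1 hfd
      rcases (h3 f hf hfc.le).eq_or_lt with he | hlt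
      · rw [← he, Set.inter_comm]; exact hmf
      · have hlt' : φ c < c := lt_of_le_of_ne h2 fun h => hΦc (h ▸ h1)
        have hfC := hΦC f hf
        obtain ⟨x, hx, hx'⟩ := wall f (φ c) c hfC (hΦC _ h1) hc hlt hlt' (S f ∪ S c)
          ((hS f hfC).1.union_of_inter (hS c hc).1 hmf)
          (Set.union_subset (hSW f hfC) (hSW c hc))
          (by
            rintro x (hx | hx)
            · exact (hS f hfC).2.2.1 x hx
            · exact (hS c hc).2.2.1 x hx)
          (Or.inl (hS f hfC).2.1) (Or.inr (hS c hc).2.1)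
        rcases hx with hx | hx
        · exact absurd hx' (Set.disjoint_left.1 (hΦd f (φ c) hf h1 hlt.ne) hx)
        · exact ⟨x, hx, hx'⟩
  -- the part of the level that is covered by legs, cut along the founder legs
  let Lg : Set V := {x | ∃ g, Φ g ∧ x ∈ S g}
  let U : ℕ → Set V := fun f => {x | ∃ c, C c ∧ φ c = f ∧ x ∈ S c} \ Lg
  let D : ℕ → Set V := fun c => compOf G (U (φ c)) (v c)
  have hvU : ∀ c, C c → v c ∉ Lg → v c ∈ U (φ c) := fun c hc hv =>
    ⟨⟨c, hc, rfl, (hS c hc).2.1⟩, hv⟩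
  have hDc : ∀ c, C c → v c ∉ Lg → IsConnectedSet G (D c) := fun c hc hv =>
    isConnectedSet_compOf (hvU c hc hv)
  have hDv : ∀ c, C c → v c ∉ Lg → v c ∈ D c := fun c hc hv => mem_compOf_self (hvU c hc hv)
  have hDW : ∀ c, D c ⊆ W := by
    intro c x hx
    obtain ⟨⟨c', hc', -, hx'⟩, -⟩ := compOf_subset hx
    exact hSW c' hc' hx'
  have hDl : ∀ c, ∀ x ∈ D c, L.level x = m := by
    intro c x hx
    obtain ⟨⟨c', hc', -, hx'⟩, -⟩ := compOf_subset hx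
    exact (hS c' hc').2.2.1 x hx'
  have hDLg : ∀ c, ∀ x ∈ D c, ∀ g, Φ g → x ∉ S g := fun c x hx g hg hxg =>
    (compOf_subset hx).2 ⟨g, hg, hxg⟩
  have hφlt : ∀ c, C c → v c ∉ Lg → φ c < c := fun c hc hv =>
    lt_of_le_of_ne (hφ c hc).2.1 fun h => hv ⟨c, h ▸ (hφ c hc).1, (hS c hc).2.1⟩
  let Touch : ℕ → ℕ → Prop := fun c g => ∃ x ∈ D c, ∃ y ∈ S g, G.Adj x y
  have htconn : ∀ c g, C c → v c ∉ Lg → Φ g → Touch c g → IsConnectedSet G (D c ∪ S g) := by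
    rintro c g hc hv hg ⟨x, hx, y, hy, hxy⟩
    exact (hDc c hc hv).union (hS g (hΦC g hg)).1 ⟨x, hx, y, hy, Or.inr hxy⟩
  have hwall2 : ∀ c g h, C c → v c ∉ Lg → Φ g → Φ h → Touch c h →
      ¬ (c < g ∧ g < h) ∧ ¬ (h < g ∧ g < c) := by
    intro c g h hc hv hg hh ht
    have hcon := htconn c h hc hv hh ht
    have hW' : D c ∪ S h ⊆ W := Set.union_subset (hDW c) (hSW h (hΦC h hh))
    have hl' : ∀ x ∈ D c ∪ S h, L.level x = m := by
      rintro x (hx | hx)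
      · exact hDl c x hx
      · exact (hS h (hΦC h hh)).2.2.1 x hx
    have hno : h ≠ g → ¬ ((D c ∪ S h) ∩ S g).Nonempty := by
      rintro hne ⟨x, hx | hx, hx'⟩
      · exact hDLg c x hx g hg hx'
      · exact Set.disjoint_left.1 (hΦd h g hh hg hne) hx hx'
    have hv' := hDv c hc hv
    constructor
    · rintro ⟨h1, h2⟩
      exact hno h2.ne' (wall c g h hc (hΦC g hg) (hΦC h hh) h1 h2 _ hcon hW' hl' (Or.inl hv')
        (Or.inr (hS h (hΦC h hh)).2.1))
    · rintro ⟨h1, h2⟩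
      exact hno h1.ne (wall h g c (hΦC h hh) (hΦC g hg) hc h1 h2 _ hcon hW' hl'
        (Or.inr (hS h (hΦC h hh)).2.1) (Or.inl hv'))
  -- Walls hide all earlier founders behind `φ c` and all later ones behind the first founder after
  -- `c`.
  have huniq : ∀ c g h, C c → v c ∉ Lg → Φ g → Φ h → Touch c g → Touch c h → g ≠ φ c → h ≠ φ c →
      g = h := by
    have big : ∀ c g, C c → v c ∉ Lg → Φ g → Touch c g → g ≠ φ c → c < g := by
      intro c g hc hv hg ht hne
      by_contra hle
      have h1 := lt_of_le_of_ne ((hφ c hc).2.2 g hg (by omega)) hne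
      exact (hwall2 c (φ c) g hc hv (hφ c hc).1 hg ht).2 ⟨h1, hφlt c hc hv⟩
    intro c g h hc hv hg hh htg hth hgn hhn
    have h1 := big c g hc hv hg htg hgn
    have h2 := big c h hc hv hh hth hhn
    rcases lt_trichotomy g h with hl | he | hl
    · exact absurd ⟨h1, hl⟩ (hwall2 c g h hc hv hg hh hth).1
    · exact he
    · exact absurd ⟨h2, hl⟩ (hwall2 c h g hc hv hh hg htg).1
  -- pieces of legs in `D c`
  have htouch : ∀ c c' x, C c → C c' → φ c' = φ c → x ∈ D c → x ∈ S c' →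
      ∃ g, Φ g ∧ Touch c g ∧ (S c' ∩ S g).Nonempty := by
    intro c c' x hc hc' hφc hx hx'
    have hxL : x ∉ Lg := (compOf_subset hx).2
    obtain ⟨z, hz, hz'⟩ := hmeet c' hc'
    obtain ⟨y, hy, t, ht, ⟨g, hg, htg⟩, hyt⟩ := (hS c' hc').1.exists_adj_compOf (P := Lg)
      ⟨z, hz, φ c', (hφ c' hc').1, hz'⟩ hx' hxL
    refine ⟨g, hg, (⟨y, ?_, t, htg, hyt⟩ : ∃ x ∈ D c, ∃ y ∈ S g, G.Adj x y), t, ht, htg⟩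
    refine (isConnectedSet_compOf (G := G) (S := S c' \ Lg) (x := x) ⟨hx', hxL⟩).subset_compOf' ?_
      ⟨x, mem_compOf_self ⟨hx', hxL⟩, hx⟩ hy
    exact compOf_subset.trans fun z hz => ⟨⟨c', hc', hφc, hz.1⟩, hz.2⟩
  have hDD : ∀ c c', C c → C c' → v c ∉ Lg → v c' ∉ Lg → (D c ∩ D c').Nonempty →
      φ c = φ c' := by
    -- A later founder lies between `c` and `c'`, and its leg would have to meet the union of the
    -- two components, which avoid all founder legs.
    have half : ∀ c c', C c → C c' → v c ∉ Lg → v c' ∉ Lg → (D c ∩ D c').Nonempty →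
        ¬ φ c < φ c' := by
      intro c c' hc hc' hv hv' hne hlt
      have h1 : c < φ c' := by
        by_contra h
        exact absurd ((hφ c hc).2.2 _ (hφ c' hc').1 (by omega)) (by omega)
      obtain ⟨x, hx, hx'⟩ := wall c (φ c') c' hc (hΦC _ (hφ c' hc').1) hc' h1 (hφlt c' hc' hv')
        (D c ∪ D c') ((hDc c hc hv).union_of_inter (hDc c' hc' hv') hne)
        (Set.union_subset (hDW c) (hDW c'))
        (by
          rintro x (hx | hx)
          · exact hDl c x hx
          · exact hDl c' x hx)
        (Or.inl (hDv c hc hv)) (Or.inr (hDv c' hc' hv'))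
      rcases hx with hx | hx
      · exact hDLg c x hx _ (hφ c' hc').1 hx'
      · exact hDLg c' x hx _ (hφ c' hc').1 hx'
    intro c c' hc hc' hv hv' hne
    have h1 := half c c' hc hc' hv hv' hne
    have h2 := half c' c hc' hc hv' hv (by rwa [Set.inter_comm])
    omega
  -- to which founder a component is attached
  let att : ℕ → Set V → ℕ := fun f E =>
    if ∃ x ∈ E, ∃ y ∈ S f, G.Adj x y then f
    else if h : ∃ g, Φ g ∧ ∃ x ∈ E, ∃ y ∈ S g, G.Adj x y then h.choose else 0
  have hatt : ∀ c, C c → v c ∉ Lg → Φ (att (φ c) (D c)) ∧ Touch c (att (φ c) (D c)) ∧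
      (att (φ c) (D c) ≠ φ c → ¬ Touch c (φ c)) := by
    intro c hc hv
    by_cases h1 : Touch c (φ c)
    · have : att (φ c) (D c) = φ c := if_pos h1
      rw [this]
      exact ⟨(hφ c hc).1, h1, fun h => absurd rfl h⟩
    · have h2 : ∃ g, Φ g ∧ Touch c g := by
        obtain ⟨g, hg, hg', -⟩ := htouch c c (v c) hc hc rfl (hDv c hc hv) (hS c hc).2.1
        exact ⟨g, hg, hg'⟩
      have : att (φ c) (D c) = h2.choose := by
        simp only [att]
        rw [if_neg h1, dif_pos h2]
      rw [this]
      exact ⟨h2.choose_spec.1, h2.choose_spec.2, fun _ => h1⟩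
  let τ : ℕ → ℕ := fun c => if h : v c ∈ Lg then h.choose else att (φ c) (D c)
  have hτ1 : ∀ c, v c ∈ Lg → Φ (τ c) ∧ v c ∈ S (τ c) := by
    intro c h
    simp only [τ, dif_pos h]
    exact h.choose_spec
  have hτ2 : ∀ c, v c ∉ Lg → τ c = att (φ c) (D c) := fun c h => dif_neg h
  have hτΦ : ∀ c, C c → Φ (τ c) := by
    intro c hc
    by_cases h : v c ∈ Lg
    · exact (hτ1 c h).1
    · rw [hτ2 c h]; exact (hatt c hc h).1
  let pod : ℕ → Set V := fun g => S g ∪ ⋃₀ {E | ∃ c, C c ∧ v c ∉ Lg ∧ τ c = g ∧ E = D c}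
  have hDeq : ∀ c c', C c → C c' → v c ∉ Lg → v c' ∉ Lg → (D c ∩ D c').Nonempty →
      τ c = τ c' := by
    intro c c' hc hc' hv hv' hne
    have h1 := hDD c c' hc hc' hv hv' hne
    have h2 : D c = D c' := by
      obtain ⟨x, hx, hx'⟩ := hne
      have e1 := compOf_eq hx
      have e2 := compOf_eq hx'
      rw [← h1] at e2
      simp only [D]
      rw [← e1, e2, h1]
    rw [hτ2 c hv, hτ2 c' hv', h1, h2]
  have hpp : ∀ g h, Φ g → Φ h → (pod g ∩ pod h).Nonempty → g = h := by
    rintro g h hg hh ⟨x, hx, hx'⟩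
    rcases hx with hx | ⟨_, ⟨c, hc, hv, hcg, rfl⟩, hx⟩
    · rcases hx' with hx' | ⟨_, ⟨c', hc', hv', hcg', rfl⟩, hx'⟩
      · by_contra hne
        exact Set.disjoint_left.1 (hΦd g h hg hh hne) hx hx'
      · exact absurd hx (hDLg c' x hx' g hg)
    · rcases hx' with hx' | ⟨_, ⟨c', hc', hv', hcg', rfl⟩, hx'⟩
      · exact absurd hx' (hDLg c x hx h hh)
      · rw [← hcg, ← hcg']
        exact hDeq c c' hc hc' hv hv' ⟨x, hx, hx'⟩
  have hvpod : ∀ c, C c → v c ∈ pod (τ c) := by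
    intro c hc
    by_cases h : v c ∈ Lg
    · exact Or.inl (hτ1 c h).2
    · exact Or.inr ⟨_, ⟨c, hc, h, rfl, rfl⟩, hDv c hc h⟩
  have hsame : ∀ c c', C c → C c' → (pod (τ c) ∩ pod (τ c')).Nonempty →
      pod (τ c) = pod (τ c') := by
    intro c c' hc hc' h
    rw [hpp _ _ (hτΦ c hc) (hτΦ c' hc') h]
  refine ⟨fun c => pod (τ c), fun c hc => ⟨?_, hvpod c hc⟩, fun c c' hc hc' h =>
    hsame c c' hc hc' ⟨v c, hvpod c hc, h ▸ hvpod c' hc'⟩, hsame⟩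
  have hg := hτΦ c hc
  dsimp only
  generalize τ c = g at hg ⊢
  obtain ⟨hSc, hvS, hSl, hF, hSF, hyS, hbW, hyb, hbl⟩ := hS g (hΦC g hg)
  refine ⟨reg (v g), eb (v g), ?_, ?_, ?_, hF, ?_, fun _ => ⟨hbW, hbl, ey (v g), Or.inl hyS,
    hSF hyS, hyb⟩⟩
  · refine hSc.union_sUnion _ ?_
    rintro _ ⟨c, hc, hv, hcg, rfl⟩
    obtain ⟨-, ⟨x, hx, y, hy, hxy⟩, -⟩ := hatt c hc hv
    rw [← hτ2 c hv, hcg] at hy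
    exact ⟨hDc c hc hv, y, hy, x, hx, Or.inr hxy.symm⟩
  · refine Set.union_subset (hSW g (hΦC g hg)) (Set.sUnion_subset ?_)
    rintro _ ⟨c, hc, hv, hcg, rfl⟩
    exact hDW c
  · rintro x (hx | ⟨_, ⟨c, hc, hv, hcg, rfl⟩, hx⟩)
    · exact hSl x hx
    · exact hDl c x hx
  · rintro x (hx | ⟨_, ⟨c, hc, hv, hcg, rfl⟩, hx⟩)
    · exact ⟨_, hSF hx, (ContactDistLE.refl hF).mono zero_le_one⟩
    · obtain ⟨⟨c', hc', hφ', hx'⟩, -⟩ := compOf_subset hx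
      obtain ⟨-, -, -, hR', hSR', -⟩ := hS c' hc'
      refine ⟨reg (v c'), hSR' hx', ?_⟩
      obtain ⟨h1, h2, h3⟩ := hatt c hc hv
      rw [← hτ2 c hv, hcg] at h1 h2 h3
      -- If `g` is the last founder, this is `hmeet`. Otherwise the piece does not touch the leg of
      -- `φ c`, so the founder leg that `S c'` reaches out of the piece is the unique other one,
      -- namely that of `g`.
      suffices (S c' ∩ S g).Nonempty by
        obtain ⟨z, hz, hz'⟩ := this
        exact ContactDistLE.of_touch hR' hF (hSR' hz) (hSF hz') (Or.inl rfl)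
      by_cases hgφ : g = φ c
      · have := hmeet c' hc'
        rwa [hφ', ← hgφ] at this
      · obtain ⟨h, hh, ht, hmt⟩ := htouch c c' x hc hc' hφ' hx hx'
        have hne : h ≠ φ c := by
          rintro rfl
          exact h3 hgφ ht
        rwa [huniq c g h hc hv hg hh h2 ht hgφ hne]

end Layout

end Pods

/-! ### Chains of pods through all levels, and the intervals of chains met by connected sets -/

section PodFamilies

variable {V : Type u} {G : SimpleGraph V} {W : Set V} {𝓡 : Set (Set V)}

namespace Layout

/-- The level of the `c`-th boundary vertex. -/
def height (L : Layout G W 𝓡) (c : ℕ) : ℕ := L.level (L.w c)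

open Classical in
/-- A choice of a center and an exit of a pod, depending only on the pod. -/
noncomputable def podData (L : Layout G W 𝓡) (k : ℕ) (P : Set V) : Set V × V :=
  if h : ∃ Fb : Set V × V, L.IsPod k P Fb.1 Fb.2 then h.choose else (∅, L.w 0)

/-- The chosen center of a pod. -/
noncomputable def center (L : Layout G W 𝓡) (k : ℕ) (P : Set V) : Set V := (L.podData k P).1

/-- The chosen exit of a pod to the previous level. -/
noncomputable def exit (L : Layout G W 𝓡) (k : ℕ) (P : Set V) : V := (L.podData k P).2

theorem isPod_center_exit {L : Layout G W 𝓡} {k : ℕ} {P : Set V} (h : ∃ F b, L.IsPod k P F b) :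
    L.IsPod k P (L.center k P) (L.exit k P) := by
  have h' : ∃ Fb : Set V × V, L.IsPod k P Fb.1 Fb.2 := by
    obtain ⟨F, b, h⟩ := h
    exact ⟨(F, b), h⟩
  unfold center exit podData
  rw [dif_pos h']
  exact h'.choose_spec

/-- Pods on the levels from `m` on, such that every boundary vertex lies in its first pod, and the
exit of each pod lies in the next one. -/
structure IsPodFamily (L : Layout G W 𝓡) (m : ℕ) (pod : ℕ → ℕ → Set V) : Prop where
  isPod : ∀ c < L.n, ∀ k, m ≤ k → k ≤ L.height c →
    L.IsPod k (pod c k) (L.center k (pod c k)) (L.exit k (pod c k))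
  w_mem : ∀ c < L.n, m ≤ L.height c → L.w c ∈ pod c (L.height c)
  exit_mem : ∀ c < L.n, ∀ k, m ≤ k → k + 1 ≤ L.height c → L.exit (k + 1) (pod c (k + 1)) ∈ pod c k
  eq_of_inter : ∀ c < L.n, ∀ c' < L.n, ∀ k, m ≤ k → k ≤ L.height c → k ≤ L.height c' →
    (pod c k ∩ pod c' k).Nonempty → pod c k = pod c' k

namespace IsPodFamily

variable {L : Layout G W 𝓡} {m : ℕ} {pod : ℕ → ℕ → Set V}

/-- The exit is a function of the pod alone, so equal pods leave into the same pod of the next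
level. -/
theorem eq_below (h : L.IsPodFamily m pod) {c c' : ℕ} (hc : c < L.n) (hc' : c' < L.n) {j k : ℕ}
    (hj : m ≤ j) (hjk : j ≤ k) (hk : k ≤ L.height c) (hk' : k ≤ L.height c')
    (heq : pod c k = pod c' k) : pod c j = pod c' j := by
  induction k, hjk using Nat.le_induction with
  | base => exact heq
  | succ k hjk ih =>
    refine ih (by omega) (by omega) (h.eq_of_inter c hc c' hc' k (by omega) (by omega) (by omega)
      ⟨L.exit (k + 1) (pod c (k + 1)), h.exit_mem c hc k (by omega) hk, ?_⟩)
    rw [heq]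
    exact h.exit_mem c' hc' k (by omega) hk'

/-- The union of the pods of a chain from level `j` on. -/
def chainFrom (L : Layout G W 𝓡) (pod : ℕ → ℕ → Set V) (c j : ℕ) : Set V :=
  {x | ∃ k, j ≤ k ∧ k ≤ L.height c ∧ x ∈ pod c k}

theorem chainFrom_subset (h : L.IsPodFamily m pod) {c : ℕ} (hc : c < L.n) {j : ℕ} (hj : m ≤ j) :
    chainFrom L pod c j ⊆ W := by
  rintro x ⟨k, h1, h2, h3⟩
  exact (h.isPod c hc k (by omega) h2).2.1 h3

theorem isConnectedSet_chainFrom (h : L.IsPodFamily m pod) {c : ℕ} (hc : c < L.n) {j : ℕ}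
    (hj : m ≤ j) (hjc : j ≤ L.height c) : IsConnectedSet G (chainFrom L pod c j) := by
  induction hd : L.height c - j generalizing j with
  | zero =>
    have : chainFrom L pod c j = pod c j := by
      ext x
      constructor
      · rintro ⟨k, h1, h2, h3⟩
        rwa [show j = k by omega]
      · exact fun hx => ⟨j, le_rfl, hjc, hx⟩
    rw [this]
    exact (h.isPod c hc j hj hjc).1
  | succ d ih =>
    have : chainFrom L pod c j = pod c j ∪ chainFrom L pod c (j + 1) := by
      ext x
      constructor
      · rintro ⟨k, h1, h2, h3⟩
        rcases h1.eq_or_lt with rfl | h1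
        · exact Or.inl h3
        · exact Or.inr ⟨k, h1, h2, h3⟩
      · rintro (hx | ⟨k, h1, h2, h3⟩)
        · exact ⟨j, le_rfl, hjc, hx⟩
        · exact ⟨k, by omega, h2, h3⟩
    rw [this]
    obtain ⟨-, -, y, hy, -, hyb⟩ := (h.isPod c hc (j + 1) (by omega) (by omega)).2.2.2.2.2
      (by omega)
    exact (h.isPod c hc j hj hjc).1.union (ih (by omega) (by omega) (by omega))
      ⟨_, h.exit_mem c hc j hj (by omega), y, ⟨j + 1, le_rfl, by omega, hy⟩, Or.inr hyb.symm⟩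

theorem w_mem_chainFrom (h : L.IsPodFamily m pod) {c : ℕ} (hc : c < L.n) {j : ℕ} (hj : m ≤ j)
    (hjc : j ≤ L.height c) : L.w c ∈ chainFrom L pod c j :=
  ⟨L.height c, hjc, le_rfl, h.w_mem c hc (by omega)⟩

end IsPodFamily

/-- Downward induction on the level: the chains already built end in exits on level `m`, boundary
vertices of height `m` start there, and the pods of that level collect both. -/
theorem exists_isPodFamily (L : Layout G W 𝓡) : ∃ pod, L.IsPodFamily 0 pod := by
  classical
  obtain ⟨M, hM⟩ : ∃ M, ∀ c < L.n, L.height c < M :=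
    ⟨(Finset.range L.n).sup L.height + 1, fun c hc =>
      Nat.lt_succ_of_le (Finset.le_sup (f := L.height) (Finset.mem_range.2 hc))⟩
  suffices ∀ d, ∃ pod, L.IsPodFamily (M - d) pod by simpa using this M
  intro d
  induction d with
  | zero =>
    -- Above all heights every condition is void.
    refine ⟨fun _ _ => ∅, ⟨fun c hc k h1 h2 => ?_, fun c hc h1 => ?_, fun c hc k h1 h2 => ?_,
      fun c hc c' hc' k h1 h2 => ?_⟩⟩ <;> have := hM c hc <;> omega
  | succ d ih =>
    obtain ⟨pod, h⟩ := ih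
    by_cases hd : M - d = 0
    · rw [show M - (d + 1) = M - d by omega]
      exact ⟨pod, h⟩
    obtain ⟨m, hm⟩ : ∃ m, M - d = m + 1 := ⟨M - d - 1, by omega⟩
    rw [hm] at h
    rw [show M - (d + 1) = m by omega]
    clear hm hd
    -- the vertex at which a chain arrives at level `m`
    let v : ℕ → V := fun c => if L.height c = m then L.w c else L.exit (m + 1) (pod c (m + 1))
    have hv1 : ∀ c, L.height c = m → v c = L.w c := fun c h => if_pos h
    have hv2 : ∀ c, L.height c ≠ m → v c = L.exit (m + 1) (pod c (m + 1)) := fun c h => if_neg h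
    have hvW : ∀ c < L.n, m ≤ L.height c → v c ∈ W ∧ L.level (v c) = m := by
      intro c hc hmc
      by_cases hcm : L.height c = m
      · rw [hv1 c hcm]; exact ⟨L.w_mem c, hcm⟩
      · rw [hv2 c hcm]
        obtain ⟨h1, h2, -⟩ := (h.isPod c hc (m + 1) le_rfl (by omega)).2.2.2.2.2 (by omega)
        exact ⟨h1, by omega⟩
    suffices ∃ P : ℕ → Set V,
        (∀ c, c < L.n ∧ m ≤ L.height c → (∃ F b, L.IsPod m (P c) F b) ∧ v c ∈ P c) ∧
        (∀ c c', c < L.n ∧ m ≤ L.height c → c' < L.n ∧ m ≤ L.height c' →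
          (P c ∩ P c').Nonempty → P c = P c') by
      obtain ⟨P, hP1, hP2⟩ := this
      let pod' : ℕ → ℕ → Set V := fun c k => if k = m then P c else pod c k
      have e1 : ∀ c, pod' c m = P c := fun c => if_pos rfl
      have e2 : ∀ c k, m + 1 ≤ k → pod' c k = pod c k := fun c k hk => if_neg (by omega)
      refine ⟨pod', ⟨fun c hc k h1 h2 => ?_, fun c hc h1 => ?_, fun c hc k h1 h2 => ?_,
        fun c hc c' hc' k h1 h2 h3 h4 => ?_⟩⟩
      · rcases h1.eq_or_lt with rfl | h1
        · rw [e1]; exact isPod_center_exit (hP1 c ⟨hc, h2⟩).1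
        · rw [e2 c k h1]; exact h.isPod c hc k h1 h2
      · rcases h1.eq_or_lt with h1 | h1
        · rw [← h1, e1, ← hv1 c h1.symm]; exact (hP1 c ⟨hc, h1.le⟩).2
        · rw [e2 c _ h1]; exact h.w_mem c hc h1
      · rw [e2 c (k + 1) (by omega)]
        rcases h1.eq_or_lt with rfl | h1
        · rw [e1, ← hv2 c (by omega)]; exact (hP1 c ⟨hc, by omega⟩).2
        · rw [e2 c k h1]; exact h.exit_mem c hc k h1 h2
      · rcases h1.eq_or_lt with rfl | h1
        · rw [e1, e1] at h4 ⊢; exact hP2 c c' ⟨hc, h2⟩ ⟨hc', h3⟩ h4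
        · rw [e2 c k h1, e2 c' k h1] at h4 ⊢
          exact h.eq_of_inter c hc c' hc' k h1 h2 h3 h4
    rcases Nat.eq_zero_or_pos m with rfl | hmpos
    · obtain ⟨R, hR, hR0⟩ := L.exists_region (L.w_mem 0)
      refine ⟨fun _ => {L.w 0}, fun c hc => ⟨⟨R, L.w 0, isConnectedSet_singleton G _,
        Set.singleton_subset_iff.2 (L.w_mem 0), ?_, hR, ?_, fun h => absurd h (by omega)⟩, ?_⟩,
        fun _ _ _ _ _ => rfl⟩
      · rintro x rfl; exact L.level_w_zero
      · rintro x rfl; exact ⟨R, hR0, (ContactDistLE.refl hR).mono zero_le_one⟩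
      · exact L.eq_of_level_zero _ (hvW c hc.1 hc.2).1 (hvW c hc.1 hc.2).2
    -- The tail of a chain: its pods above level `m`, together with the vertex at which it arrives.
    · let A : ℕ → Set V := fun c => {v c} ∪ IsPodFamily.chainFrom L pod c (m + 1)
      have hlev : ∀ c < L.n, ∀ k, m + 1 ≤ k → k ≤ L.height c → ∀ x ∈ pod c k, L.level x = k :=
        fun c hc k h1 h2 => (h.isPod c hc k h1 h2).2.2.1
      have hA : ∀ c, c < L.n ∧ m ≤ L.height c → IsConnectedSet G (A c) := by
        intro c hc
        by_cases hcm : L.height c = m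
        · have : A c = {v c} := by
            refine Set.union_eq_self_of_subset_right ?_
            rintro x ⟨k, h1, h2, -⟩
            omega
          rw [this]
          exact isConnectedSet_singleton G _
        · obtain ⟨-, -, y, hy, -, hyb⟩ := (h.isPod c hc.1 (m + 1) le_rfl
            (by have := hc.2; omega)).2.2.2.2.2 (by omega)
          rw [← hv2 c hcm] at hyb
          exact (isConnectedSet_singleton G _).union (h.isConnectedSet_chainFrom hc.1 le_rfl
            (by have := hc.2; omega)) ⟨_, rfl, y, ⟨m + 1, le_rfl, by have := hc.2; omega, hy⟩,
              Or.inr hyb.symm⟩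
      have hwA : ∀ c, c < L.n ∧ m ≤ L.height c → L.w c ∈ A c := by
        intro c hc
        by_cases hcm : L.height c = m
        · exact Or.inl (hv1 c hcm).symm
        · exact Or.inr (h.w_mem_chainFrom hc.1 le_rfl (by have := hc.2; omega))
      have hAl : ∀ c, c < L.n ∧ m ≤ L.height c → ∀ x ∈ A c,
          m ≤ L.level x ∧ (L.level x = m → x = v c) := by
        rintro c hc x (rfl | ⟨k, h1, h2, h3⟩)
        · exact ⟨(hvW c hc.1 hc.2).2.ge, fun _ => rfl⟩
        · have := hlev c hc.1 k h1 h2 x h3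
          exact ⟨by omega, fun h => by omega⟩
      have hAA : ∀ c c', c < L.n ∧ m ≤ L.height c → c' < L.n ∧ m ≤ L.height c' →
          (A c ∩ A c').Nonempty → v c = v c' := by
        rintro c c' hc hc' ⟨x, hx, hx'⟩
        rcases hx with rfl | ⟨k, h1, h2, h3⟩
        · rcases hx' with hx' | ⟨k, h1, h2, h3⟩
          · exact hx'
          · have := hlev c' hc'.1 k h1 h2 _ h3
            have := (hvW c hc.1 hc.2).2
            omega
        · rcases hx' with rfl | ⟨k', h1', h2', h3'⟩
          · have := hlev c hc.1 k h1 h2 _ h3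
            have := (hvW c' hc'.1 hc'.2).2
            omega
          · have e1 := hlev c hc.1 k h1 h2 x h3
            have e2 := hlev c' hc'.1 k' h1' h2' x h3'
            obtain rfl : k = k' := e1.symm.trans e2
            have := h.eq_below hc.1 hc'.1 le_rfl h1 h2 h2'
              (h.eq_of_inter c hc.1 c' hc'.1 k h1 h2 h2' ⟨x, h3, h3'⟩)
            rw [hv2 c (by omega), hv2 c' (by omega), this]
      obtain ⟨P, h1, -, h3⟩ := L.exists_pods_of_level hmpos
        (fun c => c < L.n ∧ m ≤ L.height c) (fun _ => Iff.rfl) v A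
        (fun c hc => (hvW c hc.1 hc.2).2)
        (fun c hc => Set.union_subset (Set.singleton_subset_iff.2 (hvW c hc.1 hc.2).1)
          (h.chainFrom_subset hc.1 le_rfl)) hA (fun c _ => Or.inl rfl) hwA hAl hAA
      exact ⟨P, h1, h3⟩

namespace IsPodFamily

variable {L : Layout G W 𝓡} {pod : ℕ → ℕ → Set V}

theorem pod_zero (h : L.IsPodFamily 0 pod) {c : ℕ} (hc : c < L.n) : pod c 0 = {L.w 0} := by
  obtain ⟨h1, h2, h3, -⟩ := h.isPod c hc 0 le_rfl (Nat.zero_le _)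
  obtain ⟨x, hx⟩ := h1.nonempty
  have : ∀ x ∈ pod c 0, x = L.w 0 := fun x hx => L.eq_of_level_zero x (h2 hx) (h3 x hx)
  exact Set.eq_singleton_iff_unique_mem.2 ⟨this x hx ▸ hx, this⟩

/-- The chains that a set meets. -/
def hits (L : Layout G W 𝓡) (pod : ℕ → ℕ → Set V) (S : Set V) : Set ℕ :=
  {c | c < L.n ∧ ∃ k ≤ L.height c, (S ∩ pod c k).Nonempty}

/-- The chains that a connected set meets are consecutive. -/
theorem mem_hits_of_between (h : L.IsPodFamily 0 pod) {S : Set V} (hS : IsConnectedSet G S)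
    (hSW : S ⊆ W) {a g b : ℕ} (ha : a ∈ hits L pod S) (hb : b ∈ hits L pod S) (hag : a ≤ g)
    (hgb : g ≤ b) : g ∈ hits L pod S := by
  rcases hag.eq_or_lt with rfl | hag
  · exact ha
  rcases hgb.eq_or_lt with rfl | hgb
  · exact hb
  by_contra hg
  obtain ⟨hbn, kb, hkb, xb, hxb, hxb'⟩ := hb
  obtain ⟨han, ka, hka, xa, hxa, hxa'⟩ := ha
  have hgn : g < L.n := hgb.trans hbn
  have hno : ∀ k ≤ L.height g, ∀ x ∈ S, x ∉ pod g k := fun k hk x hx hx' =>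
    hg ⟨hgn, k, hk, x, hx, hx'⟩
  have hka0 : 0 < ka := by
    rcases Nat.eq_zero_or_pos ka with rfl | h0
    · exfalso
      rw [h.pod_zero han] at hxa'
      exact hno 0 (Nat.zero_le _) xa hxa (by rw [h.pod_zero hgn]; exact hxa')
    · exact h0
  have ha0 : 0 < a := by
    rcases Nat.eq_zero_or_pos a with rfl | h0
    · have : L.height 0 = 0 := L.level_w_zero
      omega
    · exact h0
  have hlev : ∀ c < L.n, ∀ k, k ≤ L.height c → ∀ x ∈ pod c k, L.level x = k :=
    fun c hc k h2 => (h.isPod c hc k (Nat.zero_le _) h2).2.2.1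
  -- The upper parts of the chains `a` and `b`, joined through `S`, connect `w a` to `w b`, so they
  -- must cross the whole chain `g`, which joins `w g` to `w 0`.
  have hc2 : IsConnectedSet G (S ∪ chainFrom L pod a ka ∪ chainFrom L pod b kb) :=
    (hS.union_of_inter (h.isConnectedSet_chainFrom han (Nat.zero_le _) hka)
      ⟨xa, hxa, ka, le_rfl, hka, hxa'⟩).union_of_inter
      (h.isConnectedSet_chainFrom hbn (Nat.zero_le _) hkb)
      ⟨xb, Or.inl hxb, kb, le_rfl, hkb, hxb'⟩
  obtain ⟨x, ⟨k, -, hk, hxg⟩, hx⟩ := L.noncrossing a g b ha0 hag hgb hbn _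
    (h.chainFrom_subset hgn (Nat.zero_le 0)) _
    (Set.union_subset (Set.union_subset hSW (h.chainFrom_subset han (Nat.zero_le _)))
      (h.chainFrom_subset hbn (Nat.zero_le _)))
    (h.isConnectedSet_chainFrom hgn (Nat.zero_le 0) (Nat.zero_le _)) hc2
    ⟨0, le_rfl, Nat.zero_le _, by rw [h.pod_zero hgn]; rfl⟩
    (h.w_mem_chainFrom hgn (Nat.zero_le 0) (Nat.zero_le _))
    (Or.inl (Or.inr (h.w_mem_chainFrom han (Nat.zero_le _) hka)))
    (Or.inr (h.w_mem_chainFrom hbn (Nat.zero_le _) hkb))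
  -- Where chain `g` meets another chain, the two agree from there down, in particular at the pod
  -- that `S` meets.
  have key : ∀ c < L.n, ∀ j ≤ L.height c, ∀ y ∈ S, y ∈ pod c j → x ∈ chainFrom L pod c j →
      False := by
    rintro c hc j hj y hyS hy ⟨k', hjk, hk', hxk⟩
    obtain rfl : k = k' := (hlev g hgn k hk x hxg).symm.trans (hlev c hc k' hk' x hxk)
    have e1 := h.eq_of_inter c hc g hgn k (Nat.zero_le _) hk' hk ⟨x, hxk, hxg⟩
    have e2 := h.eq_below hc hgn (Nat.zero_le j) hjk hk' hk e1
    exact hno j (hjk.trans hk) y hyS (e2 ▸ hy)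
  rcases hx with (hx | hx) | hx
  · exact hno k hk x hx hxg
  · exact key a han ka hka xa hxa hxa' hx
  · exact key b hbn kb hkb xb hxb hxb' hx

end IsPodFamily

end Layout

end PodFamilies

/-! ### Covering a family of intervals -/

section IntervalCover

/-- A family of sets of numbers below `n` is covered greedily, from left to right: `s` runs over
the starting points, and `X s` is a member through `s` that reaches furthest. -/
theorem exists_interval_cover {ι : Type*} [Inhabited ι] (F : Set ι) (I : ι → Set ℕ) (n : ℕ)
    (hI : ∀ X ∈ F, ∀ c ∈ I X, c < n) : ∃ (St : Set ℕ) (X : ℕ → ι) (b : ℕ → ℕ),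
      (∀ s ∈ St, X s ∈ F ∧ s ∈ I (X s) ∧ b s ∈ I (X s)) ∧
      (∀ s ∈ St, ∀ Y ∈ F, s ∈ I Y → ∀ c ∈ I Y, c ≤ b s) ∧
      (∀ s ∈ St, ∀ s' ∈ St, s < s' → b s < s') ∧
      (∀ Y ∈ F, ∀ c ∈ I Y, ∃ s ∈ St, s ≤ c ∧ c ≤ b s) := by
  classical
  have hex : ∀ s, ∃ (X : ι) (b : ℕ), (∃ Y ∈ F, s ∈ I Y) →
      X ∈ F ∧ s ∈ I X ∧ b ∈ I X ∧ ∀ Y ∈ F, s ∈ I Y → ∀ c ∈ I Y, c ≤ b := by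
    intro s
    by_cases hs : ∃ Y ∈ F, s ∈ I Y
    · obtain ⟨Y, hY, hsY⟩ := hs
      let p : ℕ → Prop := fun c => ∃ Y ∈ F, s ∈ I Y ∧ c ∈ I Y
      have hp : p (Nat.findGreatest p n) :=
        Nat.findGreatest_spec (P := p) (hI Y hY s hsY).le ⟨Y, hY, hsY, hsY⟩
      obtain ⟨X, hX, h1, h2⟩ := hp
      exact ⟨X, _, fun _ => ⟨hX, h1, h2, fun Z hZ hsZ c hc =>
        Nat.le_findGreatest (P := p) (hI Z hZ c hc).le ⟨Z, hZ, hsZ, hc⟩⟩⟩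
    · exact ⟨default, 0, fun h => absurd h hs⟩
  choose X b hXb using hex
  refine ⟨{c | greedySet (fun s => ∃ Y ∈ F, s ∈ I Y) (fun s c => b s < c) c}, X, b, ?_, ?_, ?_, ?_⟩
  · intro s hs
    obtain ⟨h1, h2, h3, -⟩ := hXb s (greedySet_iff.1 hs).1
    exact ⟨h1, h2, h3⟩
  · intro s hs
    exact (hXb s (greedySet_iff.1 hs).1).2.2.2
  · intro s hs s' hs' hlt
    exact (greedySet_iff.1 hs').2 s hlt hs
  · intro Y hY c hc
    by_contra hcon
    push Not at hcon
    have : greedySet (fun s => ∃ Y ∈ F, s ∈ I Y) (fun s c => b s < c) c :=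
      greedySet_iff.2 ⟨⟨Y, hY, hc⟩, fun s hs hs' => hcon s hs' hs.le⟩
    exact absurd (hcon c this le_rfl)
      (not_lt.2 ((hXb c ⟨Y, hY, hc⟩).2.2.2 Y hY hc c hc))

end IntervalCover

/-! ### Disjoint pieces representing the regions of two consecutive ranks -/

section Bands

variable {V : Type u} {G : SimpleGraph V} {W : Set V} {𝓡 : Set (Set V)}

/-- Connected pieces cut successively out of a sequence of sets. -/
def peel (G : SimpleGraph V) (St : Set ℕ) (U : ℕ → Set V) (p : ℕ → V) (s : ℕ) : Set V :=
  compOf G (U s \ {x | ∃ r, ∃ _ : r < s, r ∈ St ∧ x ∈ peel G St U p r}) (p s)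
termination_by s

namespace Layout

/-- The least level of a vertex of a set. -/
noncomputable def rank (L : Layout G W 𝓡) (R : Set V) : ℕ := sInf (L.level '' R)

theorem rank_le (L : Layout G W 𝓡) {R : Set V} {x : V} (hx : x ∈ R) : L.rank R ≤ L.level x :=
  Nat.sInf_le ⟨x, hx, rfl⟩

theorem level_le_rank (L : Layout G W 𝓡) {R : Set V} (hR : R ∈ 𝓡) {x : V} (hx : x ∈ R) :
    L.level x ≤ L.rank R + 1 := by
  obtain ⟨y, hy, he⟩ := Nat.sInf_mem ((L.region_conn R hR).nonempty.image L.level)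
  have := L.level_region R hR x hx y hy
  rw [he] at this
  exact this

/-- The set contains every pod that it meets. -/
def PodClosed (L : Layout G W 𝓡) (pod : ℕ → ℕ → Set V) (X : Set V) : Prop :=
  ∀ c < L.n, ∀ k ≤ L.height c, (X ∩ pod c k).Nonempty → pod c k ⊆ X

/-- The union of all pods. -/
def podUnion (L : Layout G W 𝓡) (pod : ℕ → ℕ → Set V) : Set V :=
  {x | ∃ c < L.n, ∃ k ≤ L.height c, x ∈ pod c k}

/-- A set together with all the pods that it meets. -/
def podHull (L : Layout G W 𝓡) (pod : ℕ → ℕ → Set V) (X : Set V) : Set V :=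
  X ∪ ⋃₀ {t | ∃ c < L.n, ∃ k ≤ L.height c, t = pod c k ∧ (X ∩ pod c k).Nonempty}

namespace PodClosed

variable {L : Layout G W 𝓡} {pod : ℕ → ℕ → Set V} {X Y : Set V}

theorem diff (hX : L.PodClosed pod X) (hY : L.PodClosed pod Y) : L.PodClosed pod (X \ Y) := by
  rintro c hc k hk ⟨x, ⟨hxX, hxY⟩, hx⟩ y hy
  exact ⟨hX c hc k hk ⟨x, hxX, hx⟩ hy, fun hyY => hxY (hY c hc k hk ⟨y, hyY, hy⟩ hx)⟩

theorem union (hX : L.PodClosed pod X) (hY : L.PodClosed pod Y) : L.PodClosed pod (X ∪ Y) := by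
  rintro c hc k hk ⟨x, hx | hx, hxp⟩
  · exact (hX c hc k hk ⟨x, hx, hxp⟩).trans Set.subset_union_left
  · exact (hY c hc k hk ⟨x, hx, hxp⟩).trans Set.subset_union_right

theorem sUnion {F : Set (Set V)} (hF : ∀ X ∈ F, L.PodClosed pod X) : L.PodClosed pod (⋃₀ F) := by
  rintro c hc k hk ⟨x, ⟨X, hX, hxX⟩, hx⟩
  exact (hF X hX c hc k hk ⟨x, hxX, hx⟩).trans (Set.subset_sUnion_of_mem hX)

theorem compOf (h : L.IsPodFamily 0 pod) (hX : L.PodClosed pod X) (x : V) :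
    L.PodClosed pod (compOf G X x) := by
  rintro c hc k hk ⟨y, hy, hyp⟩
  exact (h.isPod c hc k (Nat.zero_le _) hk).1.subset_compOf'
    (hX c hc k hk ⟨y, compOf_subset hy, hyp⟩) ⟨y, hyp, hy⟩

end PodClosed

namespace IsPodFamily

variable {L : Layout G W 𝓡} {pod : ℕ → ℕ → Set V} {X Y : Set V}

theorem level_eq (h : L.IsPodFamily 0 pod) {c k : ℕ} (hc : c < L.n) (hk : k ≤ L.height c) {x : V}
    (hx : x ∈ pod c k) : L.level x = k :=
  (h.isPod c hc k (Nat.zero_le _) hk).2.2.1 x hx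

theorem eq_of_mem (h : L.IsPodFamily 0 pod) {c k c' k' : ℕ} (hc : c < L.n) (hk : k ≤ L.height c)
    (hc' : c' < L.n) (hk' : k' ≤ L.height c') {x : V} (hx : x ∈ pod c k) (hx' : x ∈ pod c' k') :
    k = k' ∧ pod c k = pod c' k' := by
  obtain rfl : k = k' := (h.level_eq hc hk hx).symm.trans (h.level_eq hc' hk' hx')
  exact ⟨rfl, h.eq_of_inter c hc c' hc' k (Nat.zero_le _) hk hk' ⟨x, hx, hx'⟩⟩

theorem podClosed_podHull (h : L.IsPodFamily 0 pod) (X : Set V) :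
    L.PodClosed pod (L.podHull pod X) := by
  rintro c hc k hk ⟨x, hx | ⟨_, ⟨c', hc', k', hk', rfl, hne⟩, hx⟩, hxp⟩
  · exact fun y hy => Or.inr ⟨_, ⟨c, hc, k, hk, rfl, x, hx, hxp⟩, hy⟩
  · obtain ⟨rfl, he⟩ := h.eq_of_mem hc hk hc' hk' hxp hx
    exact fun y hy => Or.inr ⟨_, ⟨c', hc', k, hk', rfl, hne⟩, he ▸ hy⟩

theorem isConnectedSet_podHull (h : L.IsPodFamily 0 pod) (hX : IsConnectedSet G X) :
    IsConnectedSet G (L.podHull pod X) := by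
  refine hX.union_sUnion _ ?_
  rintro _ ⟨c, hc, k, hk, rfl, x, hx, hx'⟩
  exact ⟨(h.isPod c hc k (Nat.zero_le _) hk).1, x, hx, x, hx', Or.inl rfl⟩

theorem podHull_subset (h : L.IsPodFamily 0 pod) (hX : X ⊆ W) : L.podHull pod X ⊆ W := by
  refine Set.union_subset hX (Set.sUnion_subset ?_)
  rintro _ ⟨c, hc, k, hk, rfl, -⟩
  exact (h.isPod c hc k (Nat.zero_le _) hk).2.1

theorem hits_mono (hXY : X ⊆ Y) : hits L pod X ⊆ hits L pod Y :=
  fun _ ⟨hc, k, hk, x, hx, hx'⟩ => ⟨hc, k, hk, x, hXY hx, hx'⟩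

theorem hits_podHull (h : L.IsPodFamily 0 pod) (X : Set V) :
    hits L pod (L.podHull pod X) = hits L pod X := by
  refine Set.Subset.antisymm ?_ (hits_mono Set.subset_union_left)
  rintro c ⟨hc, k, hk, x, hx | ⟨_, ⟨c', hc', k', hk', rfl, y, hy, hy'⟩, hx⟩, hxp⟩
  · exact ⟨hc, k, hk, x, hx, hxp⟩
  · obtain ⟨rfl, he⟩ := h.eq_of_mem hc hk hc' hk' hxp hx
    exact ⟨hc, k, hk, y, hy, he ▸ hy'⟩

theorem level_podHull (h : L.IsPodFamily 0 pod) {x : V} (hx : x ∈ L.podHull pod X) :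
    ∃ y ∈ X, L.level x = L.level y := by
  rcases hx with hx | ⟨_, ⟨c, hc, k, hk, rfl, y, hy, hy'⟩, hx⟩
  · exact ⟨x, hx, rfl⟩
  · exact ⟨y, hy, (h.level_eq hc hk hx).trans (h.level_eq hc hk hy').symm⟩

/-- A vertex of an added pod is within 1 of the center, and the center is within 2 of `X` because
`X` meets the pod. -/
theorem nearRegion_podHull (h : L.IsPodFamily 0 pod) (hX : X ∈ 𝓡) {x : V}
    (hx : x ∈ L.podHull pod X) : NearRegion G 𝓡 3 x X := by
  rcases hx with hx | ⟨_, ⟨c, hc, k, hk, rfl, y, hy, hy'⟩, hx⟩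
  · exact ⟨X, hx, (ContactDistLE.refl hX).mono (by omega)⟩
  · have h1 := (h.isPod c hc k (Nat.zero_le _) hk).2.2.2.2.1
    exact (h1 x hx).trans ((h1 y hy').contactDistLE hX hy (Or.inl rfl)).symm

end IsPodFamily

/-- A band of the layout: pairwise disjoint connected pieces of (hulls of) regions of rank `2 * g`
and `2 * g + 1`, one for each starting point in `St`, which together meet all the chains met by
such regions. -/
structure Band (L : Layout G W 𝓡) (pod : ℕ → ℕ → Set V) (g : ℕ) where
  /-- The starting points. -/
  St : Set ℕ
  /-- The region of a piece. -/
  X : ℕ → Set V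
  /-- The last chain of a piece. -/
  b : ℕ → ℕ
  /-- The pieces. -/
  Y : ℕ → Set V
  X_mem : ∀ s ∈ St, X s ∈ 𝓡
  rank_X : ∀ s ∈ St, L.rank (X s) / 2 = g
  b_lt : ∀ s ∈ St, ∀ s' ∈ St, s < s' → b s < s'
  cover : ∀ R ∈ 𝓡, L.rank R / 2 = g → ∀ c ∈ IsPodFamily.hits L pod R, ∃ s ∈ St, s ≤ c ∧ c ≤ b s
  le_b : ∀ R ∈ 𝓡, L.rank R / 2 = g → ∀ s ∈ St, s ∈ IsPodFamily.hits L pod R →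
    ∀ c ∈ IsPodFamily.hits L pod R, c ≤ b s
  s_le_b : ∀ s ∈ St, s ≤ b s
  conn : ∀ s ∈ St, IsConnectedSet G (Y s)
  subset : ∀ s ∈ St, Y s ⊆ W
  podClosed : ∀ s ∈ St, L.PodClosed pod (Y s)
  near : ∀ s ∈ St, ∀ x ∈ Y s, NearRegion G 𝓡 3 x (X s)
  level_mem : ∀ s ∈ St, ∀ x ∈ Y s, L.rank (X s) ≤ L.level x ∧ L.level x ≤ L.rank (X s) + 1
  hits_Y : ∀ s ∈ St, IsPodFamily.hits L pod (Y s) ⊆ IsPodFamily.hits L pod (X s)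
  mem_hits : ∀ s ∈ St, ∀ c, s ≤ c → c ≤ b s → c ∈ IsPodFamily.hits L pod (Y s)
  disjoint : ∀ s ∈ St, ∀ s' ∈ St, s ≠ s' → Disjoint (Y s) (Y s')

-- The regions of the band are covered greedily as intervals of chains. The pod hull of each
-- selected region loses the earlier pieces, and the component reaching its last chain is kept.
-- Although trimmed, it still spans the interval from `s` to `b s`.
open IsPodFamily in
theorem IsPodFamily.nonempty_band {L : Layout G W 𝓡} {pod : ℕ → ℕ → Set V}
    (h : L.IsPodFamily 0 pod) (g : ℕ) : Nonempty (L.Band pod g) := by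
  classical
  obtain ⟨St, X, b, h1, h2, h3, h4⟩ := exists_interval_cover
    {R | R ∈ 𝓡 ∧ L.rank R / 2 = g} (hits L pod) L.n (fun _ _ c hc => hc.1)
  let U : ℕ → Set V := fun s => L.podHull pod (X s)
  have hX : ∀ s ∈ St, X s ∈ 𝓡 := fun s hs => (h1 s hs).1.1
  have hsb : ∀ s ∈ St, s ≤ b s := fun s hs =>
    h2 s hs _ (h1 s hs).1 (h1 s hs).2.1 s (h1 s hs).2.1
  have hp : ∀ s, ∃ p, s ∈ St → p ∈ X s ∧ ∃ k ≤ L.height (b s), p ∈ pod (b s) k := by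
    intro s
    by_cases hs : s ∈ St
    · obtain ⟨-, k, hk, p, hp, hp'⟩ := (h1 s hs).2.2
      exact ⟨p, fun _ => ⟨hp, k, hk, hp'⟩⟩
    · exact ⟨L.w 0, fun h => absurd h hs⟩
  choose p hp using hp
  let Y : ℕ → Set V := peel G St U p
  let Z : ℕ → Set V := fun s => ⋃₀ {T | ∃ r < s, r ∈ St ∧ T = Y r}
  have hY : ∀ s, Y s = compOf G (U s \ Z s) (p s) := by
    intro s
    simp only [Y]
    rw [peel]
    congr 2
    ext x
    constructor
    · rintro ⟨r, hr, hr', hx⟩; exact ⟨_, ⟨r, hr, hr', rfl⟩, hx⟩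
    · rintro ⟨_, ⟨r, hr, hr', rfl⟩, hx⟩; exact ⟨r, hr, hr', hx⟩
  have hYU : ∀ s, Y s ⊆ U s := fun s => by rw [hY]; exact compOf_subset.trans Set.sdiff_subset
  have hYX : ∀ s, hits L pod (Y s) ⊆ hits L pod (X s) := fun s => by
    rw [← h.hits_podHull (X s)]; exact hits_mono (hYU s)
  have hYb : ∀ s ∈ St, ∀ c ∈ hits L pod (Y s), c ≤ b s := fun s hs c hc =>
    h2 s hs _ (h1 s hs).1 (h1 s hs).2.1 c (hYX s hc)
  have hbU : ∀ s ∈ St, b s ∈ hits L pod (U s) := fun s hs => by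
    rw [h.hits_podHull]; exact (h1 s hs).2.2
  -- An earlier piece `Y r` meets no chain beyond `b r`, and `b r < s ≤ b s`.
  have hpU : ∀ s ∈ St, p s ∈ U s \ Z s := by
    intro s hs
    obtain ⟨hpX, k, hk, hpk⟩ := hp s hs
    refine ⟨Or.inl hpX, ?_⟩
    rintro ⟨_, ⟨r, hr, hrs, rfl⟩, hpr⟩
    have e1 := hYb r hrs (b s) ⟨(h1 s hs).2.2.1, k, hk, p s, hpr, hpk⟩
    have e2 := h3 r hrs s hs hr
    have e3 := hsb s hs
    omega
  have hUc : ∀ s ∈ St, IsConnectedSet G (U s) := fun s hs =>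
    h.isConnectedSet_podHull (L.region_conn _ (hX s hs))
  have hUW : ∀ s ∈ St, U s ⊆ W := fun s hs => h.podHull_subset (L.region_subset (hX s hs))
  have hYc : ∀ s ∈ St, IsConnectedSet G (Y s) := fun s hs => by
    rw [hY]; exact isConnectedSet_compOf (hpU s hs)
  have hYW : ∀ s ∈ St, Y s ⊆ W := fun s hs => (hYU s).trans (hUW s hs)
  have hYp : ∀ s, L.PodClosed pod (Y s) := by
    intro s
    induction s using Nat.strong_induction_on with
    | _ s ih =>
      rw [hY]
      refine PodClosed.compOf h ((h.podClosed_podHull _).diff (PodClosed.sUnion ?_)) _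
      rintro _ ⟨r, hr, -, rfl⟩
      exact ih r hr
  have hbY : ∀ s ∈ St, b s ∈ hits L pod (Y s) := by
    intro s hs
    obtain ⟨-, k, hk, hpk⟩ := hp s hs
    refine ⟨(h1 s hs).2.2.1, k, hk, p s, ?_, hpk⟩
    rw [hY]; exact mem_compOf_self (hpU s hs)
  -- If something was cut off, the piece is adjacent to an earlier `Y r`. Their union meets the
  -- chains `b r` and `b s`, hence also `s` between them, which `Y r` does not reach.
  have hsY : ∀ s ∈ St, s ∈ hits L pod (Y s) := by
    intro s hs
    by_cases hne : (U s ∩ Z s).Nonempty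
    · obtain ⟨y, hy, z, -, ⟨_, ⟨r, hr, hrs, rfl⟩, hz⟩, hyz⟩ := (hUc s hs).exists_adj_compOf hne
        (hpU s hs).1 (hpU s hs).2
      rw [← hY] at hy
      have hcon := (hYc s hs).union (hYc r hrs) ⟨y, hy, z, hz, Or.inr hyz⟩
      have hbr : b r ∈ hits L pod (Y r) := hbY r hrs
      have := h.mem_hits_of_between hcon (Set.union_subset (hYW s hs) (hYW r hrs)) (g := s)
        (hits_mono Set.subset_union_right hbr) (hits_mono Set.subset_union_left (hbY s hs))
        (h3 r hrs s hs hr).le (hsb s hs)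
      obtain ⟨hsn, k, hk, x, hx | hx, hxp⟩ := this
      · exact ⟨hsn, k, hk, x, hx, hxp⟩
      · have e1 := hYb r hrs s ⟨hsn, k, hk, x, hx, hxp⟩
        have e2 := h3 r hrs s hs hr
        omega
    · have hUY : U s ⊆ Y s := by
        rw [hY]
        refine (hUc s hs).subset_compOf (fun x hx => ⟨hx, fun hz => hne ⟨x, hx, hz⟩⟩)
          (hpU s hs).1
      exact hits_mono (Set.subset_union_left.trans hUY) (h1 s hs).2.1
  have hdis : ∀ s, ∀ r ∈ St, r < s → Disjoint (Y r) (Y s) := by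
    intro s r hr hrs
    rw [hY s]
    exact Set.disjoint_left.2 fun x hx hx' => (compOf_subset hx').2 ⟨_, ⟨r, hrs, hr, rfl⟩, hx⟩
  exact ⟨{
    St := St, X := X, b := b, Y := Y
    X_mem := hX
    rank_X := fun s hs => (h1 s hs).1.2
    b_lt := h3
    cover := fun R hR hg => h4 R ⟨hR, hg⟩
    le_b := fun R hR hg s hs => h2 s hs R ⟨hR, hg⟩
    s_le_b := hsb
    conn := hYc
    subset := hYW
    podClosed := fun s _ => hYp s
    near := fun s hs x hx => h.nearRegion_podHull (hX s hs) (hYU s hx)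
    level_mem := fun s hs x hx => by
      obtain ⟨y, hy, he⟩ := h.level_podHull (hYU s hx)
      rw [he]
      exact ⟨L.rank_le hy, L.level_le_rank (hX s hs) hy⟩
    hits_Y := fun s _ => hYX s
    mem_hits := fun s hs c hc hc' =>
      h.mem_hits_of_between (hYc s hs) (hYW s hs) (hsY s hs) (hbY s hs) hc hc'
    disjoint := fun s hs s' hs' hne => by
      rcases lt_or_gt_of_ne hne with hlt | hlt
      · exact hdis s' s hs hlt
      · exact (hdis s s' hs' hlt).symm }⟩

end Layout

end Bands

/-! ### Growing connected clusters -/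

section ClusterMaps

variable {V : Type u} {G : SimpleGraph V} {W : Set V} {𝓡 : Set (Set V)}

/-- A partition of the set `D` into connected clusters, none of which cuts a pod, and each of which
contains a pod.  A cluster is represented by one of its vertices: `f x` is the representative
of the cluster of `x`. -/
structure IsClusterMap (L : Layout G W 𝓡) (pod : ℕ → ℕ → Set V) (D : Set V) (f : V → V) : Prop where
  subset : D ⊆ W
  rep_mem : ∀ x ∈ D, f x ∈ D
  conn : ∀ x ∈ D, IsConnectedSet G {y | y ∈ D ∧ f y = f x}
  podClosed : L.PodClosed pod D
  pod_eq : ∀ c < L.n, ∀ k ≤ L.height c, ∀ x ∈ pod c k, ∀ y ∈ pod c k, x ∈ D → f y = f x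
  meets : ∀ x ∈ D, ∃ y ∈ D, f y = f x ∧ y ∈ L.podUnion pod

/-- The cluster map `f'` extends `f` from `D` to `D ∪ ⋃₀ 𝒩`: for every `N ∈ 𝒩`, each component of
`N \ D` is joined to the cluster of an adjacent vertex `u` of `D` with `T N u`, or, if there is no
such vertex, `N` is a new cluster. -/
structure IsExtension (G : SimpleGraph V) (D : Set V) (f : V → V) (𝒩 : Set (Set V))
    (T : Set V → V → Prop) (f' : V → V) : Prop where
  eq : ∀ x ∈ D, f' x = f x
  attach : ∀ N ∈ 𝒩, ∀ x ∈ N, x ∉ D →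
    (∃ u ∈ D, f' x = f u ∧ T N u ∧ ∃ y ∈ compOf G (N \ D) x, G.Adj y u) ∨
    (Disjoint N D ∧ (∀ y ∈ D ∪ ⋃₀ 𝒩, (f' y = f' x ↔ y ∈ N)) ∧
      ¬ ∃ u ∈ D, T N u ∧ ∃ y ∈ compOf G (N \ D) x, G.Adj y u)

/-- The choice of a cluster depends only on the component of `N \ D`, so a component is never split
and joins its cluster by an edge. When there is no admissible neighbour, `N` is disjoint from `D`
and connected and becomes a cluster of its own. -/
theorem IsClusterMap.exists_extension {L : Layout G W 𝓡} {pod : ℕ → ℕ → Set V}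
    (h : L.IsPodFamily 0 pod) {D : Set V} {f : V → V} (hf : IsClusterMap L pod D f)
    (𝒩 : Set (Set V)) (T : Set V → V → Prop) (hdis : 𝒩.PairwiseDisjoint id)
    (hW : ∀ N ∈ 𝒩, N ⊆ W) (hpc : ∀ N ∈ 𝒩, L.PodClosed pod N)
    (hatt : ∀ N ∈ 𝒩, ∀ x ∈ N, x ∉ D →
      (∃ u ∈ D, T N u ∧ ∃ y ∈ compOf G (N \ D) x, G.Adj y u) ∨
      (Disjoint N D ∧ IsConnectedSet G N ∧ (N ∩ L.podUnion pod).Nonempty)) :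
    ∃ f', IsExtension G D f 𝒩 T f' ∧ IsClusterMap L pod (D ∪ ⋃₀ 𝒩) f' := by
  classical
  let A : Set V → Set V → Prop := fun N K => ∃ u ∈ D, T N u ∧ ∃ y ∈ K, G.Adj y u
  -- For a new cluster the representative is chosen from `N` alone, so that all its vertices agree.
  -- The value `L.w 0` is a dummy for empty `N`.
  let g : Set V → Set V → V := fun N K =>
    if h : A N K then f h.choose else if h' : N.Nonempty then h'.choose else L.w 0
  have hg1 : ∀ N K, A N K → ∃ u ∈ D, g N K = f u ∧ T N u ∧ ∃ y ∈ K, G.Adj y u := by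
    intro N K hA
    have : g N K = f hA.choose := dif_pos hA
    obtain ⟨h1, h2, h3⟩ := hA.choose_spec
    exact ⟨_, h1, this, h2, h3⟩
  have hg2 : ∀ N K, ¬ A N K → N.Nonempty → g N K ∈ N := by
    intro N K hA hne
    have : g N K = hne.choose := by
      simp only [g]
      rw [dif_neg hA, dif_pos hne]
    rw [this]
    exact hne.choose_spec
  let f' : V → V := fun x => if x ∈ D then f x else
    if h : ∃ N ∈ 𝒩, x ∈ N then g h.choose (compOf G (h.choose \ D) x) else x
  have hD : ∀ x ∈ D, f' x = f x := fun x hx => if_pos hx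
  have huniq : ∀ N ∈ 𝒩, ∀ N' ∈ 𝒩, ∀ x ∈ N, x ∈ N' → N = N' := by
    intro N hN N' hN' x hx hx'
    by_contra hne
    exact Set.disjoint_left.1 (hdis hN hN' hne) hx hx'
  have hN : ∀ N ∈ 𝒩, ∀ x ∈ N, x ∉ D → f' x = g N (compOf G (N \ D) x) := by
    intro N hN x hx hxD
    have hex : ∃ N ∈ 𝒩, x ∈ N := ⟨N, hN, hx⟩
    have : hex.choose = N := huniq _ hex.choose_spec.1 _ hN x hex.choose_spec.2 hx
    simp only [f']
    rw [if_neg hxD, dif_pos hex, this]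
  -- a vertex outside of `D` is attached, or its set is a new cluster
  have hcase : ∀ N ∈ 𝒩, ∀ x ∈ N, x ∉ D →
      (∃ u ∈ D, f' x = f u ∧ T N u ∧ ∃ y ∈ compOf G (N \ D) x, G.Adj y u) ∨
      (Disjoint N D ∧ IsConnectedSet G N ∧ (N ∩ L.podUnion pod).Nonempty ∧ f' x ∈ N ∧
        (∀ y ∈ N, f' y = f' x) ∧
        ¬ ∃ u ∈ D, T N u ∧ ∃ y ∈ compOf G (N \ D) x, G.Adj y u) := by
    intro N hNm x hx hxD
    by_cases hA : A N (compOf G (N \ D) x)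
    · left
      rw [hN N hNm x hx hxD]
      exact hg1 _ _ hA
    · right
      rcases hatt N hNm x hx hxD with h1 | ⟨h1, h2, h3⟩
      · exact absurd h1 hA
      · refine ⟨h1, h2, h3, ?_, fun y hy => ?_, hA⟩
        · rw [hN N hNm x hx hxD]; exact hg2 _ _ hA ⟨x, hx⟩
        · rw [hN N hNm x hx hxD, hN N hNm y hy (Set.disjoint_left.1 h1 hy)]
          congr 1
          exact compOf_eq (h2.subset_compOf (S := N \ D)
            (fun z hz => ⟨hz, Set.disjoint_left.1 h1 hz⟩) hx hy)
  have hnew : ∀ N ∈ 𝒩, ∀ x ∈ N, x ∉ D → Disjoint N D → f' x ∈ N →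
      (∀ y ∈ N, f' y = f' x) → ∀ y ∈ D ∪ ⋃₀ 𝒩, (f' y = f' x ↔ y ∈ N) := by
    intro N hNm x hx hxD h1 h2 h3 y hy
    refine ⟨fun hyx => ?_, h3 y⟩
    by_cases hyD : y ∈ D
    · exfalso
      rw [hD y hyD] at hyx
      exact Set.disjoint_left.1 h1 h2 (hyx ▸ hf.rep_mem y hyD)
    · obtain ⟨N', hN', hyN'⟩ := hy.resolve_left hyD
      rcases hcase N' hN' y hyN' hyD with ⟨u, hu, hyu, -⟩ | ⟨-, -, -, h4, -⟩
      · exact absurd (hf.rep_mem u hu) (Set.disjoint_left.1 h1 (by rw [← hyu, hyx]; exact h2))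
      · rw [huniq N hNm N' hN' _ h2 (hyx ▸ h4)]
        exact hyN'
  refine ⟨f', ⟨hD, fun N hNm x hx hxD => ?_⟩, ?_⟩
  · rcases hcase N hNm x hx hxD with h1 | ⟨h1, h2, h3, h4, h5, h6⟩
    · exact Or.inl h1
    · exact Or.inr ⟨h1, hnew N hNm x hx hxD h1 h4 h5, h6⟩
  have hKeq : ∀ N ∈ 𝒩, ∀ x ∈ N, x ∉ D → ∀ y ∈ compOf G (N \ D) x, f' y = f' x := by
    intro N hNm x hx hxD y hy
    have hy' := compOf_subset hy
    rw [hN N hNm x hx hxD, hN N hNm y hy'.1 hy'.2, compOf_eq hy]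
  -- fibres over representatives in `D`
  have hfib : ∀ u ∈ D, IsConnectedSet G {y | y ∈ D ∪ ⋃₀ 𝒩 ∧ f' y = f u} := by
    intro u hu
    have : {y | y ∈ D ∪ ⋃₀ 𝒩 ∧ f' y = f u} = {y | y ∈ D ∧ f y = f u} ∪
        ⋃₀ {K | ∃ N ∈ 𝒩, ∃ y ∈ N, y ∉ D ∧ K = compOf G (N \ D) y ∧ f' y = f u} := by
      ext y
      constructor
      · rintro ⟨hy, hyu⟩
        by_cases hyD : y ∈ D
        · exact Or.inl ⟨hyD, by rw [← hD y hyD, hyu]⟩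
        · obtain ⟨N, hNm, hyN⟩ := hy.resolve_left hyD
          exact Or.inr ⟨_, ⟨N, hNm, y, hyN, hyD, rfl, hyu⟩, mem_compOf_self ⟨hyN, hyD⟩⟩
      · rintro (⟨hy, hyu⟩ | ⟨_, ⟨N, hNm, x, hxN, hxD, rfl, hxu⟩, hy⟩)
        · exact ⟨Or.inl hy, by rw [hD y hy, hyu]⟩
        · exact ⟨Or.inr ⟨N, hNm, (compOf_subset hy).1⟩, by rw [hKeq N hNm x hxN hxD y hy, hxu]⟩
    rw [this]
    refine (hf.conn u hu).union_sUnion _ ?_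
    rintro _ ⟨N, hNm, x, hxN, hxD, rfl, hxu⟩
    refine ⟨isConnectedSet_compOf ⟨hxN, hxD⟩, ?_⟩
    rcases hcase N hNm x hxN hxD with ⟨u', hu', hxu', -, y, hy, hyu⟩ | ⟨h1, -, -, h4, -⟩
    · exact ⟨u', ⟨hu', by rw [← hxu', hxu]⟩, y, hy, Or.inr hyu.symm⟩
    · exact absurd (hf.rep_mem u hu) (Set.disjoint_left.1 h1 (hxu ▸ h4))
  have hreps : ∀ x ∈ D ∪ ⋃₀ 𝒩, (∃ u ∈ D, f' x = f u) ∨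
      ∃ N ∈ 𝒩, IsConnectedSet G N ∧ (N ∩ L.podUnion pod).Nonempty ∧ f' x ∈ N ∧
        ∀ y ∈ D ∪ ⋃₀ 𝒩, (f' y = f' x ↔ y ∈ N) := by
    intro x hx
    by_cases hxD : x ∈ D
    · exact Or.inl ⟨x, hxD, hD x hxD⟩
    · obtain ⟨N, hNm, hxN⟩ := hx.resolve_left hxD
      rcases hcase N hNm x hxN hxD with ⟨u, hu, hxu, -⟩ | ⟨h1, h2, h3, h4, h5, -⟩
      · exact Or.inl ⟨u, hu, hxu⟩
      · exact Or.inr ⟨N, hNm, h2, h3, h4, hnew N hNm x hxN hxD h1 h4 h5⟩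
  refine ⟨Set.union_subset hf.subset (Set.sUnion_subset hW), fun x hx => ?_, fun x hx => ?_,
    hf.podClosed.union (Layout.PodClosed.sUnion hpc), ?_, fun x hx => ?_⟩
  · rcases hreps x hx with ⟨u, hu, hxu⟩ | ⟨N, hNm, -, -, hxN, -⟩
    · rw [hxu]; exact Or.inl (hf.rep_mem u hu)
    · exact Or.inr ⟨N, hNm, hxN⟩
  · rcases hreps x hx with ⟨u, hu, hxu⟩ | ⟨N, hNm, h1, -, -, h3⟩
    · rw [hxu]; exact hfib u hu
    · convert h1 using 1
      ext y
      exact ⟨fun hy => (h3 y hy.1).1 hy.2, fun hy =>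
        have hy' : y ∈ D ∪ ⋃₀ 𝒩 := Or.inr ⟨N, hNm, hy⟩
        ⟨hy', (h3 y hy').2 hy⟩⟩
  · intro c hc k hk x hx y hy hxD'
    by_cases hxD : x ∈ D
    · rw [hD x hxD, hD y (hf.podClosed c hc k hk ⟨x, hxD, hx⟩ hy)]
      exact hf.pod_eq c hc k hk x hx y hy hxD
    · obtain ⟨N, hNm, hxN⟩ := hxD'.resolve_left hxD
      refine hKeq N hNm x hxN hxD y ?_
      refine (h.isPod c hc k (Nat.zero_le _) hk).1.subset_compOf (S := N \ D) (fun z hz => ⟨?_, ?_⟩) hx hy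
      · exact hpc N hNm c hc k hk ⟨x, hxN, hx⟩ hz
      · exact fun hzD => hxD (hf.podClosed c hc k hk ⟨z, hzD, hz⟩ hx)
  · rcases hreps x hx with ⟨u, hu, hxu⟩ | ⟨N, hNm, -, ⟨y, hyN, hy⟩, -, h3⟩
    · obtain ⟨y, hy, hyu, hyp⟩ := hf.meets u hu
      exact ⟨y, Or.inl hy, by rw [hD y hy, hyu, hxu], hyp⟩
    · have hy' : y ∈ D ∪ ⋃₀ 𝒩 := Or.inr ⟨N, hNm, hyN⟩
      exact ⟨y, hy', (h3 y hy').2 hyN, hy⟩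

/-- A property of the vertices of a cluster in terms of data assigned to the cluster. -/
def ClusterProp {α : Type*} (D : Set V) (f : V → V) (Q : V → α → Prop) : Prop :=
  ∀ x ∈ D, ∃ p, ∀ y ∈ D, f y = f x → Q y p

/-- An enlarged cluster keeps its old data `p`. Only the transfer across a single attaching edge and
the data of new clusters have to be supplied. -/
theorem IsExtension.clusterProp {α : Type*} {D : Set V} {f f' : V → V} {𝒩 : Set (Set V)}
    {T : Set V → V → Prop} (h : IsExtension G D f 𝒩 T f') {Q Q' : V → α → Prop}
    (hf : ClusterProp D f Q) (hQ : ∀ x ∈ D, ∀ p, Q x p → Q' x p)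
    (hatt : ∀ N ∈ 𝒩, ∀ x ∈ N, x ∉ D → ∀ u ∈ D, T N u → ∀ y ∈ compOf G (N \ D) x, G.Adj y u →
      ∀ p, Q u p → Q' x p)
    (hnew : ∀ N ∈ 𝒩, ∀ x ∈ N, Disjoint N D →
      (¬ ∃ u ∈ D, T N u ∧ ∃ y ∈ compOf G (N \ D) x, G.Adj y u) → ∃ p, ∀ x ∈ N, Q' x p) :
    ClusterProp (D ∪ ⋃₀ 𝒩) f' Q' := by
  have hold : ∀ u ∈ D, ∃ p, ∀ y ∈ D ∪ ⋃₀ 𝒩, f' y = f u → Q' y p := by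
    intro u hu
    obtain ⟨p, hp⟩ := hf u hu
    refine ⟨p, fun y hy hyu => ?_⟩
    by_cases hyD : y ∈ D
    · exact hQ y hyD p (hp y hyD (by rw [← h.eq y hyD, hyu]))
    · obtain ⟨N, hN, hyN⟩ := hy.resolve_left hyD
      rcases h.attach N hN y hyN hyD with ⟨u', hu', hyu', hT, z, hz, hzu⟩ | ⟨h1, h2, -⟩
      · exact hatt N hN y hyN hyD u' hu' hT z hz hzu p (hp u' hu' (by rw [← hyu', hyu]))
      · exact absurd hu (Set.disjoint_left.1 h1
          ((h2 u (Or.inl hu)).1 (by rw [h.eq u hu, hyu])))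
  intro x hx
  by_cases hxD : x ∈ D
  · rw [h.eq x hxD]; exact hold x hxD
  · obtain ⟨N, hN, hxN⟩ := hx.resolve_left hxD
    rcases h.attach N hN x hxN hxD with ⟨u, hu, hxu, -⟩ | ⟨h1, h2, h3⟩
    · rw [hxu]; exact hold u hu
    · obtain ⟨p, hp⟩ := hnew N hN x hxN h1 h3
      exact ⟨p, fun y hy hyx => hp y ((h2 y hy).1 hyx)⟩

/-- The map `f` takes at most `k` values on `A`. -/
def ValuesLE (f : V → V) (A : Set V) (k : ℕ) : Prop :=
  ∃ t : Finset V, t.card ≤ k ∧ ∀ x ∈ A, f x ∈ t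

theorem ValuesLE.mono {f : V → V} {A : Set V} {k l : ℕ} (h : ValuesLE f A k) (hkl : k ≤ l) :
    ValuesLE f A l := h.imp fun _ h => ⟨h.1.trans hkl, h.2⟩

theorem ValuesLE.of_cover {ι : Type*} {f : V → V} {A : Set V} {k l : ℕ} (s : Finset ι)
    (hs : s.card ≤ l) (B : ι → Set V) (hB : ∀ i ∈ s, ValuesLE f (B i) k)
    (hA : ∀ x ∈ A, ∃ i ∈ s, x ∈ B i) : ValuesLE f A (l * k) := by
  classical
  have : ∀ i, ∃ t : Finset V, i ∈ s → t.card ≤ k ∧ ∀ x ∈ B i, f x ∈ t := by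
    intro i
    by_cases hi : i ∈ s
    · obtain ⟨t, ht⟩ := hB i hi
      exact ⟨t, fun _ => ht⟩
    · exact ⟨∅, fun h => absurd h hi⟩
  choose t ht using this
  refine ⟨s.biUnion t, (Finset.card_biUnion_le_card_mul _ _ _ fun i hi => (ht i hi).1).trans
    (Nat.mul_le_mul_right k hs), fun x hx => ?_⟩
  obtain ⟨i, hi, hxi⟩ := hA x hx
  exact Finset.mem_biUnion.2 ⟨i, hi, (ht i hi).2 x hxi⟩

/-- If the components of `N \ D` were joined to clusters of vertices of `N ∩ D`, then the
extension has as few clusters on `N` as there were before. -/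
theorem IsExtension.valuesLE {D : Set V} {f f' : V → V} {𝒩 : Set (Set V)}
    (h : IsExtension G D f 𝒩 (fun N u => u ∈ N) f') {N : Set V} (hN : N ∈ 𝒩) {k : ℕ} (hk : 0 < k)
    (hf : ValuesLE f (N ∩ D) k) : ValuesLE f' N k := by
  by_cases hne : ∃ x ∈ N, x ∉ D ∧ Disjoint N D ∧ ∀ y ∈ D ∪ ⋃₀ 𝒩, (f' y = f' x ↔ y ∈ N)
  · obtain ⟨x, hx, hxD, -, h2⟩ := hne
    refine ⟨{f' x}, by rw [Finset.card_singleton]; exact hk, fun y hy => ?_⟩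
    rw [Finset.mem_singleton]
    exact (h2 y (Or.inr ⟨N, hN, hy⟩)).2 hy
  · obtain ⟨t, ht, htf⟩ := hf
    refine ⟨t, ht, fun x hx => ?_⟩
    by_cases hxD : x ∈ D
    · rw [h.eq x hxD]; exact htf x ⟨hx, hxD⟩
    · rcases h.attach N hN x hx hxD with ⟨u, hu, hxu, huN, -⟩ | ⟨h1, h2, -⟩
      · rw [hxu]; exact htf u ⟨huN, hu⟩
      · exact absurd ⟨x, hx, hxD, h1, h2⟩ hne

end ClusterMaps

/-! ### The clusters that contain the pods -/

section Core

variable {V : Type u} {G : SimpleGraph V} {W : Set V} {𝓡 : Set (Set V)}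

theorem exists_finset_card_le_two {S : Set ℕ}
    (h : ∀ k ∈ S, ∀ l ∈ S, ∀ m ∈ S, k < l → l < m → False) :
    ∃ t : Finset ℕ, t.card ≤ 2 ∧ ∀ x ∈ S, x ∈ t := by
  classical
  by_cases h0 : S.Nonempty
  · have hk := Nat.sInf_mem h0
    set k := sInf S
    by_cases h1 : ∃ l ∈ S, l ≠ k
    · obtain ⟨l, hl, hlk⟩ := h1
      have hkl : k ≤ l := Nat.sInf_le hl
      refine ⟨{k, l}, Finset.card_le_two, fun m hm => ?_⟩
      have hkm : k ≤ m := Nat.sInf_le hm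
      by_contra hmt
      rw [Finset.mem_insert, Finset.mem_singleton, not_or] at hmt
      rcases lt_or_gt_of_ne hmt.2 with hlt | hlt
      · exact h k hk m hm l hl (by omega) hlt
      · exact h k hk l hl m hm (by omega) hlt
    · push Not at h1
      exact ⟨{k}, by simp, fun x hx => by simp [h1 x hx]⟩
  · exact ⟨∅, by simp, fun x hx => absurd ⟨x, hx⟩ h0⟩

/-- The cost of attaching a piece near `X` to a cluster near `X'` through the edge `y v`: from `x`
to `X`, back to a region through `y`, and across. -/
theorem NearRegion.of_adj {k l : ℕ} {x y v : V} {X X' : Set V} (hx : NearRegion G 𝓡 k x X)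
    (hy : NearRegion G 𝓡 k y X) (hyv : y = v ∨ G.Adj y v) (hv : NearRegion G 𝓡 l v X') :
    NearRegion G 𝓡 (2 * k + l + 1) x X' := by
  obtain ⟨R, hyR, hR⟩ := hy
  exact (hx.trans (hR.symm.trans (hv.contactDistLE hR.left_mem hyR hyv))).mono (by omega)

namespace Layout

open IsPodFamily

namespace Band

variable {L : Layout G W 𝓡} {pod : ℕ → ℕ → Set V} {g : ℕ} (B : L.Band pod g)

theorem le_b_of_mem_hits {s : ℕ} (hs : s ∈ B.St) {c : ℕ} (hc : c ∈ hits L pod (B.Y s)) :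
    c ≤ B.b s :=
  B.le_b _ (B.X_mem s hs) (B.rank_X s hs) s hs
    (B.hits_Y s hs (B.mem_hits s hs s le_rfl (B.s_le_b s hs))) c (B.hits_Y s hs hc)

/-- Otherwise the region of `s` meets the chains `s₁` and `s`, so the furthest reach `b s₁` includes
`s`, contrary to the spacing of the starting points. -/
theorem lt_of_mem_hits (h : L.IsPodFamily 0 pod) {s s₁ : ℕ} (hs : s ∈ B.St) (hs₁ : s₁ ∈ B.St)
    (hlt : s₁ < s) {c : ℕ} (hc : c ∈ hits L pod (B.Y s)) : s₁ < c := by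
  by_contra hle
  have e1 := B.hits_Y s hs hc
  have e2 := B.hits_Y s hs (B.mem_hits s hs s le_rfl (B.s_le_b s hs))
  have hX := B.X_mem s hs
  have e3 := h.mem_hits_of_between (L.region_conn _ hX) (L.region_subset hX) e1 e2
    (not_lt.1 hle) hlt.le
  have e4 := B.le_b _ hX (B.rank_X s hs) s₁ hs₁ e3 s e2
  have e5 := B.b_lt s₁ hs₁ s hs hlt
  omega

/-- No chain is met by three pieces of a band. -/
theorem not_mem_hits_three (h : L.IsPodFamily 0 pod) {k l m c : ℕ} (hk : k ∈ B.St) (hl : l ∈ B.St)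
    (hm : m ∈ B.St) (hkl : k < l) (hlm : l < m) (hck : c ∈ hits L pod (B.Y k))
    (hcm : c ∈ hits L pod (B.Y m)) : False := by
  have e1 := B.le_b_of_mem_hits hk hck
  have e2 := B.b_lt k hk l hl hkl
  have e3 := B.lt_of_mem_hits h hm hl hlm hcm
  omega

theorem meets_podUnion {s : ℕ} (hs : s ∈ B.St) : (B.Y s ∩ L.podUnion pod).Nonempty := by
  obtain ⟨hc, k, hk, x, hx, hx'⟩ := B.mem_hits s hs s le_rfl (B.s_le_b s hs)
  exact ⟨x, hx, s, hc, k, hk, hx'⟩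

/-- A region meets the intervals of at most two pieces of its band. -/
theorem exists_finset_region (h : L.IsPodFamily 0 pod) {R : Set V} (hR : R ∈ 𝓡)
    (hg : L.rank R / 2 = g) : ∃ t : Finset ℕ, t.card ≤ 2 ∧
      ∀ s ∈ B.St, ∀ c ∈ hits L pod R, s ≤ c → c ≤ B.b s → s ∈ t := by
  obtain ⟨t, ht, h'⟩ := exists_finset_card_le_two
    (S := {s | s ∈ B.St ∧ ∃ c ∈ hits L pod R, s ≤ c ∧ c ≤ B.b s}) (by
      rintro k ⟨hk, c, hc, hkc, hcb⟩ l ⟨hl, -⟩ m ⟨hm, d, hd, hmd, hdb⟩ hkl hlm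
      have e1 := B.b_lt k hk l hl hkl
      have e2 := h.mem_hits_of_between (L.region_conn R hR) (L.region_subset hR) hc hd
        (show c ≤ l by omega) (by omega)
      have e3 := B.le_b R hR hg l hl e2 d hd
      have e4 := B.b_lt l hl m hm hlm
      omega)
  exact ⟨t, ht, fun s hs c hc h1 h2 => h' s ⟨hs, c, hc, h1, h2⟩⟩

variable {g' : ℕ} (B' : L.Band pod g')

/-- A piece meets at most four pieces of another band that meet some chain which it does not. -/
theorem exists_finset_not_subset (h : L.IsPodFamily 0 pod) {j : ℕ} (hj : j ∈ B'.St) :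
    ∃ t : Finset ℕ, t.card ≤ 4 ∧ ∀ s ∈ B.St, (B.Y s ∩ B'.Y j).Nonempty →
      ¬ hits L pod (B.Y s) ⊆ hits L pod (B'.Y j) → s ∈ t := by
  classical
  have hpt : ∀ c, ∃ t : Finset ℕ, t.card ≤ 2 ∧ ∀ s ∈ B.St, c ∈ hits L pod (B.Y s) → s ∈ t := by
    intro c
    obtain ⟨t, ht, h'⟩ := exists_finset_card_le_two
      (S := {s | s ∈ B.St ∧ c ∈ hits L pod (B.Y s)})
      (fun k hk l hl m hm hkl hlm => B.not_mem_hits_three h hk.1 hl.1 hm.1 hkl hlm hk.2 hm.2)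
    exact ⟨t, ht, fun s hs hc => h' s ⟨hs, hc⟩⟩
  have hjj := B'.mem_hits j hj j le_rfl (B'.s_le_b j hj)
  have hbj := B'.mem_hits j hj (B'.b j) (B'.s_le_b j hj) le_rfl
  set I := hits L pod (B'.Y j) with hI
  have hne : I.Nonempty := ⟨j, hjj⟩
  -- A piece that meets `Y j` and leaves its interval `I` must meet a chain next to an end of `I`.
  -- There are two such chains, each on at most two pieces.
  obtain ⟨t₁, ht₁, h₁⟩ := hpt (sInf I - 1)
  obtain ⟨t₂, ht₂, h₂⟩ := hpt (B'.b j + 1)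
  refine ⟨t₁ ∪ t₂, (Finset.card_union_le _ _).trans (by omega), fun s hs hmeet hns => ?_⟩
  obtain ⟨c, hc, hcI⟩ := Set.not_subset.1 hns
  have hp : sInf I ∈ I := Nat.sInf_mem hne
  have hcon : IsConnectedSet G (B.Y s ∪ B'.Y j) :=
    (B.conn s hs).union_of_inter (B'.conn j hj) hmeet
  have hbtw : ∀ a ∈ hits L pod (B.Y s ∪ B'.Y j), ∀ b ∈ hits L pod (B.Y s ∪ B'.Y j), ∀ x, a ≤ x →
      x ≤ b → x ∉ I → x ∈ hits L pod (B.Y s) := by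
    intro a ha b hb x hax hxb hx
    obtain ⟨hxn, k, hk, y, hy | hy, hyx⟩ := h.mem_hits_of_between hcon
      (Set.union_subset (B.subset s hs) (B'.subset j hj)) ha hb hax hxb
    · exact ⟨hxn, k, hk, y, hy, hyx⟩
    · exact absurd ⟨hxn, k, hk, y, hy, hyx⟩ hx
  have hc' := hits_mono (Y := B.Y s ∪ B'.Y j) Set.subset_union_left hc
  rw [Finset.mem_union]
  by_cases hlt : c < sInf I
  · left
    refine h₁ s hs (hbtw c hc' _ (hits_mono Set.subset_union_right hp) _ (by omega) (by omega) ?_)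
    exact Nat.notMem_of_lt_sInf (by omega)
  · right
    have hlt' : B'.b j < c := by
      by_contra hle
      exact hcI (h.mem_hits_of_between (B'.conn j hj) (B'.subset j hj) hp hbj (by omega) (by omega))
    refine h₂ s hs (hbtw _ (hits_mono Set.subset_union_right hbj) c hc' _ (by omega) (by omega) ?_)
    intro hx
    have := B'.le_b_of_mem_hits hj hx
    omega

/-- A piece all of whose chains are met by a given piece of another band meets at most three
pieces of that band. -/
theorem exists_finset_subset (h : L.IsPodFamily 0 pod) {s j : ℕ} (hs : s ∈ B.St) (hj : j ∈ B'.St)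
    (hsub : hits L pod (B.Y s) ⊆ hits L pod (B'.Y j)) :
    ∃ t : Finset ℕ, t.card ≤ 3 ∧ ∀ l ∈ B'.St, (B.Y s ∩ B'.Y l).Nonempty → l ∈ t := by
  classical
  have hss := B.mem_hits s hs s le_rfl (B.s_le_b s hs)
  -- No starting point lies strictly between `j` and `l`, so only `j` and its two neighbours among
  -- the starting points can occur.
  have key : ∀ l ∈ B'.St, (B.Y s ∩ B'.Y l).Nonempty → ∀ l₁ ∈ B'.St,
      ¬ (j < l₁ ∧ l₁ < l) ∧ ¬ (l < l₁ ∧ l₁ < j) := by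
    intro l hl hmeet l₁ hl₁
    have hcon : IsConnectedSet G (B.Y s ∪ B'.Y l) :=
      (B.conn s hs).union_of_inter (B'.conn l hl) hmeet
    have hW : B.Y s ∪ B'.Y l ⊆ W := Set.union_subset (B.subset s hs) (B'.subset l hl)
    have hll := B'.mem_hits l hl l le_rfl (B'.s_le_b l hl)
    have h1 := hits_mono (L := L) (pod := pod) (Y := B.Y s ∪ B'.Y l) Set.subset_union_left hss
    have h2 := hits_mono (L := L) (pod := pod) (X := B'.Y l) (Y := B.Y s ∪ B'.Y l)
      Set.subset_union_right hll
    constructor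
    · rintro ⟨hjl, hll₁⟩
      have hb := B'.b_lt j hj l₁ hl₁ hjl
      have e1 := B'.le_b_of_mem_hits hj (hsub hss)
      obtain ⟨hn, k, hk, x, hx | hx, hxp⟩ :=
        h.mem_hits_of_between hcon hW h1 h2 (show s ≤ l₁ by omega) hll₁.le
      · have := B'.le_b_of_mem_hits hj (hsub ⟨hn, k, hk, x, hx, hxp⟩)
        omega
      · have := B'.lt_of_mem_hits h hl hl₁ hll₁ ⟨hn, k, hk, x, hx, hxp⟩
        omega
    · rintro ⟨hll₁, hlj⟩
      have e1 := B'.lt_of_mem_hits h hj hl₁ hlj (hsub hss)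
      obtain ⟨hn, k, hk, x, hx | hx, hxp⟩ :=
        h.mem_hits_of_between hcon hW h2 h1 hll₁.le e1.le
      · have := B'.lt_of_mem_hits h hj hl₁ hlj (hsub ⟨hn, k, hk, x, hx, hxp⟩)
        omega
      · have := B'.le_b_of_mem_hits hl ⟨hn, k, hk, x, hx, hxp⟩
        have := B'.b_lt l hl l₁ hl₁ hll₁
        omega
  let S : Set ℕ := {l | l ∈ B'.St ∧ (B.Y s ∩ B'.Y l).Nonempty ∧ l ≠ j}
  obtain ⟨t, ht, h'⟩ := exists_finset_card_le_two (S := S) (by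
    rintro k ⟨hk, hk', hkj⟩ l ⟨hl, hl', hlj⟩ m ⟨hm, hm', hmj⟩ hkl hlm
    rcases lt_or_gt_of_ne hlj with hlt | hlt
    · exact (key k hk hk' l hl).2 ⟨hkl, hlt⟩
    · exact (key m hm hm' l hl).1 ⟨hlt, hlm⟩)
  refine ⟨insert j t, (Finset.card_insert_le _ _).trans (by omega), fun l hl hmeet => ?_⟩
  rw [Finset.mem_insert]
  by_cases hlj : l = j
  · exact Or.inl hlj
  · exact Or.inr (h' l ⟨hl, hmeet, hlj⟩)

end Band

end Layout

end Core

/-! ### Merging the pieces of all bands into clusters -/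

section CoreClusters

variable {V : Type u} {G : SimpleGraph V} {W : Set V} {𝓡 : Set (Set V)}

theorem isClusterMap_empty (L : Layout G W 𝓡) (pod : ℕ → ℕ → Set V) :
    IsClusterMap L pod ∅ id :=
  ⟨Set.empty_subset _, fun _ h => h.elim, fun _ h => h.elim,
    fun _ _ _ _ ⟨_, h, _⟩ => h.elim, fun _ _ _ _ _ _ _ _ h => h.elim, fun _ h => h.elim⟩

/-- Components of `N \ D`, for connected `N`, are joined to vertices of `N ∩ D`, if there are. -/
theorem IsConnectedSet.attach_or_disjoint {N D : Set V} (hN : IsConnectedSet G N) {x : V}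
    (hx : x ∈ N) (hxD : x ∉ D) :
    (∃ u ∈ D, u ∈ N ∧ ∃ y ∈ compOf G (N \ D) x, G.Adj y u) ∨ Disjoint N D := by
  by_cases h : (N ∩ D).Nonempty
  · obtain ⟨y, hy, u, huN, huD, hyu⟩ := hN.exists_adj_compOf h hx hxD
    exact Or.inl ⟨u, huD, huN, y, hy, hyu⟩
  · exact Or.inr (Set.disjoint_iff_inter_eq_empty.2 (Set.not_nonempty_iff_eq_empty.1 h))

/-- The extension step for connected pieces: each piece becomes a cluster, or is distributed among
the clusters that it meets. -/
theorem IsClusterMap.exists_extension_of_conn {L : Layout G W 𝓡} {pod : ℕ → ℕ → Set V}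
    (h : L.IsPodFamily 0 pod) {D : Set V} {f : V → V} (hf : IsClusterMap L pod D f)
    (𝒩 : Set (Set V)) (hdis : 𝒩.PairwiseDisjoint id) (hc : ∀ N ∈ 𝒩, IsConnectedSet G N)
    (hW : ∀ N ∈ 𝒩, N ⊆ W) (hpc : ∀ N ∈ 𝒩, L.PodClosed pod N)
    (hmeet : ∀ N ∈ 𝒩, (N ∩ L.podUnion pod).Nonempty) :
    ∃ f', IsExtension G D f 𝒩 (fun N u => u ∈ N) f' ∧ IsClusterMap L pod (D ∪ ⋃₀ 𝒩) f' := by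
  refine hf.exists_extension h 𝒩 _ hdis hW hpc fun N hN x hx hxD => ?_
  exact ((hc N hN).attach_or_disjoint hx hxD).imp id fun hd => ⟨hd, hc N hN, hmeet N hN⟩

theorem ValuesLE.congr {f f' : V → V} {A D : Set V} {k : ℕ} (h : ValuesLE f A k) (hA : A ⊆ D)
    (hD : ∀ x ∈ D, f' x = f x) : ValuesLE f' A k :=
  h.imp fun _ h => ⟨h.1, fun x hx => by rw [hD x (hA hx)]; exact h.2 x hx⟩

-- A piece of odd rank is dominated if its chains are among those of one piece of even rank in the
-- next band. Undominated odd pieces come first, then even pieces, then dominated odd ones, and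
-- finally the uncovered pods. An even piece meets at most 4 undominated pieces, and a dominated one
-- meets at most 3 even pieces, hence `3 * 4` clusters.
open Layout IsPodFamily in
theorem Layout.IsPodFamily.exists_core {L : Layout G W 𝓡} {pod : ℕ → ℕ → Set V}
    (h : L.IsPodFamily 0 pod) (B : ∀ g, L.Band pod g) :
    ∃ D f, IsClusterMap L pod D f ∧ L.podUnion pod ⊆ D ∧
      ClusterProp D f (fun y (p : Set V × ℕ) => NearRegion G 𝓡 17 y p.1 ∧
        p.2 ≤ L.level y + 1 ∧ L.level y + 1 ≤ p.2 + 2) ∧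
      ∀ g, ∀ s ∈ (B g).St, (B g).Y s ⊆ D ∧ ValuesLE f ((B g).Y s) 12 := by
  classical
  let Lo : ℕ → ℕ → Prop := fun g s => s ∈ (B g).St ∧ L.rank ((B g).X s) = 2 * g
  let Hi : ℕ → ℕ → Prop := fun g s => s ∈ (B g).St ∧ L.rank ((B g).X s) = 2 * g + 1
  let Dom : ℕ → ℕ → Prop := fun g s => ∃ j, Lo (g + 1) j ∧
    hits L pod ((B g).Y s) ⊆ hits L pod ((B (g + 1)).Y j)
  have hLoHi : ∀ g, ∀ s ∈ (B g).St, Lo g s ∨ Hi g s := by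
    intro g s hs
    have := (B g).rank_X s hs
    by_cases h0 : L.rank ((B g).X s) = 2 * g
    · exact Or.inl ⟨hs, h0⟩
    · exact Or.inr ⟨hs, by omega⟩
  have hLol : ∀ g s, Lo g s → ∀ x ∈ (B g).Y s, 2 * g ≤ L.level x ∧ L.level x ≤ 2 * g + 1 := by
    intro g s hs x hx
    have := (B g).level_mem s hs.1 x hx
    rwa [hs.2] at this
  have hHil : ∀ g s, Hi g s → ∀ x ∈ (B g).Y s, 2 * g + 1 ≤ L.level x ∧
      L.level x ≤ 2 * g + 2 := by
    intro g s hs x hx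
    have := (B g).level_mem s hs.1 x hx
    rwa [hs.2] at this
  have hsame : ∀ g, ∀ s ∈ (B g).St, ∀ s' ∈ (B g).St, ∀ x ∈ (B g).Y s, x ∈ (B g).Y s' →
      s = s' := by
    intro g s hs s' hs' x hx hx'
    by_contra hne
    exact Set.disjoint_left.1 ((B g).disjoint s hs s' hs' hne) hx hx'
  have hHH : ∀ g s g' s', Hi g s → Hi g' s' → ∀ x ∈ (B g).Y s, x ∈ (B g').Y s' →
      g = g' ∧ s = s' := by
    intro g s g' s' hs hs' x hx hx'
    have e1 := hHil g s hs x hx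
    have e2 := hHil g' s' hs' x hx'
    obtain rfl : g = g' := by omega
    exact ⟨rfl, hsame g s hs.1 s' hs'.1 x hx hx'⟩
  have hLL : ∀ g s g' s', Lo g s → Lo g' s' → ∀ x ∈ (B g).Y s, x ∈ (B g').Y s' →
      g = g' ∧ s = s' := by
    intro g s g' s' hs hs' x hx hx'
    have e1 := hLol g s hs x hx
    have e2 := hLol g' s' hs' x hx'
    obtain rfl : g = g' := by omega
    exact ⟨rfl, hsame g s hs.1 s' hs'.1 x hx hx'⟩
  have hHL : ∀ g s g' s', Hi g s → Lo g' s' → ∀ x ∈ (B g).Y s, x ∈ (B g').Y s' →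
      g' = g + 1 ∧ L.level x = 2 * g + 2 := by
    intro g s g' s' hs hs' x hx hx'
    have e1 := hHil g s hs x hx
    have e2 := hLol g' s' hs' x hx'
    by_cases hg : g' = g + 1
    · omega
    · obtain rfl : g = g' := by omega
      obtain rfl := hsame g s hs.1 s' hs'.1 x hx hx'
      have := hs.2.symm.trans hs'.2
      omega
  -- the four kinds of pieces
  let 𝒩₁ : Set (Set V) := {N | ∃ g s, (Hi g s ∧ ¬ Dom g s) ∧ N = (B g).Y s}
  let 𝒩₂ : Set (Set V) := {N | ∃ g s, Lo g s ∧ N = (B g).Y s}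
  let 𝒩₃ : Set (Set V) := {N | ∃ g s, (Hi g s ∧ Dom g s) ∧ N = (B g).Y s}
  let 𝒩₄ : Set (Set V) := {N | ∃ c < L.n, ∃ k ≤ L.height c, N = pod c k}
  have hdis : ∀ P : ℕ → ℕ → Prop, (∀ g s g' s', P g s → P g' s' → ∀ x ∈ (B g).Y s,
      x ∈ (B g').Y s' → g = g' ∧ s = s') →
      {N | ∃ g s, P g s ∧ N = (B g).Y s}.PairwiseDisjoint id := by
    rintro P hP _ ⟨g, s, hs, rfl⟩ _ ⟨g', s', hs', rfl⟩ hne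
    refine Set.disjoint_left.2 fun x hx hx' => hne ?_
    obtain ⟨rfl, rfl⟩ := hP g s g' s' hs hs' x hx hx'
    rfl
  have step : ∀ (P : ℕ → ℕ → Prop), (∀ g s, P g s → s ∈ (B g).St) →
      (∀ g s g' s', P g s → P g' s' → ∀ x ∈ (B g).Y s, x ∈ (B g').Y s' → g = g' ∧ s = s') →
      ∀ D f, IsClusterMap L pod D f → ∃ f',
        IsExtension G D f {N | ∃ g s, P g s ∧ N = (B g).Y s} (fun N u => u ∈ N) f' ∧
        IsClusterMap L pod (D ∪ ⋃₀ {N | ∃ g s, P g s ∧ N = (B g).Y s}) f' := by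
    intro P hP hP' D f hf
    refine hf.exists_extension_of_conn h _ (hdis P hP') ?_ ?_ ?_ ?_
    · rintro _ ⟨g, s, hs, rfl⟩; exact (B g).conn s (hP g s hs)
    · rintro _ ⟨g, s, hs, rfl⟩; exact (B g).subset s (hP g s hs)
    · rintro _ ⟨g, s, hs, rfl⟩; exact (B g).podClosed s (hP g s hs)
    · rintro _ ⟨g, s, hs, rfl⟩; exact (B g).meets_podUnion (hP g s hs)
  obtain ⟨f₁, hx₁, hf₁⟩ := step (fun g s => Hi g s ∧ ¬ Dom g s) (fun g s hs => hs.1.1)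
    (fun g s g' s' hs hs' => hHH g s g' s' hs.1 hs'.1) ∅ id (isClusterMap_empty L pod)
  obtain ⟨f₂, hx₂, hf₂⟩ := step Lo (fun g s hs => hs.1) hLL _ f₁ hf₁
  obtain ⟨f₃, hx₃, hf₃⟩ := step (fun g s => Hi g s ∧ Dom g s) (fun g s hs => hs.1.1)
    (fun g s g' s' hs hs' => hHH g s g' s' hs.1 hs'.1) _ f₂ hf₂
  obtain ⟨f₄, hx₄, hf₄⟩ := hf₃.exists_extension_of_conn h 𝒩₄
    (by
      rintro _ ⟨c, hc, k, hk, rfl⟩ _ ⟨c', hc', k', hk', rfl⟩ hne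
      exact Set.disjoint_left.2 fun x hx hx' => hne (h.eq_of_mem hc hk hc' hk' hx hx').2)
    (by rintro _ ⟨c, hc, k, hk, rfl⟩; exact (h.isPod c hc k (Nat.zero_le _) hk).1)
    (by rintro _ ⟨c, hc, k, hk, rfl⟩; exact (h.isPod c hc k (Nat.zero_le _) hk).2.1)
    (by
      rintro _ ⟨c, hc, k, hk, rfl⟩ c' hc' k' hk' ⟨x, hx, hx'⟩
      exact (h.eq_of_mem hc hk hc' hk' hx hx').2.ge)
    (by
      rintro _ ⟨c, hc, k, hk, rfl⟩
      obtain ⟨x, hx⟩ := (h.isPod c hc k (Nat.zero_le _) hk).1.nonempty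
      exact ⟨x, hx, c, hc, k, hk, hx⟩)
  have hD₁ : ∀ x ∈ ∅ ∪ ⋃₀ 𝒩₁, ∃ g s, (Hi g s ∧ ¬ Dom g s) ∧ x ∈ (B g).Y s := by
    rintro x (hx | ⟨_, ⟨g, s, hs, rfl⟩, hx⟩)
    · exact hx.elim
    · exact ⟨g, s, hs, hx⟩
  have hmeet₂ : ∀ g s, Lo g s → ∀ x ∈ (B g).Y s, x ∈ ∅ ∪ ⋃₀ 𝒩₁ → ∃ g' s', g = g' + 1 ∧
      L.level x = 2 * g' + 2 ∧ (Hi g' s' ∧ ¬ Dom g' s') ∧ x ∈ (B g').Y s' := by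
    intro g s hs x hx hxD
    obtain ⟨g', s', hs', hx'⟩ := hD₁ x hxD
    obtain ⟨e1, e2⟩ := hHL g' s' g s hs'.1 hs x hx' hx
    exact ⟨g', s', e1, e2, hs', hx'⟩
  have hmeet₃ : ∀ g s, Hi g s ∧ Dom g s → ∀ x ∈ (B g).Y s, x ∈ ∅ ∪ ⋃₀ 𝒩₁ ∪ ⋃₀ 𝒩₂ →
      L.level x = 2 * g + 2 ∧ ∃ s', Lo (g + 1) s' ∧ x ∈ (B (g + 1)).Y s' := by
    rintro g s hs x hx (hxD | ⟨_, ⟨g', s', hs', rfl⟩, hx'⟩)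
    · obtain ⟨g', s', hs', hx'⟩ := hD₁ x hxD
      obtain ⟨rfl, rfl⟩ := hHH g s g' s' hs.1 hs'.1 x hx hx'
      exact absurd hs.2 hs'.2
    · obtain ⟨rfl, e⟩ := hHL g s g' s' hs.1 hs' x hx hx'
      exact ⟨e, s', hs', hx'⟩
  -- counting the clusters on a piece
  have hv₁ : ∀ g s, Hi g s ∧ ¬ Dom g s → ValuesLE f₁ ((B g).Y s) 1 := fun g s hs =>
    hx₁.valuesLE ⟨g, s, hs, rfl⟩ one_pos ⟨∅, by simp, fun x hx => hx.2.elim⟩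
  have hv₂ : ∀ g s, Lo g s → ValuesLE f₂ ((B g).Y s) 4 := by
    intro g s hs
    refine hx₂.valuesLE ⟨g, s, hs, rfl⟩ (by omega) ?_
    -- Only undominated pieces are present so far, so none of them has its chains contained in those
    -- of this even piece.
    obtain ⟨t, ht, ht'⟩ := (B (g - 1)).exists_finset_not_subset (B g) h hs.1
    refine ValuesLE.of_cover (k := 1) (l := 4) (t.filter fun i => Hi (g - 1) i ∧ ¬ Dom (g - 1) i)
      ((Finset.card_filter_le _ _).trans ht) (fun i => (B (g - 1)).Y i) ?_ ?_
    · intro i hi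
      exact hv₁ _ _ (Finset.mem_filter.1 hi).2
    · rintro x ⟨hx, hxD⟩
      obtain ⟨g', s', rfl, -, hs', hx'⟩ := hmeet₂ g s hs x hx hxD
      refine ⟨s', Finset.mem_filter.2 ⟨ht' s' hs'.1.1 ⟨x, hx', hx⟩ fun hsub => ?_, hs'⟩, hx'⟩
      exact hs'.2 ⟨s, hs, hsub⟩
  have hv₃ : ∀ g s, Hi g s ∧ Dom g s → ValuesLE f₃ ((B g).Y s) 12 := by
    intro g s hs
    refine hx₃.valuesLE ⟨g, s, hs, rfl⟩ (by omega) ?_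
    obtain ⟨j, hj, hsub⟩ := hs.2
    obtain ⟨t, ht, ht'⟩ := (B g).exists_finset_subset (B (g + 1)) h hs.1.1 hj.1 hsub
    refine ValuesLE.of_cover (k := 4) (l := 3) (t.filter fun i => Lo (g + 1) i)
      ((Finset.card_filter_le _ _).trans ht) (fun i => (B (g + 1)).Y i) ?_ ?_
    · intro i hi
      exact hv₂ _ _ (Finset.mem_filter.1 hi).2
    · rintro x ⟨hx, hxD⟩
      obtain ⟨-, s', hs', hx'⟩ := hmeet₃ g s hs x hx hxD
      exact ⟨s', Finset.mem_filter.2 ⟨ht' s' hs'.1 ⟨x, hx, hx'⟩, hs'⟩, hx'⟩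
  -- distances
  have hq₁ : ClusterProp (∅ ∪ ⋃₀ 𝒩₁) f₁ (fun y (p : Set V × ℕ) => NearRegion G 𝓡 3 y p.1 ∧
      p.2 % 2 = 0 ∧ p.2 ≤ L.level y + 1 ∧ L.level y + 1 ≤ p.2 + 1) := by
    refine hx₁.clusterProp (Q := fun _ _ => True) (fun x hx => hx.elim) (fun x hx => hx.elim)
      (fun N hN x hx hxD u hu => hu.elim) ?_
    rintro _ ⟨g, s, hs, rfl⟩ - - - -
    refine ⟨((B g).X s, 2 * g + 2), fun x hx => ⟨(B g).near s hs.1.1 x hx, ?_⟩⟩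
    have := hHil g s hs.1 x hx
    dsimp only
    omega
  -- Each attachment takes the distance from `l` to `2 * 3 + l + 1`: 3, 10, 17. The second datum is
  -- the start of a window of levels shifted by one. Its evenness fixes it when a piece is attached,
  -- so the window stays three levels wide.
  have hq₂ : ClusterProp (∅ ∪ ⋃₀ 𝒩₁ ∪ ⋃₀ 𝒩₂) f₂ (fun y (p : Set V × ℕ) =>
      NearRegion G 𝓡 10 y p.1 ∧ p.2 % 2 = 0 ∧ p.2 ≤ L.level y + 1 ∧
        L.level y + 1 ≤ p.2 + 2) := by
    refine hx₂.clusterProp hq₁ ?_ ?_ ?_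
    · rintro x - p ⟨h1, h2⟩
      exact ⟨h1.mono (by omega), by omega⟩
    · rintro _ ⟨g, s, hs, rfl⟩ x hx - u hu huN y hy hyu p ⟨h1, h2⟩
      obtain ⟨g', s', rfl, e, -⟩ := hmeet₂ g s hs u huN hu
      have := hLol _ s hs x hx
      refine ⟨((B _).near s hs.1 x hx).of_adj ((B _).near s hs.1 y (compOf_subset hy).1)
        (Or.inr hyu) h1, by omega⟩
    · rintro _ ⟨g, s, hs, rfl⟩ - - - -
      refine ⟨((B g).X s, 2 * g), fun x hx => ⟨((B g).near s hs.1 x hx).mono (by omega), ?_⟩⟩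
      have := hLol g s hs x hx
      dsimp only
      omega
  have hq₃ : ClusterProp (∅ ∪ ⋃₀ 𝒩₁ ∪ ⋃₀ 𝒩₂ ∪ ⋃₀ 𝒩₃) f₃ (fun y (p : Set V × ℕ) =>
      NearRegion G 𝓡 17 y p.1 ∧ p.2 ≤ L.level y + 1 ∧ L.level y + 1 ≤ p.2 + 2) := by
    refine hx₃.clusterProp hq₂ ?_ ?_ ?_
    · rintro x - p ⟨h1, h2⟩
      exact ⟨h1.mono (by omega), by omega⟩
    · rintro _ ⟨g, s, hs, rfl⟩ x hx - u hu huN y hy hyu p ⟨h1, h2⟩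
      obtain ⟨e, -⟩ := hmeet₃ g s hs u huN hu
      have := hHil _ s hs.1 x hx
      refine ⟨((B _).near s hs.1.1 x hx).of_adj ((B _).near s hs.1.1 y (compOf_subset hy).1)
        (Or.inr hyu) h1, by omega⟩
    · rintro _ ⟨g, s, hs, rfl⟩ - - - -
      refine ⟨((B g).X s, 2 * g + 2),
        fun x hx => ⟨((B g).near s hs.1.1 x hx).mono (by omega), ?_⟩⟩
      have := hHil g s hs.1 x hx
      dsimp only
      omega
  -- The domain never cuts a pod, so the remaining pods become clusters of their own.
  have hpodD : ∀ N ∈ 𝒩₄, ∀ x ∈ N, x ∉ ∅ ∪ ⋃₀ 𝒩₁ ∪ ⋃₀ 𝒩₂ ∪ ⋃₀ 𝒩₃ →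
      Disjoint N (∅ ∪ ⋃₀ 𝒩₁ ∪ ⋃₀ 𝒩₂ ∪ ⋃₀ 𝒩₃) := by
    rintro _ ⟨c, hc, k, hk, rfl⟩ x hx hxD
    exact Set.disjoint_left.2 fun y hy hyD => hxD (hf₃.podClosed c hc k hk ⟨y, hyD, hy⟩ hx)
  refine ⟨_, f₄, hf₄, ?_, hx₄.clusterProp hq₃ (fun _ _ _ h => h) ?_ ?_, fun g s hs => ?_⟩
  · rintro x ⟨c, hc, k, hk, hx⟩
    exact Or.inr ⟨_, ⟨c, hc, k, hk, rfl⟩, hx⟩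
  · intro N hN x hx hxD u hu huN
    exact absurd hu (Set.disjoint_left.1 (hpodD N hN x hx hxD) huN)
  · rintro _ ⟨c, hc, k, hk, rfl⟩ - - - -
    refine ⟨(L.center k (pod c k), k), fun x hx =>
      ⟨((h.isPod c hc k (Nat.zero_le _) hk).2.2.2.2.1 x hx).mono (by omega), ?_⟩⟩
    have := h.level_eq hc hk hx
    dsimp only
    omega
  · rcases hLoHi g s hs with hlo | hhi
    · have e2 : (B g).Y s ⊆ ∅ ∪ ⋃₀ 𝒩₁ ∪ ⋃₀ 𝒩₂ := fun x hx => Or.inr ⟨_, ⟨g, s, hlo, rfl⟩, hx⟩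
      have e3 := e2.trans (Set.subset_union_left (t := ⋃₀ 𝒩₃))
      exact ⟨e3.trans Set.subset_union_left,
        (((hv₂ g s hlo).congr e2 hx₃.eq).congr e3 hx₄.eq).mono (by omega)⟩
    · by_cases hd : Dom g s
      · have e3 : (B g).Y s ⊆ ∅ ∪ ⋃₀ 𝒩₁ ∪ ⋃₀ 𝒩₂ ∪ ⋃₀ 𝒩₃ := fun x hx =>
          Or.inr ⟨_, ⟨g, s, ⟨hhi, hd⟩, rfl⟩, hx⟩
        exact ⟨e3.trans Set.subset_union_left, (hv₃ g s ⟨hhi, hd⟩).congr e3 hx₄.eq⟩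
      · have e1 : (B g).Y s ⊆ ∅ ∪ ⋃₀ 𝒩₁ := fun x hx => Or.inr ⟨_, ⟨g, s, ⟨hhi, hd⟩, rfl⟩, hx⟩
        have e2 := e1.trans (Set.subset_union_left (t := ⋃₀ 𝒩₂))
        have e3 := e2.trans (Set.subset_union_left (t := ⋃₀ 𝒩₃))
        exact ⟨e3.trans Set.subset_union_left,
          ((((hv₁ g s ⟨hhi, hd⟩).congr e1 hx₂.eq).congr e2 hx₃.eq).congr e3 hx₄.eq).mono
            (by omega)⟩

end CoreClusters

/-! ### Covering the regions that meet pods -/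

section Pockets

variable {V : Type u} {G : SimpleGraph V} {W : Set V} {𝓡 : Set (Set V)}

namespace Layout.IsPodFamily

variable {L : Layout G W 𝓡} {pod : ℕ → ℕ → Set V}

/-- The pods adjacent to a component of the complement of the pods lie on two consecutive chains. -/
theorem exists_pocket_chain (h : L.IsPodFamily 0 pod) (Q : Set V) :
    ∃ a, ∀ x ∈ W \ L.podUnion pod, Q = compOf G (W \ L.podUnion pod) x →
      ∀ y ∈ Q, ∀ z ∈ L.podUnion pod, G.Adj y z →
        ∃ c < L.n, (c = a ∨ c = a + 1) ∧ ∃ k ≤ L.height c, z ∈ pod c k := by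
  by_cases hQ : ∃ x ∈ W \ L.podUnion pod, Q = compOf G (W \ L.podUnion pod) x
  swap
  · exact ⟨0, fun x hx hxQ => absurd ⟨x, hx, hxQ⟩ hQ⟩
  obtain ⟨x, hx, rfl⟩ := hQ
  set Q := compOf G (W \ L.podUnion pod) x with hQ
  suffices ∃ a, ∀ y ∈ Q, ∀ z ∈ L.podUnion pod, G.Adj y z →
      ∃ c < L.n, (c = a ∨ c = a + 1) ∧ ∃ k ≤ L.height c, z ∈ pod c k by
    obtain ⟨a, ha⟩ := this
    exact ⟨a, fun _ _ _ => ha⟩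
  have hQno : ∀ y ∈ Q, y ∉ L.podUnion pod := fun y hy => (compOf_subset hy).2
  have hQW : Q ⊆ W := fun y hy => (compOf_subset hy).1
  -- numbers of chains not exceeded by the chains through some adjacent pod
  let S : Set ℕ := {a | ∃ y ∈ Q, ∃ c < L.n, ∃ k ≤ L.height c, ∃ z ∈ pod c k, G.Adj y z ∧
    ∀ c' ∈ hits L pod (pod c k), c' ≤ a}
  by_cases hS : S.Nonempty
  · refine ⟨sInf S, fun y hy z hz hyz => ?_⟩
    obtain ⟨c, hc, k, hk, hzc⟩ := hz
    obtain ⟨y₀, hy₀, c₀, hc₀, k₀, hk₀, z₀, hz₀, hyz₀, hmax₀⟩ := Nat.sInf_mem hS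
    set a := sInf S with ha
    by_contra hcon
    have hca : ∀ c' ∈ hits L pod (pod c k), c' ≠ a ∧ c' ≠ a + 1 := by
      rintro c' ⟨hc', k', hk', t, ht, ht'⟩
      obtain ⟨rfl, he⟩ := h.eq_of_mem hc hk hc' hk' ht ht'
      constructor
      · rintro rfl
        exact hcon ⟨_, hc', Or.inl rfl, k, hk', he ▸ hzc⟩
      · rintro rfl
        exact hcon ⟨_, hc', Or.inr rfl, k, hk', he ▸ hzc⟩
    have hpc := (h.isPod c hc k (Nat.zero_le _) hk)
    have hpc₀ := (h.isPod c₀ hc₀ k₀ (Nat.zero_le _) hk₀)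
    -- some chain through the pod is beyond `a`
    obtain ⟨b, hb, hab⟩ : ∃ b ∈ hits L pod (pod c k), a + 1 < b := by
      by_contra hno
      push Not at hno
      have hlt : ∀ c' ∈ hits L pod (pod c k), c' ≤ a - 1 := fun c' hc' => by
        have := hno c' hc'
        have := hca c' hc'
        omega
      have hcc : c ∈ hits L pod (pod c k) := ⟨hc, k, hk, z, hzc, hzc⟩
      have h1 : a - 1 ∈ S := ⟨y, hy, c, hc, k, hk, z, hzc, hyz, hlt⟩
      have h2 : a ≤ a - 1 := Nat.sInf_le h1
      have := hlt c hcc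
      have := (hca c hcc).1
      omega
    have hcc₀ : c₀ ∈ hits L pod (pod c₀ k₀) := ⟨hc₀, k₀, hk₀, z₀, hz₀, hz₀⟩
    have hQc : IsConnectedSet G Q := isConnectedSet_compOf hx
    -- The pocket with both pods meets a chain up to `a` and one beyond `a + 1`, hence also `a + 1`.
    -- But the pocket meets no pod, the first pod stays at or below `a`, and the second avoids `a +
    -- 1`.
    have hcon3 : IsConnectedSet G (Q ∪ pod c₀ k₀ ∪ pod c k) :=
      (hQc.union hpc₀.1 ⟨y₀, hy₀, z₀, hz₀, Or.inr hyz₀⟩).union hpc.1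
        ⟨y, Or.inl hy, z, hzc, Or.inr hyz⟩
    obtain ⟨hn, k', hk', t, ht, ht'⟩ := h.mem_hits_of_between hcon3
      (Set.union_subset (Set.union_subset hQW hpc₀.2.1) hpc.2.1) (g := a + 1)
      (hits_mono (Set.subset_union_right.trans Set.subset_union_left) hcc₀)
      (hits_mono Set.subset_union_right hb) (by have := hmax₀ c₀ hcc₀; omega) hab.le
    rcases ht with (ht | ht) | ht
    · exact hQno t ht ⟨_, hn, k', hk', ht'⟩
    · have := hmax₀ (a + 1) ⟨hn, k', hk', t, ht, ht'⟩
      omega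
    · exact (hca (a + 1) ⟨hn, k', hk', t, ht, ht'⟩).2 rfl
  · refine ⟨0, fun y hy z hz hyz => absurd ?_ hS⟩
    obtain ⟨c, hc, k, hk, hzc⟩ := hz
    exact ⟨L.n, y, hy, c, hc, k, hk, z, hzc, hyz, fun c' hc' => hc'.1.le⟩

theorem center_step (h : L.IsPodFamily 0 pod) {c : ℕ} (hc : c < L.n) {k : ℕ}
    (hk : k + 1 ≤ L.height c) :
    ContactDistLE G 𝓡 2 (L.center (k + 1) (pod c (k + 1))) (L.center k (pod c k)) := by
  obtain ⟨-, -, -, hF, -, h6⟩ := h.isPod c hc (k + 1) (Nat.zero_le _) hk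
  obtain ⟨-, -, y, -, hyF, hyb⟩ := h6 (by omega)
  exact ((h.isPod c hc k (Nat.zero_le _) (by omega)).2.2.2.2.1 _
    (h.exit_mem c hc k (Nat.zero_le _) hk)).contactDistLE hF hyF (Or.inr hyb)

/-- Regions that meet a chain in pods whose levels differ by at most one are close. -/
theorem contactDistLE_of_chain (h : L.IsPodFamily 0 pod) {c : ℕ} (hc : c < L.n) {k k' : ℕ}
    (hk : k ≤ L.height c) (hk' : k' ≤ L.height c) (hkk : k ≤ k' + 1) (hkk' : k' ≤ k + 1)
    {Z Z' : Set V} (hZ : Z ∈ 𝓡) (hZ' : Z' ∈ 𝓡) {z z' : V} (hz : z ∈ Z) (hz' : z' ∈ Z')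
    (hzp : z ∈ pod c k) (hzp' : z' ∈ pod c k') : ContactDistLE G 𝓡 6 Z Z' := by
  have h1 := ((h.isPod c hc k (Nat.zero_le _) hk).2.2.2.2.1 z hzp).contactDistLE hZ hz
    (Or.inl rfl)
  have h2 := ((h.isPod c hc k' (Nat.zero_le _) hk').2.2.2.2.1 z' hzp').contactDistLE hZ' hz'
    (Or.inl rfl)
  have h3 : ContactDistLE G 𝓡 2 (L.center k (pod c k)) (L.center k' (pod c k')) := by
    rcases lt_trichotomy k k' with hlt | rfl | hlt
    · obtain rfl : k' = k + 1 := by omega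
      exact (h.center_step hc hk').symm
    · exact (ContactDistLE.refl h1.right_mem).mono (by omega)
    · obtain rfl : k = k' + 1 := by omega
      exact h.center_step hc hk
  exact ((h1.trans h3).trans h2.symm).mono (by omega)

/-- The property of clusters maintained while they grow outside of the pods: after `i` rounds, they
are near a region, and their levels are within a range around that of their pods. -/
def GrowthProp (L : Layout G W 𝓡) (pod : ℕ → ℕ → Set V) (i : ℕ) (y : V) (p : Set V × ℕ) : Prop :=
  NearRegion G 𝓡 (17 + 7 * i) y p.1 ∧ p.2 ≤ L.level y + 1 + 2 * i ∧
    L.level y + 1 ≤ p.2 + 2 + 2 * i ∧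
    (y ∈ L.podUnion pod → p.2 ≤ L.level y + 1 ∧ L.level y + 1 ≤ p.2 + 2)

/-- The vertices outside of the pods that are joined, inside a region of `𝒪` of rank `m`, to the
chain number `ch Q + s`, where `Q` is their pocket. -/
def reachSet (L : Layout G W 𝓡) (pod : ℕ → ℕ → Set V) (𝒪 : Set (Set V)) (ch : Set V → ℕ)
    (s m : ℕ) : Set V :=
  {x | x ∉ L.podUnion pod ∧ ∃ Z ∈ 𝒪, L.rank Z = m ∧ x ∈ Z ∧
    ∃ y ∈ compOf G (Z \ L.podUnion pod) x, ∃ z ∈ Z, G.Adj y z ∧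
      ch (compOf G (W \ L.podUnion pod) x) + s < L.n ∧
      ∃ k ≤ L.height (ch (compOf G (W \ L.podUnion pod) x) + s),
        z ∈ pod (ch (compOf G (W \ L.podUnion pod) x) + s) k}

/-- Inside one pocket, the regions of rank `m` that reach the prescribed chain do so in pods of
nearly equal levels, so they are pairwise within distance 6. One more step reaches the cluster,
which gives the increment 7. Levels change by at most 2. Fixing the parity of the rank makes the
added sets disjoint. -/
theorem exists_growth (h : L.IsPodFamily 0 pod) {𝒪 : Set (Set V)} (h𝒪 : 𝒪 ⊆ 𝓡) (ch : Set V → ℕ)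
    (s e i : ℕ) {D : Set V} {f : V → V} (hf : IsClusterMap L pod D f) (hpD : L.podUnion pod ⊆ D)
    (hQ : ClusterProp D f (GrowthProp L pod i)) :
    ∃ f', (∀ x ∈ D, f' x = f x) ∧
      IsClusterMap L pod (D ∪ ⋃₀ {N | ∃ m, m % 2 = e ∧ N = reachSet L pod 𝒪 ch s m}) f' ∧
      ClusterProp (D ∪ ⋃₀ {N | ∃ m, m % 2 = e ∧ N = reachSet L pod 𝒪 ch s m}) f'
        (GrowthProp L pod (i + 1)) := by
  have hlev : ∀ m, ∀ x ∈ reachSet L pod 𝒪 ch s m, m ≤ L.level x ∧ L.level x ≤ m + 1 := by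
    rintro m x ⟨-, Z, hZ, rfl, hx, -⟩
    exact ⟨L.rank_le hx, L.level_le_rank (h𝒪 hZ) hx⟩
  have hNW : ∀ m, reachSet L pod 𝒪 ch s m ⊆ W \ L.podUnion pod := by
    rintro m x ⟨hxp, Z, hZ, -, hx, -⟩
    exact ⟨L.region_subset (h𝒪 hZ) hx, hxp⟩
  have hatt : ∀ m, ∀ x ∈ reachSet L pod 𝒪 ch s m, x ∉ D →
      ∃ u ∈ D, ∃ y ∈ compOf G (reachSet L pod 𝒪 ch s m \ D) x, G.Adj y u := by
    rintro m x ⟨hxp, Z, hZ, hm, hx, y, hy, z, hz, hyz, hcn, k, hk, hzk⟩ hxD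
    have hxZ : x ∈ Z \ L.podUnion pod := ⟨hx, hxp⟩
    have hzD : z ∈ D := hpD ⟨_, hcn, k, hk, hzk⟩
    have hKc : IsConnectedSet G (compOf G (Z \ L.podUnion pod) x) := isConnectedSet_compOf hxZ
    have hcon : IsConnectedSet G (compOf G (Z \ L.podUnion pod) x ∪ {z}) :=
      hKc.union (isConnectedSet_singleton G z) ⟨y, hy, z, rfl, Or.inr hyz⟩
    obtain ⟨y', hy', u, -, hu, hyu⟩ := hcon.exists_adj_compOf (P := D) ⟨z, Or.inr rfl, hzD⟩
      (Or.inl (mem_compOf_self hxZ)) hxD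
    -- The path to the pod stays in the reach set until it enters `D`, because all its vertices
    -- share the pocket and the component of `Z` outside the pods.
    refine ⟨u, hu, y', compOf_mono ?_ hy', hyu⟩
    rintro t ⟨ht | rfl, htD⟩
    · refine ⟨⟨(compOf_subset ht).2, Z, hZ, hm, (compOf_subset ht).1, ?_⟩, htD⟩
      have e1 : compOf G (W \ L.podUnion pod) t = compOf G (W \ L.podUnion pod) x := by
        refine compOf_eq (hKc.subset_compOf ?_ (mem_compOf_self hxZ) ht)
        exact compOf_subset.trans
          (Set.sdiff_subset_sdiff_left (L.region_subset (h𝒪 hZ)))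
      rw [e1, compOf_eq ht]
      exact ⟨y, hy, z, hz, hyz, hcn, k, hk, hzk⟩
    · exact absurd hzD htD
  obtain ⟨f', hx', hf'⟩ := hf.exists_extension h
    {N | ∃ m, m % 2 = e ∧ N = reachSet L pod 𝒪 ch s m} (fun _ _ => True) (by
      rintro _ ⟨m, hm, rfl⟩ _ ⟨m', hm', rfl⟩ hne
      refine Set.disjoint_left.2 fun x hx hx' => hne ?_
      have e1 := hlev m x hx
      have e2 := hlev m' x hx'
      obtain rfl : m = m' := by omega
      rfl)
    (by rintro _ ⟨m, -, rfl⟩; exact fun x hx => (hNW m hx).1)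
    (by
      rintro _ ⟨m, -, rfl⟩ c hc k hk ⟨x, hx, hxp⟩
      exact absurd ⟨c, hc, k, hk, hxp⟩ (hNW m hx).2)
    (by
      rintro _ ⟨m, -, rfl⟩ x hx hxD
      obtain ⟨u, hu, y, hy⟩ := hatt m x hx hxD
      exact Or.inl ⟨u, hu, trivial, y, hy⟩)
  refine ⟨f', hx'.eq, hf', hx'.clusterProp hQ ?_ ?_ ?_⟩
  · rintro x - p ⟨h1, h2, h3, h4⟩
    exact ⟨h1.mono (by omega), by omega, by omega, h4⟩
  · rintro _ ⟨m, -, rfl⟩ x hx hxD u hu - y hy hyu p ⟨h1, h2, h3, -⟩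
    have hyN := (compOf_subset hy).1
    have hlx := hlev m x hx
    have hly := hlev m y hyN
    have hQxy : compOf G (W \ L.podUnion pod) y = compOf G (W \ L.podUnion pod) x := by
      refine compOf_eq ((isConnectedSet_compOf (G := G)
        (S := reachSet L pod 𝒪 ch s m \ D) ⟨hx, hxD⟩).subset_compOf ?_
        (mem_compOf_self ⟨hx, hxD⟩) hy)
      exact compOf_subset.trans (Set.sdiff_subset.trans (hNW m))
    have hyW := (hNW m hyN).1
    have huW := hf.subset hu
    have l1 := L.level_adj y hyW u huW hyu
    have l2 := L.level_adj u huW y hyW hyu.symm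
    obtain ⟨hxp, Z, hZ, hZm, hxZ, -, -, z, hz, -, hcn, k, hk, hzk⟩ := hx
    obtain ⟨-, Z', hZ', hZm', hyZ', -, -, z', hz', -, hcn', k', hk', hzk'⟩ := hyN
    rw [hQxy] at hk' hzk'
    have k1 := h.level_eq hcn hk hzk
    have k2 := h.level_eq hcn hk' hzk'
    have k3 := L.rank_le hz
    have k4 := L.rank_le hz'
    have k5 := L.level_le_rank (h𝒪 hZ) hz
    have k6 := L.level_le_rank (h𝒪 hZ') hz'
    have h6 := h.contactDistLE_of_chain hcn hk hk' (by omega) (by omega) (h𝒪 hZ) (h𝒪 hZ') hz hz'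
      hzk hzk'
    refine ⟨⟨Z, hxZ, (h6.trans (h1.contactDistLE (h𝒪 hZ') hyZ' (Or.inr hyu))).mono (by omega)⟩,
      by omega, by omega, fun hp => absurd hp hxp⟩
  · rintro _ ⟨m, -, rfl⟩ x hx hd hno
    obtain ⟨u, hu, y, hy⟩ := hatt m x hx (Set.disjoint_left.1 hd hx)
    exact absurd ⟨u, hu, trivial, y, hy⟩ hno

/-- The clusters can be made to cover any set of regions that meet pods. -/
theorem exists_cover (h : L.IsPodFamily 0 pod) {𝒪 : Set (Set V)} (h𝒪 : 𝒪 ⊆ 𝓡)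
    (h𝒪p : ∀ Z ∈ 𝒪, (Z ∩ L.podUnion pod).Nonempty) {D : Set V} {f : V → V}
    (hf : IsClusterMap L pod D f) (hpD : L.podUnion pod ⊆ D)
    (hQ : ClusterProp D f (fun y (p : Set V × ℕ) => NearRegion G 𝓡 17 y p.1 ∧
        p.2 ≤ L.level y + 1 ∧ L.level y + 1 ≤ p.2 + 2)) :
    ∃ D' f', IsClusterMap L pod D' f' ∧ D ⊆ D' ∧ (∀ x ∈ D, f' x = f x) ∧ (∀ Z ∈ 𝒪, Z ⊆ D') ∧
      ClusterProp D' f' (GrowthProp L pod 4) := by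
  choose ch hch using h.exists_pocket_chain
  have hQ0 : ClusterProp D f (GrowthProp L pod 0) := by
    intro x hx
    obtain ⟨p, hp⟩ := hQ x hx
    exact ⟨p, fun y hy hyx => ⟨(hp y hy hyx).1, (hp y hy hyx).2.1, (hp y hy hyx).2.2,
      fun _ => (hp y hy hyx).2⟩⟩
  -- Two candidate chains for each pocket and two parities of the rank give four rounds.
  obtain ⟨f₁, e₁, hf₁, hQ₁⟩ := h.exists_growth h𝒪 ch 0 0 0 hf hpD hQ0
  obtain ⟨f₂, e₂, hf₂, hQ₂⟩ := h.exists_growth h𝒪 ch 0 1 1 hf₁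
    (hpD.trans Set.subset_union_left) hQ₁
  obtain ⟨f₃, e₃, hf₃, hQ₃⟩ := h.exists_growth h𝒪 ch 1 0 2 hf₂
    ((hpD.trans Set.subset_union_left).trans Set.subset_union_left) hQ₂
  obtain ⟨f₄, e₄, hf₄, hQ₄⟩ := h.exists_growth h𝒪 ch 1 1 3 hf₃
    (((hpD.trans Set.subset_union_left).trans Set.subset_union_left).trans
      Set.subset_union_left) hQ₃
  refine ⟨_, f₄, hf₄, fun x hx => Or.inl (Or.inl (Or.inl (Or.inl hx))), fun x hx => ?_,
    fun Z hZ x hx => ?_, hQ₄⟩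
  · rw [e₄ x (Or.inl (Or.inl (Or.inl hx))), e₃ x (Or.inl (Or.inl hx)), e₂ x (Or.inl hx), e₁ x hx]
  · by_cases hxp : x ∈ L.podUnion pod
    · exact Or.inl (Or.inl (Or.inl (Or.inl (hpD hxp))))
    have hxW : x ∈ W \ L.podUnion pod := ⟨L.region_subset (h𝒪 hZ) hx, hxp⟩
    obtain ⟨y, hy, z, hz, hzp, hyz⟩ := (L.region_conn Z (h𝒪 hZ)).exists_adj_compOf (h𝒪p Z hZ)
      hx hxp
    have hyQ : y ∈ compOf G (W \ L.podUnion pod) x :=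
      compOf_mono (Set.sdiff_subset_sdiff_left (L.region_subset (h𝒪 hZ))) hy
    obtain ⟨c, hc, hca, k, hk, hzk⟩ := hch _ x hxW rfl y hyQ z hzp hyz
    rcases hca with rfl | rfl
    · have hmem : x ∈ reachSet L pod 𝒪 ch 0 (L.rank Z) :=
        ⟨hxp, Z, hZ, rfl, hx, y, hy, z, hz, hyz, hc, k, hk, hzk⟩
      rcases Nat.mod_two_eq_zero_or_one (L.rank Z) with hm | hm
      · exact Or.inl (Or.inl (Or.inl (Or.inr ⟨_, ⟨_, hm, rfl⟩, hmem⟩)))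
      · exact Or.inl (Or.inl (Or.inr ⟨_, ⟨_, hm, rfl⟩, hmem⟩))
    · have hmem : x ∈ reachSet L pod 𝒪 ch 1 (L.rank Z) :=
        ⟨hxp, Z, hZ, rfl, hx, y, hy, z, hz, hyz, hc, k, hk, hzk⟩
      rcases Nat.mod_two_eq_zero_or_one (L.rank Z) with hm | hm
      · exact Or.inl (Or.inr ⟨_, ⟨_, hm, rfl⟩, hmem⟩)
      · exact Or.inr ⟨_, ⟨_, hm, rfl⟩, hmem⟩

end Layout.IsPodFamily

end Pockets

/-! ### Walks along few clusters -/

section Scattering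

variable {V : Type u} {G : SimpleGraph V} {W : Set V} {𝓡 : Set (Set V)}

/-- There is a walk whose vertex sequence is the concatenation of at most `k` safe sequences. -/
def SafeWalk (G : SimpleGraph V) (𝒞 : Set (Set V)) (R : Set V) (k : ℕ) (a b : V) : Prop :=
  ∃ p : G.Walk a b, ∃ M : List (List V), M.length ≤ k ∧ p.support = M.flatten ∧
    ∀ l ∈ M, IsSafe 𝒞 R l

theorem IsSafe.sublist {𝒞 : Set (Set V)} {R : Set V} {l l' : List V} (h : IsSafe 𝒞 R l)
    (hl : l'.Sublist l) : IsSafe 𝒞 R l' :=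
  h.imp (fun ⟨C, hC, h⟩ => ⟨C, hC, fun v hv => h v (hl.subset hv)⟩)
    fun h v hv => h v (hl.subset hv)

/-- Shortcutting a walk leaves a sublist of its vertex sequence. Such a sublist inherits the blocks,
and the empty ones are dropped. -/
theorem List.Sublist.exists_flatten {α : Type*} {M : List (List α)} {l : List α}
    (h : l.Sublist M.flatten) : ∃ M' : List (List α), l = M'.flatten ∧ M'.length ≤ M.length ∧
      ∀ l' ∈ M', l' ≠ [] ∧ ∃ m ∈ M, l'.Sublist m := by
  induction M generalizing l with
  | nil => exact ⟨[], by simpa using h, le_rfl, by simp⟩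
  | cons m M ih =>
    rw [List.flatten_cons, List.sublist_append_iff] at h
    obtain ⟨l₁, l₂, rfl, h₁, h₂⟩ := h
    obtain ⟨M', rfl, hlen, hM'⟩ := ih h₂
    have hM'' : ∀ l' ∈ M', l' ≠ [] ∧ ∃ m' ∈ m :: M, l'.Sublist m' := fun l' hl' =>
      ⟨(hM' l' hl').1, (hM' l' hl').2.imp fun _ h => ⟨List.mem_cons_of_mem _ h.1, h.2⟩⟩
    by_cases hl : l₁ = []
    · exact ⟨M', by simp [hl], by rw [List.length_cons]; omega, hM''⟩
    · refine ⟨l₁ :: M', by simp, by simpa using hlen, fun l' hl' => ?_⟩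
      rcases List.mem_cons.1 hl' with rfl | hl'
      · exact ⟨hl, m, List.mem_cons_self, h₁⟩
      · exact hM'' l' hl'

namespace SafeWalk

variable {𝒞 : Set (Set V)} {R : Set V} {k l : ℕ} {a b c d : V}

theorem mono (h : SafeWalk G 𝒞 R k a b) (hkl : k ≤ l) : SafeWalk G 𝒞 R l a b := by
  obtain ⟨p, M, hM, h⟩ := h
  exact ⟨p, M, hM.trans hkl, h⟩

theorem symm (h : SafeWalk G 𝒞 R k a b) : SafeWalk G 𝒞 R k b a := by
  obtain ⟨p, M, hM, hp, hs⟩ := h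
  refine ⟨p.reverse, (M.map List.reverse).reverse, by simpa using hM, ?_, fun m hm => ?_⟩
  · rw [SimpleGraph.Walk.support_reverse, hp, List.reverse_flatten]
  · rw [List.mem_reverse, List.mem_map] at hm
    obtain ⟨m', hm', rfl⟩ := hm
    refine (hs m' hm').imp (fun ⟨C, hC, h⟩ => ⟨C, hC, fun v hv => h v (List.mem_reverse.1 hv)⟩)
      fun h v hv => h v (List.mem_reverse.1 hv)

theorem comp_adj (h : SafeWalk G 𝒞 R k a b) (hbc : G.Adj b c) (h' : SafeWalk G 𝒞 R l c d) :
    SafeWalk G 𝒞 R (k + l) a d := by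
  obtain ⟨p, M, hM, hp, hs⟩ := h
  obtain ⟨q, M', hM', hq, hs'⟩ := h'
  refine ⟨p.append (SimpleGraph.Walk.cons hbc q), M ++ M', ?_, ?_, fun m hm => ?_⟩
  · rw [List.length_append]; omega
  · rw [SimpleGraph.Walk.support_append, SimpleGraph.Walk.support_cons, List.tail_cons, hp, hq,
      List.flatten_append]
  · exact (List.mem_append.1 hm).elim (hs m) (hs' m)

theorem trans (h : SafeWalk G 𝒞 R k a b) (h' : SafeWalk G 𝒞 R l b c) :
    SafeWalk G 𝒞 R (k + l) a c := by
  obtain ⟨p, M, hM, hp, hs⟩ := h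
  obtain ⟨q, M', hM', hq, hs'⟩ := h'
  obtain ⟨M'', hq', hlen, hM''⟩ := List.Sublist.exists_flatten
    (show q.support.tail.Sublist M'.flatten from hq ▸ List.tail_sublist _)
  refine ⟨p.append q, M ++ M'', ?_, ?_, fun m hm => ?_⟩
  · rw [List.length_append]; omega
  · rw [SimpleGraph.Walk.support_append, hp, hq', List.flatten_append]
  · rcases List.mem_append.1 hm with hm | hm
    · exact hs m hm
    · obtain ⟨-, m', hm', hsub⟩ := hM'' m hm
      exact (hs' m' hm').sublist hsub

theorem of_isConnectedSet {T : Set V} (hT : IsConnectedSet G T)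
    (hsafe : (∃ C ∈ 𝒞, T ⊆ C) ∨ ∀ v ∈ T, v ∈ R ∧ v ∉ ⋃₀ 𝒞) (ha : a ∈ T) (hb : b ∈ T) :
    SafeWalk G 𝒞 R 1 a b := by
  obtain ⟨p, hp⟩ := hT.exists_walk ha hb
  refine ⟨p, [p.support], by simp, by simp, fun m hm => ?_⟩
  rw [List.mem_singleton] at hm
  subst hm
  exact hsafe.imp (fun ⟨C, hC, h⟩ => ⟨C, hC, fun v hv => h (hp v hv)⟩) fun h v hv => h v (hp v hv)

theorem safelyJoined (h : SafeWalk G 𝒞 R k a b) : SafelyJoined G 𝒞 R k a b := by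
  classical
  obtain ⟨p, M, hM, hp, hs⟩ := h
  obtain ⟨M', hp', hlen, hM'⟩ := List.Sublist.exists_flatten
    (show p.bypass.support.Sublist M.flatten from hp ▸ p.support_bypass_sublist_support)
  refine ⟨p.bypass, p.bypass_isPath, M', hlen.trans hM, hp', fun m hm => ?_⟩
  obtain ⟨h1, m', hm', hsub⟩ := hM' m hm
  exact ⟨h1, (hs m' hm').sublist hsub⟩

/-- If the vertices of `A` inside a connected set have few colours, one can go from one colour to
another without returning to a colour. -/
theorem of_colors {S A : Set V} {color : V → V} {s e : ℕ}
    (hsame : ∀ x ∈ S, x ∈ A → ∀ y ∈ S, y ∈ A → color x = color y → SafeWalk G 𝒞 R s x y)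
    (hun : ∀ K ⊆ S, IsConnectedSet G K → (∀ x ∈ K, x ∉ A) → ∀ x ∈ K, ∀ y ∈ K,
      SafeWalk G 𝒞 R e x y) (N : ℕ) {T : Set V} (hTS : T ⊆ S) (hT : IsConnectedSet G T)
    (t : Finset V) (ht : t.card ≤ N) (hcol : ∀ x ∈ T, x ∈ A → color x ∈ t) {x y : V} (hx : x ∈ T)
    (hy : y ∈ T) : SafeWalk G 𝒞 R (N * s + (N + 1) * e) x y := by
  classical
  induction N generalizing T t x y with
  | zero =>
    have ht0 : t = ∅ := Finset.card_eq_zero.1 (by omega)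
    subst ht0
    simpa using hun T hTS hT (fun z hz hzA => by simpa using hcol z hz hzA) x hx y hy
  | succ N ih =>
    have harith : (N + 1) * s + (N + 1 + 1) * e = e + (s + (N * s + (N + 1) * e)) := by ring
    -- starting in a coloured vertex
    have main : ∀ z ∈ T, z ∈ A → SafeWalk G 𝒞 R (s + (N * s + (N + 1) * e)) z y := by
      intro z hz hzA
      by_cases hyc : y ∈ A ∧ color y = color z
      · exact (hsame z (hTS hz) hzA y (hTS hy) hyc.1 hyc.2.symm).mono (by omega)
      -- The component of `y` after deleting the colour of `z` has one colour fewer and is adjacent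
      -- to a vertex `z'` of that colour. One passes from `z` to `z'` and never returns to this
      -- colour.
      · let P : Set V := {v | v ∈ A ∧ color v = color z}
        obtain ⟨y', hy', z', hz', hzP, hyz⟩ := hT.exists_adj_compOf (P := P) ⟨z, hz, hzA, rfl⟩
          hy hyc
        have h1 := ih (compOf_subset.trans (Set.sdiff_subset.trans hTS))
          (isConnectedSet_compOf (G := G) (S := T \ P) ⟨hy, hyc⟩) (t.erase (color z))
          (by rw [Finset.card_erase_of_mem (hcol z hz hzA)]; omega)
          (fun v hv hvA => Finset.mem_erase.2 ⟨fun h => (compOf_subset hv).2 ⟨hvA, h⟩,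
            hcol v (compOf_subset hv).1 hvA⟩) hy' (mem_compOf_self ⟨hy, hyc⟩)
        exact (hsame z (hTS hz) hzA z' (hTS hz') hzP.1 hzP.2.symm).comp_adj hyz.symm h1
    by_cases hxA : x ∈ A
    · refine (main x hx hxA).mono ?_
      omega
    · by_cases hTA : (T ∩ A).Nonempty
      · obtain ⟨x', hx', z, hz, hzA, hxz⟩ := hT.exists_adj_compOf hTA hx hxA
        refine ((hun _ (compOf_subset.trans (Set.sdiff_subset.trans hTS))
          (isConnectedSet_compOf (G := G) (S := T \ A) ⟨hx, hxA⟩)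
          (fun v hv => (compOf_subset hv).2) x (mem_compOf_self ⟨hx, hxA⟩) x' hx').comp_adj hxz
          (main z hz hzA)).mono ?_
        omega
      · refine (hun T hTS hT (fun v hv hvA => hTA ⟨v, hv, hvA⟩) x hx y hy).mono ?_
        omega

end SafeWalk

/-- The clusters of a cluster map. -/
def clustersOf (D : Set V) (f : V → V) : Set (Set V) :=
  {C | ∃ x ∈ D, C = {y | y ∈ D ∧ f y = f x}}

theorem sUnion_clustersOf (D : Set V) (f : V → V) : ⋃₀ clustersOf D f = D := by
  ext x
  constructor
  · rintro ⟨_, ⟨y, -, rfl⟩, hx⟩; exact hx.1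
  · exact fun hx => ⟨_, ⟨x, hx, rfl⟩, hx, rfl⟩

namespace IsClusterMap

open Layout

variable {L : Layout G W 𝓡} {pod : ℕ → ℕ → Set V} {D : Set V} {f : V → V}

theorem safeWalk_of_eq (hf : IsClusterMap L pod D f) (R : Set V) {x y : V} (hx : x ∈ D)
    (hy : y ∈ D) (hxy : f y = f x) : SafeWalk G (clustersOf D f) R 1 x y :=
  SafeWalk.of_isConnectedSet (hf.conn x hx) (Or.inl ⟨_, ⟨x, hx, rfl⟩, subset_rfl⟩) ⟨hx, rfl⟩
    ⟨hy, hxy⟩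

/-- Moving along a chain of pods. -/
theorem safeWalk_chain (h : L.IsPodFamily 0 pod) (hf : IsClusterMap L pod D f)
    (hpD : L.podUnion pod ⊆ D) (R : Set V) {c : ℕ} (hc : c < L.n) (d : ℕ) {k : ℕ}
    (hk : k + d ≤ L.height c) {x y : V} (hx : x ∈ D) (hy : y ∈ D)
    (hxk : ∃ z ∈ pod c k, f x = f z) (hyk : ∃ z ∈ pod c (k + d), f y = f z) :
    SafeWalk G (clustersOf D f) R (d + 1) x y := by
  have hpod : ∀ k ≤ L.height c, ∀ z ∈ pod c k, z ∈ D := fun k hk z hz => hpD ⟨c, hc, k, hk, hz⟩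
  obtain ⟨z, hz, hxz⟩ := hxk
  induction d generalizing k x z with
  | zero =>
    obtain ⟨z', hz', hyz⟩ := hyk
    refine hf.safeWalk_of_eq R hx hy ?_
    rw [hxz, hyz]
    exact hf.pod_eq c hc k hk z hz z' hz' (hpod k hk z hz)
  | succ d ih =>
    obtain ⟨-, -, u, hu, -, huv⟩ := (h.isPod c hc (k + 1) (Nat.zero_le _) (by omega)).2.2.2.2.2
      (by omega)
    have hv := h.exit_mem c hc k (Nat.zero_le _) (by omega)
    have h1 := hf.safeWalk_of_eq R hx (hpod k (by omega) _ hv) (by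
      rw [hxz]
      exact hf.pod_eq c hc k (by omega) z hz _ hv (hpod k (by omega) z hz))
    have h2 := ih (k := k + 1) (by omega) (hpod (k + 1) (by omega) u hu)
      (by rwa [show k + 1 + d = k + (d + 1) by omega]) u hu rfl
    exact (h1.comp_adj huv.symm h2).mono (by omega)

/-- Inside a region and outside of the pods, few clusters are met. -/
theorem safeWalk_pocket (h : L.IsPodFamily 0 pod) (hf : IsClusterMap L pod D f)
    (hQ : ClusterProp D f (IsPodFamily.GrowthProp L pod 4)) {R : Set V} (hR : R ∈ 𝓡) {K : Set V}
    (hKR : K ⊆ R) (hK : IsConnectedSet G K) (hKp : ∀ x ∈ K, x ∉ L.podUnion pod) {x y : V}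
    (hx : x ∈ K) (hy : y ∈ K) : SafeWalk G (clustersOf D f) R 89 x y := by
  classical
  have hKW : K ⊆ W \ L.podUnion pod := fun z hz => ⟨L.region_subset hR (hKR hz), hKp z hz⟩
  obtain ⟨a, ha⟩ := h.exists_pocket_chain (compOf G (W \ L.podUnion pod) x)
  replace ha := ha x (hKW hx) rfl
  have hpt : ∀ c k, ∃ z, c < L.n → k ≤ L.height c → z ∈ pod c k := by
    intro c k
    by_cases hck : c < L.n ∧ k ≤ L.height c
    · obtain ⟨z, hz⟩ := (h.isPod c hck.1 k (Nat.zero_le _) hck.2).1.nonempty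
      exact ⟨z, fun _ _ => hz⟩
    · exact ⟨L.w 0, fun h1 h2 => absurd ⟨h1, h2⟩ hck⟩
  choose pt hpt using hpt
  let r := L.rank R
  -- Two chains, and 22 levels: a cluster vertex and a pod vertex of the same cluster differ by at
  -- most 10 levels, and the region itself occupies levels `r` and `r + 1`.
  let t : Finset V := (({a, a + 1} : Finset ℕ) ×ˢ Finset.Icc (r - 10) (r + 11)).image
    fun q => f (pt q.1 q.2)
  have ht : t.card ≤ 44 := by
    refine Finset.card_image_le.trans ?_
    rw [Finset.card_product, Nat.card_Icc]
    have : ({a, a + 1} : Finset ℕ).card ≤ 2 := Finset.card_le_two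
    calc _ ≤ 2 * 22 := Nat.mul_le_mul this (by omega)
      _ = 44 := rfl
  have := SafeWalk.of_colors (G := G) (𝒞 := clustersOf D f) (R := R) (S := K) (A := D) (color := f)
    (s := 1) (e := 1) (fun x _ hx y _ hy hxy => hf.safeWalk_of_eq R hx hy hxy.symm)
    (fun F hF hFc hFD x hx y hy => SafeWalk.of_isConnectedSet hFc
      (Or.inr fun v hv => ⟨hKR (hF hv), by rw [sUnion_clustersOf]; exact hFD v hv⟩) hx hy)
    44 subset_rfl hK t ht ?_ hx hy
  · simpa using this
  · intro v hv hvD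
    obtain ⟨z₀, hz₀, hvz₀, hzp₀⟩ := hf.meets v hvD
    -- From `v`, the cluster reaches its first pod without leaving the pocket, so this pod is on one
    -- of the two chains.
    obtain ⟨y, hy, z, ⟨hzD, hzv⟩, hzp, hyz⟩ := (hf.conn v hvD).exists_adj_compOf
      (P := L.podUnion pod) ⟨z₀, ⟨hz₀, hvz₀⟩, hzp₀⟩ ⟨hvD, rfl⟩ (hKp v hv)
    have hvQ : v ∈ compOf G (W \ L.podUnion pod) x := hK.subset_compOf hKW hx hv
    have hyQ : y ∈ compOf G (W \ L.podUnion pod) x := by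
      rw [← compOf_eq hvQ]
      exact compOf_mono (Set.sdiff_subset_sdiff_left fun z hz => hf.subset hz.1) hy
    obtain ⟨c, hc, hca, k, hk, hzk⟩ := ha y hyQ z hzp hyz
    obtain ⟨p, hp⟩ := hQ v hvD
    obtain ⟨-, p1, p2, -⟩ := hp v hvD rfl
    obtain ⟨p3, p4⟩ := (hp z hzD hzv).2.2.2 hzp
    have e1 := h.level_eq hc hk hzk
    have e2 := L.rank_le (hKR hv)
    have e3 := L.level_le_rank hR (hKR hv)
    refine Finset.mem_image.2 ⟨(c, k), Finset.mem_product.2 ⟨?_, Finset.mem_Icc.2 ?_⟩, ?_⟩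
    · rcases hca with rfl | rfl <;> simp
    · dsimp only [r]; omega
    · dsimp only
      rw [← hzv]
      exact hf.pod_eq c hc k hk z hzk _ (hpt c k hc hk) hzD

end IsClusterMap

end Scattering

/-! ### Assembly of the clustering and of the constants -/

section MainResult

variable {V : Type u} {G : SimpleGraph V} {W : Set V} {𝓡 : Set (Set V)}

open Layout IsPodFamily

namespace IsClusterMap

variable {L : Layout G W 𝓡} {pod : ℕ → ℕ → Set V} {D : Set V} {f : V → V}

theorem safeWalk_region (h : L.IsPodFamily 0 pod) (hf : IsClusterMap L pod D f)
    (hpD : L.podUnion pod ⊆ D) (hQ : ClusterProp D f (GrowthProp L pod 4))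
    (B : ∀ g, L.Band pod g)
    (hB : ∀ g, ∀ s ∈ (B g).St, (B g).Y s ⊆ D ∧ ValuesLE f ((B g).Y s) 12) {R : Set V}
    (hR : R ∈ 𝓡) {a b : V} (ha : a ∈ R) (hb : b ∈ R) :
    SafeWalk G (clustersOf D f) R 2393 a b := by
  classical
  let g := L.rank R / 2
  have hg : L.rank R / 2 = g := rfl
  obtain ⟨t₀, ht₀, ht₀'⟩ := (B g).exists_finset_region h hR hg
  -- The hub clusters: at most two pieces are relevant to `R`, with at most 12 clusters on each.
  obtain ⟨t, ht, htf⟩ := ValuesLE.of_cover (f := f) (k := 12) (l := 2)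
    (A := {v | ∃ s ∈ t₀.filter (· ∈ (B g).St), v ∈ (B g).Y s})
    (t₀.filter (· ∈ (B g).St)) ((Finset.card_filter_le _ _).trans ht₀) (fun s => (B g).Y s)
    (fun s hs => (hB g s (Finset.mem_filter.1 hs).2).2) (fun _ hx => hx)
  -- The chain through `x` also meets a relevant piece, and both levels lie between `2 * g` and `2 *
  -- g + 2`. Following the chain therefore uses at most three clusters.
  have hhub : ∀ x, ∃ v, x ∈ R → x ∈ L.podUnion pod →
      v ∈ D ∧ f v ∈ t ∧ SafeWalk G (clustersOf D f) R 3 x v := by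
    intro x
    by_cases hx : x ∈ R ∧ x ∈ L.podUnion pod
    swap
    · exact ⟨x, fun h1 h2 => absurd ⟨h1, h2⟩ hx⟩
    obtain ⟨hxR, c, hc, k, hk, hxk⟩ := hx
    have hcR : c ∈ hits L pod R := ⟨hc, k, hk, x, hxR, hxk⟩
    obtain ⟨s, hs, hsc, hcb⟩ := (B g).cover R hR hg c hcR
    have hst := ht₀' s hs c hcR hsc hcb
    obtain ⟨-, k', hk', v, hvY, hvk'⟩ := (B g).mem_hits s hs c hsc hcb
    have hvD := (hB g s hs).1 hvY
    have hxD := hpD ⟨c, hc, k, hk, hxk⟩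
    refine ⟨v, fun _ _ => ⟨hvD, htf v ⟨s, Finset.mem_filter.2 ⟨hst, hs⟩, hvY⟩, ?_⟩⟩
    have e1 := h.level_eq hc hk hxk
    have e2 := h.level_eq hc hk' hvk'
    have e3 := L.rank_le hxR
    have e4 := L.level_le_rank hR hxR
    have e5 := (B g).level_mem s hs v hvY
    have e6 := (B g).rank_X s hs
    rcases le_total k k' with hkk | hkk
    · obtain ⟨d, rfl⟩ := Nat.exists_eq_add_of_le hkk
      exact (hf.safeWalk_chain h hpD R hc d hk' hxD hvD ⟨x, hxk, rfl⟩ ⟨v, hvk', rfl⟩).mono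
        (by omega)
    · obtain ⟨d, rfl⟩ := Nat.exists_eq_add_of_le hkk
      exact (hf.safeWalk_chain h hpD R hc d hk hvD hxD ⟨v, hvk', rfl⟩ ⟨x, hxk, rfl⟩).symm.mono
        (by omega)
  choose hub hhub using hhub
  -- Here `7 = 3 + 1 + 3`: to the hub, inside its cluster, and back. The 89 is the bound outside the
  -- pods.
  have := SafeWalk.of_colors (G := G) (𝒞 := clustersOf D f) (R := R) (S := R)
    (A := L.podUnion pod) (color := fun x => f (hub x)) (s := 7) (e := 89) ?_
    (fun K hKR hK hKp x hx y hy => hf.safeWalk_pocket h hQ hR hKR hK hKp hx hy) 24 subset_rfl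
    (L.region_conn R hR) t ht (fun x hx hxp => (hhub x hx hxp).2.1) ha hb
  · exact this
  · intro x hx hxp y hy hyp hxy
    obtain ⟨h1, -, h3⟩ := hhub x hx hxp
    obtain ⟨h1', -, h3'⟩ := hhub y hy hyp
    exact (h3.trans ((hf.safeWalk_of_eq R h1 h1' hxy.symm).trans h3'.symm))

/-- All chains end in `w 0`, so the pods form a connected set, and every cluster meets it. -/
theorem isConnectedSet_domain (h : L.IsPodFamily 0 pod) (hf : IsClusterMap L pod D f)
    (hpD : L.podUnion pod ⊆ D) : IsConnectedSet G D := by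
  have hP : IsConnectedSet G (L.podUnion pod) := by
    have h1 : L.podUnion pod = ⋃₀ {T | ∃ c < L.n, T = chainFrom L pod c 0} := by
      ext x
      constructor
      · rintro ⟨c, hc, k, hk, hx⟩
        exact ⟨_, ⟨c, hc, rfl⟩, k, Nat.zero_le _, hk, hx⟩
      · rintro ⟨_, ⟨c, hc, rfl⟩, k, -, hk, hx⟩
        exact ⟨c, hc, k, hk, hx⟩
    rw [h1]
    refine isConnectedSet_sUnion (x := L.w 0) ?_ ⟨_, 0, L.n_pos, rfl⟩
    rintro _ ⟨c, hc, rfl⟩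
    exact ⟨h.isConnectedSet_chainFrom hc le_rfl (Nat.zero_le _),
      0, le_rfl, Nat.zero_le _, by rw [h.pod_zero hc]; rfl⟩
  have := hP.union_sUnion (clustersOf D f) (by
    rintro _ ⟨x, hx, rfl⟩
    obtain ⟨y, hy, hyx, hyp⟩ := hf.meets x hx
    exact ⟨hf.conn x hx, y, hyp, y, ⟨hy, hyx⟩, Or.inl rfl⟩)
  rwa [sUnion_clustersOf, Set.union_eq_self_of_subset_left hpD] at this

end IsClusterMap

theorem exists_clustering [Finite V] (E : PlaneEmbedding (G.induce W)) (hW : IsConnectedSet G W)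
    (h𝓡 : ∀ R ∈ 𝓡, IsConnectedSet G R) (hcover : ⋃₀ 𝓡 = W) :
    ∃ 𝒞 : Set (Set V), IsPartialClustering G W 𝒞 ∧
      ((∀ R ∈ 𝓡, IsOuterRegion E R → R ⊆ ⋃₀ 𝒞) ∧ IsConnectedSet G (⋃₀ 𝒞)) ∧
      (∀ C ∈ 𝒞, HasRegionDiamLE G 𝓡 C 92) ∧
      (∀ R ∈ 𝓡, ∀ a ∈ R, ∀ b ∈ R, SafelyJoined G 𝒞 R 2393 a b) := by
  obtain ⟨L, hL⟩ := exists_layout E hW h𝓡 hcover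
  obtain ⟨pod, h⟩ := L.exists_isPodFamily
  let B : ∀ g, L.Band pod g := fun g => (h.nonempty_band g).some
  obtain ⟨D₀, f₀, hf₀, hpD₀, hQ₀, hB₀⟩ := h.exists_core B
  -- Outer regions are among those covered, since every boundary vertex lies in the first pod of its
  -- chain.
  obtain ⟨D, f, hf, hDD, hff, hcov, hQ⟩ := h.exists_cover
    (𝒪 := {R | R ∈ 𝓡 ∧ (R ∩ L.podUnion pod).Nonempty}) (fun _ hR => hR.1) (fun _ hR => hR.2) hf₀
    hpD₀ hQ₀
  have hpD := hpD₀.trans hDD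
  have hB : ∀ g, ∀ s ∈ (B g).St, (B g).Y s ⊆ D ∧ ValuesLE f ((B g).Y s) 12 := fun g s hs =>
    ⟨(hB₀ g s hs).1.trans hDD, (hB₀ g s hs).2.congr (hB₀ g s hs).1 hff⟩
  refine ⟨clustersOf D f, ⟨?_, ?_⟩, ⟨fun R hR hout => ?_, ?_⟩, ?_, fun R hR a ha b hb =>
    (hf.safeWalk_region h hpD hQ B hB hR ha hb).safelyJoined⟩
  · rintro _ ⟨x, hx, rfl⟩
    exact ⟨fun y hy => hf.subset hy.1, hf.conn x hx⟩
  · rintro _ ⟨x, hx, rfl⟩ _ ⟨y, hy, rfl⟩ hne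
    refine Set.disjoint_left.2 fun z hz hz' => hne ?_
    rw [← hz.2, ← hz'.2]
  · rw [sUnion_clustersOf]
    obtain ⟨v, hvR, hv⟩ := hout
    obtain ⟨c, hc, hcv⟩ := hL v hv
    refine hcov R ⟨hR, v.1, hvR, c, hc, L.height c, le_rfl, ?_⟩
    rw [← hcv]
    exact h.w_mem c hc (Nat.zero_le _)
  · rw [sUnion_clustersOf]
    exact hf.isConnectedSet_domain h hpD
  · rintro _ ⟨x, hx, rfl⟩
    obtain ⟨p, hp⟩ := hQ x hx
    exact hasRegionDiamLE_of_nearRegion (k := 45) fun y hy => (hp y hy.1 hy.2).1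

end MainResult

theorem mainTheorem3 :
    ∃ α β : ℕ, α ≤ 170 ∧ β ≤ 3744 ∧
      ∃ clusterOuter : ∀ (V : Type u) (G : SimpleGraph V) (W : Set V),
          PlaneEmbedding (G.induce W) → Set (Set V) → Set (Set V),
        ∀ (V : Type u) [Finite V] (G : SimpleGraph V) (W : Set V)
          (E : PlaneEmbedding (G.induce W)) (𝓡 : Set (Set V)),
          IsConnectedSet G W →
          (∀ R ∈ 𝓡, IsConnectedSet G R) →
          ⋃₀ 𝓡 = W →
          IsPartialClustering G W (clusterOuter V G W E 𝓡) ∧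
          ((∀ R ∈ 𝓡, IsOuterRegion E R → R ⊆ ⋃₀ clusterOuter V G W E 𝓡) ∧
            IsConnectedSet G (⋃₀ clusterOuter V G W E 𝓡)) ∧
          (∀ C ∈ clusterOuter V G W E 𝓡, HasRegionDiamLE G 𝓡 C α) ∧
          (∀ R ∈ 𝓡, ∀ a ∈ R, ∀ b ∈ R,
            SafelyJoined G (clusterOuter V G W E 𝓡) R β a b) := by
  classical
  -- The procedure is a choice for each input for which a clustering exists. The empty set is a
  -- default for all other inputs.
  refine ⟨92, 2393, by norm_num, by norm_num, fun V G W E 𝓡 =>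
    if h : ∃ 𝒞 : Set (Set V), IsPartialClustering G W 𝒞 ∧
      ((∀ R ∈ 𝓡, IsOuterRegion E R → R ⊆ ⋃₀ 𝒞) ∧ IsConnectedSet G (⋃₀ 𝒞)) ∧
      (∀ C ∈ 𝒞, HasRegionDiamLE G 𝓡 C 92) ∧
      (∀ R ∈ 𝓡, ∀ a ∈ R, ∀ b ∈ R, SafelyJoined G 𝒞 R 2393 a b) then h.choose else ∅, ?_⟩
  intro V _ G W E 𝓡 hW h𝓡 hcover
  have h := exists_clustering E hW h𝓡 hcover
  simp only [dif_pos h]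
  exact h.choose_spec
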